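/- Let $\Bbbk$ be a field of characteristic $0$, let $X$ be a well-ordered set and $N:X\times X\to\mathbb Z_+$ a function; write $\partial^{(s)}=\partial^s/s!$. An associative conformal algebra is a $\Bbbk[\partial]$-module $C$ with bilinear operations $(\cdot\,{}_{(n)}\,\cdot)$, $n\in\mathbb Z_+$, such that for all $x,y,z\in C$ and $n,m\in\mathbb Z_+$: $x_{(n)}y=0$ for all sufficiently large $n$; $(\partial x)_{(n)}y=-n\,x_{(n-1)}y$; $x_{(n)}\partial y=\partial(x_{(n)}y)+n\,x_{(n-1)}y$; and $x_{(n)}(y_{(m)}z)=\sum_{s=0}^{n}\binom ns (x_{(s)}y)_{(n+m-s)}z$. Put $\{x_{(n)}y\}=\sum_{s\ge0}(-1)^{n+s}\partial^{(s)}(x_{(n+s)}y)$. Let $\mathrm{Conf}(X,N)$ be the free associative conformal algebra generated by $X$ with locality function $N$, i.e. with $a_{(n)}b=0$ for $a,b\in X$, $n\ge N(a,b)$. For $S\subseteq \mathrm{Conf}(X,N)$ let $\mathrm{Conf}(X,N\mid S)$ be its quotient by the ideal generated by $S$. Let $A(X)$ be the associative algebra generated by $\partial,L_n^a,R_n^a$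 ($a\in X$, $n\in\mathbb Z_+$) with the relations $$L_n^a\partial=\partial L_n^a+nL_{n-1}^a,\qquad R_n^a\partial=\partial R_n^a+nR_{n-1}^a,\qquad R_m^bL_n^a=L_n^aR_m^b. \tag{A}$$ It has the linear basis $B$ of all words $\partial^sL_{n_1}^{a_1}\cdots L_{n_k}^{a_k}R_{m_1}^{b_1}\cdots R_{m_t}^{b_t}$, so the free $A(X)$-module generated by $X$ has the basis $\{ux: u\in B,\ x\in X\}$. The algebra $A(X)$ acts on $\mathrm{Conf}(X,N)$ by $\partial$, $L_n^af=a_{(n)}f$, $R_n^af=\{f_{(n)}a\}$. Order the letters by $\partial<L_n^a<R_m^b$, and $L_n^a<L_m^b$ (respectively $R_n^a<R_m^b$) if $n<m$, or $n=m$ and $a<b$. Order words in these letters first by their degree in the letters $R_n^a$, then by the degree-lexicographic order; put $ux\prec vy$ if $u\prec v$, or $u=v$ and $x<y$. Consider the relations, for $a,b,c\in X$: $$L_n^ab=0\quad(n\ge N(a,b)), \tag{1}$$ $$R_n^ba=\sum_{s=0}^{N(a,b)-n-1}(-1)^{n+s}\partial^{(s)}L_{n+s}^ab\quad(n\ge0),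 \tag{2}$$ $$L_n^aL_m^bu=\sum_{q\ge1}(-1)^{q+1}\binom nq L_{n-q}^aL_{m+q}^bu\quad(n\ge N(a,b),\ m\ge0), \tag{3}$$ where in (3) $u=L_{m_1}^{c_1}\cdots L_{m_k}^{c_k}c$ with arbitrary $k,m_i\in\mathbb Z_+$, $c_i\in X$. A set $T$ of elements of the free $A(X)$-module, written in the basis $\{ux\}$, is called a Gröbner–Shirshov basis (GSB) of an $A(X)$-module if, in the free module generated by $X$ over the free associative algebra in the letters $\partial,L_n^a,R_n^a$, all compositions of intersection and of inclusion among the relations (A) and the elements of $T$ are trivial: the composition at a word $w$ is a linear combination of elements $afbx$ and $at$, where $f$ is a relation (A), $t\in T$, $a,b$ are words and $x\in X$, all of whose principal words are $\prec w$ (for compositions within (A): a linear combination of elements $afb$ of this kind in the free associative algebra). A word $ux$ is called reduced with respect to $T$ if the principal word of no nonzero element of $T$ is a subword of $ux$. Let $S\subseteq\mathrm{Conf}(X,N)$ be a set of conformal polynomials, considered as a set of elements of the free $A(X)$-module generated by $X$: that is, let $T$ be any set of elements of this free module, written in the basis $\{ux\}$, whose set of values in $\mathrm{Conf}(X,N)$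 is $S$ (for example, write every element of $S$ through the words below). "$S$-reduced" means reduced with respect to $T$. Then the following conditions are equivalent: 1. $T$ together with (1), (2) and (3) is a GSB of an $A(X)$-module; 2. the $S$-reduced words of the form $$\partial^sL_{n_1}^{a_1}L_{n_2}^{a_2}\cdots L_{n_k}^{a_k}a_{k+1},\qquad k,s\in\mathbb Z_+,\ a_i\in X,\ 0\le n_i<N(a_i,a_{i+1}),$$ form a linear basis of $\mathrm{Conf}(X,N\mid S)$ (i.e. the images of the elements $\partial^s(a_1{}_{(n_1)}(a_2{}_{(n_2)}\cdots(a_k{}_{(n_k)}a_{k+1})\cdots))$, indexed by these words, are linearly independent and span). -/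

import Mathlib

noncomputable section

universe u v w

/-! ## Associative conformal algebras

An `H`-module, `H = k[∂]`, is a `k`-module together with the `k`-linear operator `∂`. -/

/-- A `k`-module with a linear operator `∂` and bilinear products `(· ₙ ·)`, `n ∈ ℤ₊`. -/
class ConformalOps (k : Type u) (C : Type v) [Field k] [AddCommGroup C] [Module k C] where
  /-- the operator `∂` -/
  derOp : C →ₗ[k] C
  /-- the products `x ₙ y` -/
  nprodOp : ℕ → C →ₗ[k] C →ₗ[k] C

section Ops

variable (k : Type u) {C : Type v} [Field k] [AddCommGroup C] [Module k C] [ConformalOps k C]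

/-- The operator `∂`. -/
abbrev der : C →ₗ[k] C := ConformalOps.derOp

/-- The product `x ₙ y`. -/
abbrev nprod (n : ℕ) : C →ₗ[k] C →ₗ[k] C := ConformalOps.nprodOp n

end Ops

/-- Associative conformal algebras. For `n = 0` the terms with the factor `n` vanish, so the
truncated subtraction `n - 1` is harmless. -/
class AssocConformalAlgebra (k : Type u) (C : Type v) [Field k] [AddCommGroup C] [Module k C]
    extends ConformalOps k C where
  locality : ∀ x y : C, ∃ M : ℕ, ∀ n, M ≤ n → nprod k n x y = 0
  der_nprod : ∀ (n : ℕ) (x y : C), nprod k n (der k x) y = -((n : k) • nprod k (n - 1) x y)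
  nprod_der : ∀ (n : ℕ) (x y : C),
    nprod k n x (der k y) = der k (nprod k n x y) + (n : k) • nprod k (n - 1) x y
  assoc : ∀ (n m : ℕ) (x y z : C), nprod k n x (nprod k m y z) =
    ∑ s ∈ Finset.range (n + 1), (n.choose s : k) • nprod k (n + m - s) (nprod k s x y) z

/-- Homomorphisms: linear maps that respect `∂` and all the products. -/
structure IsConformalHom (k : Type u) {C : Type v} {D : Type w} [Field k]
    [AddCommGroup C] [Module k C] [ConformalOps k C]
    [AddCommGroup D] [Module k D] [ConformalOps k D] (f : C →ₗ[k] D) : Prop where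
  map_der : ∀ x, f (der k x) = der k (f x)
  map_nprod : ∀ n x y, f (nprod k n x y) = nprod k n (f x) (f y)

section Ideals

set_option linter.unusedSectionVars false

variable {k : Type u} {C : Type v} [Field k] [AddCommGroup C] [Module k C] [ConformalOps k C]

/-- (Two-sided, `∂`-invariant) ideals. -/
structure IsConformalIdeal (J : Submodule k C) : Prop where
  der_mem : ∀ x ∈ J, der k x ∈ J
  left_mem : ∀ (n : ℕ) (y : C), ∀ x ∈ J, nprod k n y x ∈ J
  right_mem : ∀ (n : ℕ) (y : C), ∀ x ∈ J, nprod k n x y ∈ J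

variable (k) in
/-- The ideal generated by a set. -/
def conformalIdealSpan (S : Set C) : Submodule k C :=
  sInf {J | IsConformalIdeal J ∧ S ⊆ J}

theorem conformalIdealSpan_le {S : Set C} {J : Submodule k C} (hJ : IsConformalIdeal J)
    (h : S ⊆ J) : conformalIdealSpan k S ≤ J :=
  sInf_le ⟨hJ, h⟩

theorem subset_conformalIdealSpan (S : Set C) : S ⊆ conformalIdealSpan k S := by
  intro x hx
  simp only [conformalIdealSpan, SetLike.mem_coe, Submodule.mem_sInf]
  exact fun J hJ => hJ.2 hx

theorem conformalIdealSpan_isIdeal (S : Set C) : IsConformalIdeal (conformalIdealSpan k S) where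
  der_mem x hx := by
    simp only [conformalIdealSpan, Submodule.mem_sInf] at hx ⊢
    exact fun J hJ => hJ.1.der_mem x (hx J hJ)
  left_mem n y x hx := by
    simp only [conformalIdealSpan, Submodule.mem_sInf] at hx ⊢
    exact fun J hJ => hJ.1.left_mem n y x (hx J hJ)
  right_mem n y x hx := by
    simp only [conformalIdealSpan, Submodule.mem_sInf] at hx ⊢
    exact fun J hJ => hJ.1.right_mem n y x (hx J hJ)

/-- The quotient by the ideal generated by `S`, with the induced operations. -/
instance quotConformalOps (S : Set C) : ConformalOps k (C ⧸ conformalIdealSpan k S) where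
  derOp := Submodule.mapQ _ _ (der k) (fun x hx => (conformalIdealSpan_isIdeal S).der_mem x hx)
  nprodOp n := Submodule.liftQ _
    { toFun := fun x => Submodule.mapQ _ _ (nprod k n x)
        (fun y hy => (conformalIdealSpan_isIdeal S).left_mem n x y hy)
      map_add' := fun x y => by ext z; simp
      map_smul' := fun c x => by ext z; simp }
    (fun x hx => by
      ext z
      simpa [Submodule.Quotient.mk_eq_zero] using
        (conformalIdealSpan_isIdeal S).right_mem n z x hx)

theorem quot_der_mk (S : Set C) (x : C) :
    der k (Submodule.Quotient.mk (p := conformalIdealSpan k S) x) =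
      Submodule.Quotient.mk (der k x) := rfl

theorem quot_nprod_mk (S : Set C) (n : ℕ) (x y : C) :
    nprod k n (Submodule.Quotient.mk (p := conformalIdealSpan k S) x) (Submodule.Quotient.mk y) =
      Submodule.Quotient.mk (nprod k n x y) := rfl

end Ideals

instance quotAssocConformalAlgebra {k : Type u} {C : Type v} [Field k] [AddCommGroup C]
    [Module k C] [AssocConformalAlgebra k C] (S : Set C) :
    AssocConformalAlgebra k (C ⧸ conformalIdealSpan k S) where
  toConformalOps := quotConformalOps S
  locality x y := by
    obtain ⟨x, rfl⟩ := Submodule.Quotient.mk_surjective _ x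
    obtain ⟨y, rfl⟩ := Submodule.Quotient.mk_surjective _ y
    obtain ⟨M, hM⟩ := AssocConformalAlgebra.locality (k := k) x y
    exact ⟨M, fun n hn => by rw [quot_nprod_mk, hM n hn]; rfl⟩
  der_nprod n x y := by
    obtain ⟨x, rfl⟩ := Submodule.Quotient.mk_surjective _ x
    obtain ⟨y, rfl⟩ := Submodule.Quotient.mk_surjective _ y
    simp only [quot_der_mk, quot_nprod_mk, AssocConformalAlgebra.der_nprod,
      Submodule.Quotient.mk_neg, Submodule.Quotient.mk_smul]
  nprod_der n x y := by
    obtain ⟨x, rfl⟩ := Submodule.Quotient.mk_surjective _ x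
    obtain ⟨y, rfl⟩ := Submodule.Quotient.mk_surjective _ y
    simp only [quot_der_mk, quot_nprod_mk, AssocConformalAlgebra.nprod_der,
      Submodule.Quotient.mk_add, Submodule.Quotient.mk_smul]
  assoc n m x y z := by
    obtain ⟨x, rfl⟩ := Submodule.Quotient.mk_surjective _ x
    obtain ⟨y, rfl⟩ := Submodule.Quotient.mk_surjective _ y
    obtain ⟨z, rfl⟩ := Submodule.Quotient.mk_surjective _ z
    simp only [quot_nprod_mk]
    rw [AssocConformalAlgebra.assoc]
    exact map_sum (Submodule.mkQ (conformalIdealSpan k S)) _ _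

/-! ## The free associative conformal algebra `Conf(X, N)` -/

/-- Nonassociative monomials in the generators `X` and the operations `∂`, `(· ₙ ·)`. -/
inductive ConfMon (X : Type v) : Type v
  | gen : X → ConfMon X
  | der : ConfMon X → ConfMon X
  | prod : ℕ → ConfMon X → ConfMon X → ConfMon X

/-- The absolutely free `k`-module with operations `∂`, `(· ₙ ·)` on the set `X`. -/
def PreConf (k : Type u) (X : Type v) [Field k] : Type (max u v) := ConfMon X →₀ k

section Free

variable (k : Type u) {X : Type v} [Field k]

instance : AddCommGroup (PreConf k X) := inferInstanceAs (AddCommGroup (ConfMon X →₀ k))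
instance : Module k (PreConf k X) := inferInstanceAs (Module k (ConfMon X →₀ k))

/-- A monomial as an element of the absolutely free object. -/
def PreConf.mon (p : ConfMon X) : PreConf k X := Finsupp.single p (1 : k)

instance : ConformalOps k (PreConf k X) where
  derOp := Finsupp.lmapDomain k k ConfMon.der
  nprodOp n := Finsupp.lsum k fun p => LinearMap.toSpanSingleton k ((ConfMon X →₀ k) →ₗ[k] _)
    (Finsupp.lmapDomain k k (ConfMon.prod n p))

/-- The relations of `Conf(X, N)`: the identities of associative conformal algebras and
`a ₙ b = 0` for `a, b ∈ X`, `n ≥ N a b`. -/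
inductive ConfRel (N : X → X → ℕ) : PreConf k X → Prop
  | der_nprod (n : ℕ) (f g : PreConf k X) :
      ConfRel N (nprod k n (der k f) g + (n : k) • nprod k (n - 1) f g)
  | nprod_der (n : ℕ) (f g : PreConf k X) :
      ConfRel N (nprod k n f (der k g) - (der k (nprod k n f g) + (n : k) • nprod k (n - 1) f g))
  | assoc (n m : ℕ) (f g h : PreConf k X) :
      ConfRel N (nprod k n f (nprod k m g h) -
        ∑ s ∈ Finset.range (n + 1), (n.choose s : k) • nprod k (n + m - s) (nprod k s f g) h)
  | locality (a b : X) (n : ℕ) (hn : N a b ≤ n) :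
      ConfRel N (nprod k n (PreConf.mon k (ConfMon.gen a)) (PreConf.mon k (ConfMon.gen b)))

/-- The free associative conformal algebra generated by `X` with locality function `N`. -/
abbrev Conf (N : X → X → ℕ) : Type (max u v) :=
  PreConf k X ⧸ conformalIdealSpan k {f : PreConf k X | ConfRel k N f}

variable (N : X → X → ℕ)

/-- The class of a monomial. -/
def Conf.mon (p : ConfMon X) : Conf k N := Submodule.Quotient.mk (PreConf.mon k p)

/-- The generators of `Conf(X, N)`. -/
def Conf.gen (a : X) : Conf k N := Conf.mon k N (ConfMon.gen a)

theorem preConf_der_mon (p : ConfMon X) :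
    der k (PreConf.mon k p) = PreConf.mon k (ConfMon.der p) :=
  Finsupp.mapDomain_single

theorem preConf_nprod_mon (n : ℕ) (p q : ConfMon X) :
    nprod k n (PreConf.mon k p) (PreConf.mon k q) = PreConf.mon k (ConfMon.prod n p q) := by
  change (Finsupp.lsum k (fun p => LinearMap.toSpanSingleton k ((ConfMon X →₀ k) →ₗ[k] _)
    (Finsupp.lmapDomain k k (ConfMon.prod n p))) (Finsupp.single p (1 : k)))
    (Finsupp.single q (1 : k)) = Finsupp.single _ (1 : k)
  simp

theorem preConf_induction {P : PreConf k X → Prop} (h0 : P 0)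
    (hadd : ∀ f g, P f → P g → P (f + g)) (hsmul : ∀ (c : k) f, P f → P (c • f))
    (hmon : ∀ p, P (PreConf.mon k p)) (f : PreConf k X) : P f := by
  refine Finsupp.induction_linear (motive := P) f h0 hadd fun p c => ?_
  have : (Finsupp.single p c : ConfMon X →₀ k) = c • Finsupp.single p (1 : k) := by simp
  rw [this]
  exact hsmul c _ (hmon p)

theorem Conf.mk_eq_zero_of_rel {f : PreConf k X} (h : ConfRel k N f) :
    (Submodule.Quotient.mk f : Conf k N) = 0 :=
  (Submodule.Quotient.mk_eq_zero _).2 (subset_conformalIdealSpan _ h)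

theorem Conf.der_nprod (n : ℕ) (x y : Conf k N) :
    nprod k n (der k x) y = -((n : k) • nprod k (n - 1) x y) := by
  obtain ⟨x, rfl⟩ := Submodule.Quotient.mk_surjective _ x
  obtain ⟨y, rfl⟩ := Submodule.Quotient.mk_surjective _ y
  have h := Conf.mk_eq_zero_of_rel k N (ConfRel.der_nprod n x y)
  rw [Submodule.Quotient.mk_add, Submodule.Quotient.mk_smul] at h
  exact eq_neg_of_add_eq_zero_left h

theorem Conf.nprod_der (n : ℕ) (x y : Conf k N) :
    nprod k n x (der k y) = der k (nprod k n x y) + (n : k) • nprod k (n - 1) x y := by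
  obtain ⟨x, rfl⟩ := Submodule.Quotient.mk_surjective _ x
  obtain ⟨y, rfl⟩ := Submodule.Quotient.mk_surjective _ y
  have h := Conf.mk_eq_zero_of_rel k N (ConfRel.nprod_der n x y)
  rw [Submodule.Quotient.mk_sub, Submodule.Quotient.mk_add, Submodule.Quotient.mk_smul] at h
  exact sub_eq_zero.1 h

theorem Conf.assoc (n m : ℕ) (x y z : Conf k N) : nprod k n x (nprod k m y z) =
    ∑ s ∈ Finset.range (n + 1), (n.choose s : k) • nprod k (n + m - s) (nprod k s x y) z := by
  obtain ⟨x, rfl⟩ := Submodule.Quotient.mk_surjective _ x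
  obtain ⟨y, rfl⟩ := Submodule.Quotient.mk_surjective _ y
  obtain ⟨z, rfl⟩ := Submodule.Quotient.mk_surjective _ z
  have h := Conf.mk_eq_zero_of_rel k N (ConfRel.assoc n m x y z)
  rw [Submodule.Quotient.mk_sub] at h
  refine (sub_eq_zero.1 h).trans ?_
  exact map_sum (Submodule.mkQ (conformalIdealSpan k {f : PreConf k X | ConfRel k N f})) _ _

/-- `x` and `y` are local to each other. -/
def Conf.IsLoc (x y : Conf k N) : Prop := ∃ M : ℕ, ∀ n, M ≤ n → nprod k n x y = 0

theorem Conf.isLoc_add_left {x x' y : Conf k N} (h : Conf.IsLoc k N x y)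
    (h' : Conf.IsLoc k N x' y) : Conf.IsLoc k N (x + x') y := by
  obtain ⟨M, hM⟩ := h
  obtain ⟨M', hM'⟩ := h'
  exact ⟨max M M', fun n hn => by simp [hM n (by omega), hM' n (by omega)]⟩

theorem Conf.isLoc_add_right {x y y' : Conf k N} (h : Conf.IsLoc k N x y)
    (h' : Conf.IsLoc k N x y') : Conf.IsLoc k N x (y + y') := by
  obtain ⟨M, hM⟩ := h
  obtain ⟨M', hM'⟩ := h'
  exact ⟨max M M', fun n hn => by simp [hM n (by omega), hM' n (by omega)]⟩

theorem Conf.isLoc_der_left {x y : Conf k N} (h : Conf.IsLoc k N x y) :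
    Conf.IsLoc k N (der k x) y := by
  obtain ⟨M, hM⟩ := h
  exact ⟨M + 1, fun n hn => by rw [Conf.der_nprod, hM (n - 1) (by omega), smul_zero, neg_zero]⟩

theorem Conf.isLoc_der_right {x y : Conf k N} (h : Conf.IsLoc k N x y) :
    Conf.IsLoc k N x (der k y) := by
  obtain ⟨M, hM⟩ := h
  exact ⟨M + 1, fun n hn => by
    rw [Conf.nprod_der, hM n (by omega), hM (n - 1) (by omega), smul_zero, map_zero, add_zero]⟩

theorem Conf.isLoc_nprod_left {x y z : Conf k N} (h : Conf.IsLoc k N y z) (s : ℕ) :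
    Conf.IsLoc k N (nprod k s x y) z := by
  obtain ⟨M, hM⟩ := h
  refine ⟨M, ?_⟩
  induction s using Nat.strong_induction_on with
  | _ s ih =>
    intro m hm
    have h := Conf.assoc k N s m x y z
    rw [hM m hm, map_zero, Finset.sum_range_succ, Finset.sum_eq_zero, zero_add] at h
    · simpa using h.symm
    · intro t ht
      have ht := Finset.mem_range.1 ht
      rw [ih t ht _ (by omega), smul_zero]

theorem Conf.isLoc_nprod_right {x y z : Conf k N} (h : Conf.IsLoc k N x y)
    (h' : Conf.IsLoc k N y z) (m : ℕ) : Conf.IsLoc k N x (nprod k m y z) := by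
  obtain ⟨M, hM⟩ := h
  choose K hK using fun s => Conf.isLoc_nprod_left k N (x := x) h' s
  refine ⟨M + ∑ s ∈ Finset.range M, K s, fun n hn => ?_⟩
  rw [Conf.assoc]
  refine Finset.sum_eq_zero fun s hs => ?_
  by_cases hsM : s < M
  · have : K s ≤ ∑ s ∈ Finset.range M, K s :=
      Finset.single_le_sum (f := K) (fun _ _ => Nat.zero_le _) (Finset.mem_range.2 hsM)
    rw [hK s _ (by omega), smul_zero]
  · rw [hM s (by omega), map_zero, LinearMap.zero_apply, smul_zero]

theorem Conf.mon_der (p : ConfMon X) : Conf.mon k N (ConfMon.der p) = der k (Conf.mon k N p) := by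
  rw [Conf.mon, ← preConf_der_mon, ← quot_der_mk]; rfl

theorem Conf.mon_prod (n : ℕ) (p q : ConfMon X) :
    Conf.mon k N (ConfMon.prod n p q) = nprod k n (Conf.mon k N p) (Conf.mon k N q) := by
  rw [Conf.mon, ← preConf_nprod_mon, ← quot_nprod_mk]; rfl

theorem Conf.isLoc_mon (p q : ConfMon X) :
    Conf.IsLoc k N (Conf.mon k N p) (Conf.mon k N q) := by
  induction q generalizing p with
  | gen b =>
    induction p with
    | gen a => exact ⟨N a b, fun n hn => Conf.mk_eq_zero_of_rel k N (ConfRel.locality a b n hn)⟩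
    | der p ih => rw [Conf.mon_der]; exact Conf.isLoc_der_left k N ih
    | prod n p p' _ ih => rw [Conf.mon_prod]; exact Conf.isLoc_nprod_left k N ih n
  | der q ih => rw [Conf.mon_der]; exact Conf.isLoc_der_right k N (ih p)
  | prod n q q' ih ih' =>
    rw [Conf.mon_prod]; exact Conf.isLoc_nprod_right k N (ih p) (ih' q) n

theorem Conf.isLoc (x y : Conf k N) : Conf.IsLoc k N x y := by
  obtain ⟨x, rfl⟩ := Submodule.Quotient.mk_surjective _ x
  obtain ⟨y, rfl⟩ := Submodule.Quotient.mk_surjective _ y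
  refine preConf_induction k (P := fun x => Conf.IsLoc k N (Submodule.Quotient.mk x) _)
    ⟨0, fun n _ => by simp⟩ (fun f g hf hg => Conf.isLoc_add_left k N hf hg) ?_ (fun p => ?_) x
  · rintro c f ⟨M, hM⟩
    exact ⟨M, fun n hn => by rw [Submodule.Quotient.mk_smul]; simp [hM n hn]⟩
  refine preConf_induction k (P := fun y => Conf.IsLoc k N _ (Submodule.Quotient.mk y))
    ⟨0, fun n _ => by simp⟩ (fun f g hf hg => Conf.isLoc_add_right k N hf hg) ?_ (fun q => ?_) y
  · rintro c f ⟨M, hM⟩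
    exact ⟨M, fun n hn => by rw [Submodule.Quotient.mk_smul]; simp [hM n hn]⟩
  exact Conf.isLoc_mon k N p q

instance Conf.instAssocConformalAlgebra : AssocConformalAlgebra k (Conf k N) where
  toConformalOps := quotConformalOps _
  locality := Conf.isLoc k N
  der_nprod := Conf.der_nprod k N
  nprod_der := Conf.nprod_der k N
  assoc := Conf.assoc k N

/-- The value of a monomial in a conformal algebra. -/
def ConfMon.eval {C : Type w} [AddCommGroup C] [Module k C] [ConformalOps k C] (φ : X → C) :
    ConfMon X → C
  | .gen a => φ a
  | .der p => _root_.der k (ConfMon.eval φ p)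
  | .prod n p q => _root_.nprod k n (ConfMon.eval φ p) (ConfMon.eval φ q)

/-- The universal property of `Conf(X, N)`. -/
theorem Conf.existsUnique_lift {C : Type w} [AddCommGroup C] [Module k C]
    [AssocConformalAlgebra k C] (φ : X → C)
    (hφ : ∀ a b n, N a b ≤ n → nprod k n (φ a) (φ b) = 0) :
    ∃! F : Conf k N →ₗ[k] C, IsConformalHom k F ∧ ∀ a, F (Conf.gen k N a) = φ a := by
  let E : PreConf k X →ₗ[k] C :=
    Finsupp.lsum k fun p => LinearMap.toSpanSingleton k C (ConfMon.eval k φ p)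
  have hEm : ∀ p, E (PreConf.mon k p) = ConfMon.eval k φ p := fun p => by
    change (Finsupp.lsum k fun p => LinearMap.toSpanSingleton k C (ConfMon.eval k φ p))
      (Finsupp.single p (1 : k)) = _
    simp
  have hEd : ∀ f, E (der k f) = der k (E f) := by
    refine preConf_induction k (by simp) (fun f g hf hg => by simp [hf, hg])
      (fun c f hf => by simp [hf]) fun p => ?_
    rw [preConf_der_mon, hEm, hEm]; rfl
  have hEp : ∀ n f g, E (nprod k n f g) = nprod k n (E f) (E g) := by
    intro n f g
    refine preConf_induction k (P := fun f => E (nprod k n f g) = nprod k n (E f) (E g))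
      (by simp) (fun f g hf hg => by simp [hf, hg]) (fun c f hf => by simp [hf]) (fun p => ?_) f
    refine preConf_induction k (P := fun g => E (nprod k n _ g) = nprod k n _ (E g))
      (by simp) (fun f g hf hg => by simp [hf, hg]) (fun c f hf => by simp [hf]) (fun q => ?_) g
    rw [preConf_nprod_mon, hEm, hEm, hEm]; rfl
  have hker : conformalIdealSpan k {f : PreConf k X | ConfRel k N f} ≤ LinearMap.ker E := by
    refine conformalIdealSpan_le ⟨fun x hx => ?_, fun n y x hx => ?_, fun n y x hx => ?_⟩ ?_
    · rw [LinearMap.mem_ker] at hx ⊢; rw [hEd, hx, map_zero]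
    · rw [LinearMap.mem_ker] at hx ⊢; rw [hEp, hx, map_zero]
    · rw [LinearMap.mem_ker] at hx ⊢; rw [hEp, hx, map_zero, LinearMap.zero_apply]
    · rintro f (⟨n, f, g⟩ | ⟨n, f, g⟩ | ⟨n, m, f, g, h⟩ | ⟨a, b, n, hn⟩)
      · simp [hEp, hEd, AssocConformalAlgebra.der_nprod]
      · simp [hEp, hEd, AssocConformalAlgebra.nprod_der]
      · simp only [SetLike.mem_coe, LinearMap.mem_ker, map_sub, map_sum, map_smul, hEp]
        rw [AssocConformalAlgebra.assoc, sub_self]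
      · rw [SetLike.mem_coe, LinearMap.mem_ker, hEp, hEm, hEm]
        exact hφ a b n hn
  refine ⟨Submodule.liftQ _ E hker, ⟨⟨fun x => ?_, fun n x y => ?_⟩, fun a => hEm _⟩, ?_⟩
  · obtain ⟨x, rfl⟩ := Submodule.Quotient.mk_surjective _ x
    exact hEd x
  · obtain ⟨x, rfl⟩ := Submodule.Quotient.mk_surjective _ x
    obtain ⟨y, rfl⟩ := Submodule.Quotient.mk_surjective _ y
    exact hEp n x y
  · rintro G ⟨hG, hGg⟩
    have hGm : ∀ p, G (Conf.mon k N p) = ConfMon.eval k φ p := by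
      intro p
      induction p with
      | gen a => exact hGg a
      | der p ih => rw [Conf.mon_der, hG.map_der, ih]; rfl
      | prod n p q ih ih' => rw [Conf.mon_prod, hG.map_nprod, ih, ih']; rfl
    refine LinearMap.ext fun x => ?_
    obtain ⟨x, rfl⟩ := Submodule.Quotient.mk_surjective _ x
    change G (Submodule.Quotient.mk x) = E x
    refine preConf_induction k (P := fun x => G (Submodule.Quotient.mk x) = E x)
      (by simp) (fun f g hf hg => by simp [hf, hg])
      (fun c f hf => by simp [hf]) (fun p => ?_) x
    exact (hGm p).trans (hEm p).symm

/-- `Conf(X, N | S)`: the associative conformal algebra generated by `X` with locality function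
`N` and defining relations `S`. -/
abbrev ConfMod (S : Set (Conf k N)) : Type (max u v) := Conf k N ⧸ conformalIdealSpan k S

end Free

/-! ## The operators `∂`, `L_n^a`, `R_n^a` -/

section Curly

variable (k : Type u) {C : Type v} [Field k] [AddCommGroup C] [Module k C]
  [AssocConformalAlgebra k C]

/-- The summand `(-1)^(n+s) ∂^(s) (y ₙ₊ₛ x)`, with `∂^(s) = ∂^s / s!`. -/
def curlyTerm (n : ℕ) (x y : C) (s : ℕ) : C :=
  ((-1 : k) ^ (n + s) * ((s.factorial : k))⁻¹) • ((der k) ^ s) (nprod k (n + s) y x)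

theorem curlyTerm_finite (n : ℕ) (x y : C) : (Function.support (curlyTerm k n x y)).Finite := by
  obtain ⟨M, hM⟩ := AssocConformalAlgebra.locality (k := k) y x
  refine (Set.finite_Iio M).subset fun s hs => ?_
  by_contra h
  simp only [Set.mem_Iio, not_lt] at h
  exact hs (by rw [curlyTerm, hM (n + s) (by omega), map_zero, smul_zero])

/-- The map `y ↦ {y ₙ x} = ∑_{s ≥ 0} (-1)^(n+s) ∂^(s) (y ₙ₊ₛ x)`; the sum is finite by
locality. -/
def curly (n : ℕ) (x : C) : C →ₗ[k] C where
  toFun y := ∑ᶠ s : ℕ, curlyTerm k n x y s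
  map_add' y z := by
    rw [← finsum_add_distrib (curlyTerm_finite k n x y) (curlyTerm_finite k n x z)]
    refine finsum_congr fun s => ?_
    simp [curlyTerm]
  map_smul' c y := by
    rw [RingHom.id_apply, smul_finsum' c (curlyTerm_finite k n x y)]
    refine finsum_congr fun s => ?_
    simp [curlyTerm, smul_comm c]

end Curly

/-- The letters `∂`, `L_n^a`, `R_n^a`. -/
inductive Letter (X : Type v) : Type v
  | d : Letter X
  | L : ℕ → X → Letter X
  | R : ℕ → X → Letter X

/-- Words in the letters. -/
abbrev OpWord (X : Type v) : Type v := FreeMonoid (Letter X)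

/-- Noncommutative polynomials in the letters: the free associative algebra. -/
abbrev OpAlg (k : Type u) (X : Type v) [Field k] : Type (max u v) := MonoidAlgebra k (OpWord X)

/-- The free left module on `X` over the free associative algebra; its linear basis is formed by
the words `u x`, where `u` is a word in the letters and `x ∈ X`. -/
abbrev OpFree (k : Type u) (X : Type v) [Field k] : Type (max u v) := X →₀ OpAlg k X

/-- A word as a noncommutative polynomial. -/
def wd (k : Type u) {X : Type v} [Field k] (u : OpWord X) : OpAlg k X := MonoidAlgebra.single u 1

/-- The module element `p x` for a polynomial `p` and a generator `x`. -/
def atGen {k : Type u} {X : Type v} [Field k] (p : OpAlg k X) (x : X) : OpFree k X :=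
  Finsupp.single x p

/-- The word `∂^s`. -/
def dPow {X : Type v} (s : ℕ) : OpWord X := FreeMonoid.of Letter.d ^ s

/-- The word `L_{n_1}^{a_1} … L_{n_k}^{a_k}` of a list `(n_1, a_1), …, (n_k, a_k)`. -/
def lWord {X : Type v} (l : List (ℕ × X)) : OpWord X :=
  FreeMonoid.ofList (l.map fun p => Letter.L p.1 p.2)

/-- The word `R_{n_1}^{a_1} … R_{n_k}^{a_k}` of a list `(n_1, a_1), …, (n_k, a_k)`. -/
def rWord {X : Type v} (l : List (ℕ × X)) : OpWord X :=
  FreeMonoid.ofList (l.map fun p => Letter.R p.1 p.2)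

/-- The defining relations of the associative algebra `A(X)`. -/
inductive AlgRel (k : Type u) {X : Type v} [Field k] : OpAlg k X → Prop
  | L_d (n : ℕ) (a : X) : AlgRel k
      (wd k (.of (.L n a) * .of .d) - wd k (.of .d * .of (.L n a))
        - (n : k) • wd k (.of (.L (n - 1) a)))
  | R_d (n : ℕ) (a : X) : AlgRel k
      (wd k (.of (.R n a) * .of .d) - wd k (.of .d * .of (.R n a))
        - (n : k) • wd k (.of (.R (n - 1) a)))
  | R_L (m : ℕ) (b : X) (n : ℕ) (a : X) : AlgRel k
      (wd k (.of (.R m b) * .of (.L n a)) - wd k (.of (.L n a) * .of (.R m b)))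

/-- The module relations of `Conf(X, N)`: locality, right multiplication, and the consequences
of locality for longer words. -/
inductive BaseRel (k : Type u) {X : Type v} [Field k] (N : X → X → ℕ) : OpFree k X → Prop
  | locality (a b : X) (n : ℕ) (hn : N a b ≤ n) : BaseRel k N (atGen (wd k (.of (.L n a))) b)
  | rightMul (a b : X) (n : ℕ) : BaseRel k N
      (atGen (wd k (.of (.R n b))) a - ∑ s ∈ Finset.range (N a b - n),
        ((-1 : k) ^ (n + s) * ((s.factorial : k))⁻¹) •
          atGen (wd k (dPow s * .of (.L (n + s) a))) b)
  | localityExt (a b : X) (n m : ℕ) (hn : N a b ≤ n) (l : List (ℕ × X)) (c : X) : BaseRel k N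
      (atGen (wd k (.of (.L n a) * .of (.L m b) * lWord l)) c - ∑ q ∈ Finset.Icc 1 n,
        ((-1 : k) ^ (q + 1) * (n.choose q : k)) •
          atGen (wd k (.of (.L (n - q) a) * .of (.L (m + q) b) * lWord l)) c)

section Eval

variable (k : Type u) {X : Type v} [Field k] (N : X → X → ℕ)

/-- The operators on `Conf(X, N)`: `L_n^a f = a ₙ f`, `R_n^a f = {f ₙ a}`. -/
def opLetter : Letter X → Module.End k (Conf k N)
  | .d => der k
  | .L n a => nprod k n (Conf.gen k N a)
  | .R n a => curly k n (Conf.gen k N a)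

/-- The action of noncommutative polynomials on `Conf(X, N)`. -/
def opAction : OpAlg k X →ₐ[k] Module.End k (Conf k N) :=
  MonoidAlgebra.lift k (Module.End k (Conf k N)) (OpWord X) (FreeMonoid.lift (opLetter k N))

/-- The module homomorphism from the free module to `Conf(X, N)` that is identical on `X`. -/
def toConf : OpFree k X →ₗ[k] Conf k N :=
  Finsupp.lsum k fun x =>
    (LinearMap.applyₗ (Conf.gen k N x)).comp (opAction k N).toLinearMap

end Eval

/-! ## The monomial order -/

/-- The order on the letters: `∂ < L_n^a < R_m^b`, and `L_n^a < L_m^b` (resp. `R_n^a < R_m^b`) iff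
`n < m`, or `n = m` and `a < b`. -/
def letterLT {X : Type v} [LinearOrder X] : Letter X → Letter X → Prop
  | .d, .d => False
  | .d, .L _ _ => True
  | .d, .R _ _ => True
  | .L _ _, .d => False
  | .L n a, .L m b => n < m ∨ (n = m ∧ a < b)
  | .L _ _, .R _ _ => True
  | .R _ _, .d => False
  | .R _ _, .L _ _ => False
  | .R n a, .R m b => n < m ∨ (n = m ∧ a < b)

/-- Is the letter one of the `R_n^a`? -/
def Letter.isR {X : Type v} : Letter X → Bool
  | .R _ _ => true
  | _ => false

/-- The degree in the letters `R_n^a`. -/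
def degR {X : Type v} (u : OpWord X) : ℕ := u.toList.countP Letter.isR

/-- The monomial order on words: first the degree in the letters `R_n^a`, then deg-lex. -/
def wordLT {X : Type v} [LinearOrder X] (u v : OpWord X) : Prop :=
  degR u < degR v ∨ (degR u = degR v ∧ (u.length < v.length ∨
    (u.length = v.length ∧ List.Lex letterLT u.toList v.toList)))

/-- The order on the words `u x` of the free module. -/
def modWordLT {X : Type v} [LinearOrder X] (p q : OpWord X × X) : Prop :=
  wordLT p.1 q.1 ∨ (p.1 = q.1 ∧ p.2 < q.2)

/-! ## Gröbner–Shirshov bases of modules over an algebra given by relations -/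

section GSB

variable {k : Type u} {X : Type v} [Field k] [LinearOrder X]

/-- `u` is the principal word of the polynomial `f`. -/
def IsLeadAlg (f : OpAlg k X) (u : OpWord X) : Prop :=
  f.coeff u ≠ 0 ∧ ∀ v, f.coeff v ≠ 0 → v = u ∨ wordLT v u

/-- `u x` is the principal word of the module element `t`. -/
def IsLeadMod (t : OpFree k X) (u : OpWord X) (x : X) : Prop :=
  (t x).coeff u ≠ 0 ∧ ∀ v y, (t y).coeff v ≠ 0 → (v = u ∧ y = x) ∨ modWordLT (v, y) (u, x)

/-- `h` is trivial modulo `(E, w)`: a linear combination of `a f b`, `f ∈ E`, whose principal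
words are less than `w`. -/
def TrivialAlg (E : Set (OpAlg k X)) (w : OpWord X) (h : OpAlg k X) : Prop :=
  h ∈ Submodule.span k {g | ∃ f ∈ E, ∃ u, IsLeadAlg f u ∧ ∃ a b : OpWord X,
    wordLT (a * u * b) w ∧ g = wd k a * f * wd k b}

/-- `h` is trivial modulo `(E, T, w)`: a linear combination of `a f b x`, `f ∈ E`, and of `a t`,
`t ∈ T`, whose principal words are less than `w`. -/
def TrivialMod (E : Set (OpAlg k X)) (T : Set (OpFree k X)) (w : OpWord X × X)
    (h : OpFree k X) : Prop :=
  h ∈ Submodule.span k (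
    {g | ∃ f ∈ E, ∃ u, IsLeadAlg f u ∧ ∃ (a b : OpWord X) (x : X),
      modWordLT (a * u * b, x) w ∧ g = atGen (wd k a * f * wd k b) x} ∪
    {g | ∃ t ∈ T, ∃ u x, IsLeadMod t u x ∧ ∃ a : OpWord X,
      modWordLT (a * u, x) w ∧ g = wd k a • t})

/-- `(E, T)` is a Gröbner–Shirshov basis (of the module with generators `X` and relations `T` over
the algebra with relations `E`): all compositions of `E` with `E`, of `E` with `T`, and of `T`
with `T` are trivial. Zero elements have no principal word and take no part. -/
structure IsGSB (E : Set (OpAlg k X)) (T : Set (OpFree k X)) : Prop where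
  /-- intersections in the algebra -/
  alg_inter : ∀ f ∈ E, ∀ g ∈ E, ∀ u v a b : OpWord X, IsLeadAlg f u → IsLeadAlg g v →
    u * b = a * v → a.length < u.length →
    TrivialAlg E (u * b)
      ((f.coeff u)⁻¹ • (f * wd k b) - (g.coeff v)⁻¹ • (wd k a * g))
  /-- inclusions in the algebra -/
  alg_incl : ∀ f ∈ E, ∀ g ∈ E, ∀ u v a b : OpWord X, IsLeadAlg f u → IsLeadAlg g v →
    u = a * v * b →
    TrivialAlg E u ((f.coeff u)⁻¹ • f - (g.coeff v)⁻¹ • (wd k a * g * wd k b))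
  /-- intersections of an algebra relation with a module relation -/
  algMod_inter : ∀ f ∈ E, ∀ t ∈ T, ∀ (u v a b : OpWord X) (x : X), IsLeadAlg f u →
    IsLeadMod t v x → u * b = a * v → a.length < u.length →
    TrivialMod E T (u * b, x)
      ((f.coeff u)⁻¹ • atGen (f * wd k b) x - ((t x).coeff v)⁻¹ • (wd k a • t))
  /-- inclusions of an algebra relation in a module relation -/
  algMod_incl : ∀ f ∈ E, ∀ t ∈ T, ∀ (u v a b : OpWord X) (x : X), IsLeadAlg f u →
    IsLeadMod t v x → v = a * u * b →
    TrivialMod E T (v, x)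
      (((t x).coeff v)⁻¹ • t - (f.coeff u)⁻¹ • atGen (wd k a * f * wd k b) x)
  /-- inclusions of a module relation in a module relation -/
  mod_incl : ∀ t ∈ T, ∀ t' ∈ T, ∀ (u v a : OpWord X) (x : X), IsLeadMod t u x →
    IsLeadMod t' v x → u = a * v →
    TrivialMod E T (u, x)
      (((t x).coeff u)⁻¹ • t - ((t' x).coeff v)⁻¹ • (wd k a • t'))

/-- The word `u x` contains no principal word of an element of `T` as a subword. (In the word
`u x` the letter from `X` is the last one, so such a subword is necessarily a suffix.) -/
def IsReducedWord (T : Set (OpFree k X)) (u : OpWord X) (x : X) : Prop :=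
  ¬ ∃ t ∈ T, ∃ v, IsLeadMod t v x ∧ ∃ a : OpWord X, u = a * v

end GSB

/-! ## Words of `Conf(X, N)` and representatives of conformal polynomials -/

/-- The words `∂^s L_{n_1}^{a_1} … L_{n_k}^{a_k} R_{m_1}^{b_1} … R_{m_t}^{b_t}`, a linear basis
of `A(X)`. -/
def IsNormalWord {X : Type v} (u : OpWord X) : Prop :=
  ∃ (s : ℕ) (l r : List (ℕ × X)), u = dPow s * lWord l * rWord r

/-- `T` is the set `S` of conformal polynomials written as elements of the free `A(X)`-module
generated by `X`: the elements of `T` are linear combinations of the words `u x`, `u` in the basis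
of `A(X)`, and the set of their values in `Conf(X, N)` is `S`. -/
def Represents {k : Type u} {X : Type v} [Field k] (N : X → X → ℕ) (T : Set (OpFree k X))
    (S : Set (Conf k N)) : Prop :=
  (∀ t ∈ T, ∀ (u : OpWord X) (x : X), (t x).coeff u ≠ 0 → IsNormalWord u) ∧
    toConf k N '' T = S

/-- `n_i < N(a_i, a_{i+1})` for `i = 1, …, k`, where the list is `(n_1, a_1), …, (n_k, a_k)` and
`x = a_{k+1}`. -/
def IsAdmissible {X : Type v} (N : X → X → ℕ) : List (ℕ × X) → X → Prop
  | [], _ => True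
  | [(n, a)], x => n < N a x
  | (n, a) :: (m, b) :: l, x => n < N a b ∧ IsAdmissible N ((m, b) :: l) x

/-- The indices `(s, l, x)` of the `T`-reduced words `∂^s L_{n_1}^{a_1} … L_{n_k}^{a_k} a_{k+1}`
with `0 ≤ n_i < N(a_i, a_{i+1})`, where `l = (n_1, a_1), …, (n_k, a_k)` and `x = a_{k+1}`. -/
def ReducedIndex {k : Type u} {X : Type v} [Field k] [LinearOrder X] (N : X → X → ℕ)
    (T : Set (OpFree k X)) : Type v :=
  {p : ℕ × List (ℕ × X) × X //
    IsAdmissible N p.2.1 p.2.2 ∧ IsReducedWord T (dPow p.1 * lWord p.2.1) p.2.2}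

/-- The element `∂^s (a_1 _{n_1} (a_2 _{n_2} … (a_k _{n_k} a_{k+1}) … ))` of `Conf(X, N)`. -/
def confWord (k : Type u) {X : Type v} [Field k] (N : X → X → ℕ) (p : ℕ × List (ℕ × X) × X) :
    Conf k N :=
  ((der k) ^ p.1 : Module.End k (Conf k N))
    (p.2.1.foldr (fun q f => nprod k q.1 (Conf.gen k N q.2) f) (Conf.gen k N p.2.2))

/-- The images in `Conf(X, N | S)` of the `T`-reduced words. -/
def reducedFamily {k : Type u} {X : Type v} [Field k] [LinearOrder X] (N : X → X → ℕ)
    (T : Set (OpFree k X)) (S : Set (Conf k N)) (p : ReducedIndex N T) : ConfMod k N S :=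
  Submodule.Quotient.mk (confWord k N p.1)

end

noncomputable section

universe u v w

/-! ## Reduction modulo a family of elements with prescribed principal words -/

section Reduction

variable {k : Type*} {V : Type*} {W : Type*} [Field k] [AddCommGroup V] [Module k V]

/-! Let `G` be the family of all elements `a f b x` and `a t`, where `f` runs over (A) and `t` over
`T` and (1)–(3), each with its principal word, and let `M` be its span. The theorem rests on three
facts: the words free of principal words of `G` are exactly the admissible `T`-reduced ones
(`not_genRel_iff`); `M` is the kernel of the evaluation in `Conf(X, N | S)` (`ker_toConfMod`); and
reduced words together with `M` always span the free module (`reducedSpan_sup_totalSpan`). Spanning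
is thus automatic, and condition 2 says that the span of reduced words meets `M` only in zero.

If all compositions are trivial, this intersection is zero by the composition-diamond lemma:
disjoint occurrences of principal words give trivial differences for free, overlapping ones are
covered by the compositions (`IsGSB.confluent`), hence every nonzero element of `M` has a principal
word that occurs in `G` (`exists_lead_of_mem_upToSpan`). Conversely, a composition at `w` lies in
`M` and involves only words below `w`. Reducing it uses only members of `G` below `w`, and the
reduced remainder lies in `M`, so it vanishes (`mem_lowerSpan_of_disjoint`). Compositions inside (A)
do not depend on `T` and are checked by hand; the only proper overlap is `R L ∂`.

The kernel statement has two halves. A subspace of `Conf(X, N)` stable under `∂`, `L_n^a`, `R_n^a`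
is an ideal (`Conf.isConformalIdeal_of_stable`), so the image of `M` is the ideal generated by `S`.
It remains to see that (A), (1), (2), (3) already define `Conf(X, N)`, which amounts to the
independence of the admissible words (`linearIndependent_confWord`).

That independence comes from a model. Read a list `(n_1, a_1), …, (n_k, a_k)` as the word `a_1 …
a_k` with coefficient `∏ (t_i - t_{i+1})^{n_i}`, where `t_{k+1} = 0`. The operator `a(i)` prepends
`a` and multiplies by `t_1^i`. The `n`-th product of two such sequences inserts `(t_1 - t_2)^n`, so
dividing by the lists with some `n_i ≥ N(a_i, a_{i+1})` forces locality. Distinct admissible words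
act on the empty list with distinct admissible principal lists. -/

/-- `w` is the principal word of `v` with respect to the basis `b` ordered by `r`. -/
def HasLead (b : Module.Basis W k V) (r : W → W → Prop) (v : V) (w : W) : Prop :=
  b.repr v w ≠ 0 ∧ ∀ w', b.repr v w' ≠ 0 → w' = w ∨ r w' w

/-- The span of the elements of the family with principal word less than `w`. -/
def lowerSpan (k : Type*) {V W : Type*} [Field k] [AddCommGroup V] [Module k V]
    (r : W → W → Prop) (G : V → W → Prop) (w : W) : Submodule k V :=
  Submodule.span k {g | ∃ w', G g w' ∧ r w' w}

/-- The span of all elements of the family. -/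
def totalSpan (k : Type*) {V W : Type*} [Field k] [AddCommGroup V] [Module k V]
    (G : V → W → Prop) : Submodule k V :=
  Submodule.span k {g | ∃ w, G g w}

/-- The vectors all of whose basis words are less than `w`. -/
def belowWord (b : Module.Basis W k V) (r : W → W → Prop) (w : W) : Submodule k V :=
  Submodule.comap b.repr.toLinearMap (Finsupp.supported k k {w' | r w' w})

/-- The span of the words that are not principal words of the family. -/
def reducedSpan (b : Module.Basis W k V) (G : V → W → Prop) : Submodule k V :=
  Submodule.comap b.repr.toLinearMap (Finsupp.supported k k {w | ¬ ∃ g, G g w})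

variable {b : Module.Basis W k V} {r : W → W → Prop} {G : V → W → Prop}

theorem mem_belowWord {w : W} {v : V} :
    v ∈ belowWord b r w ↔ ∀ w', b.repr v w' ≠ 0 → r w' w := by
  simp [belowWord, Finsupp.mem_supported, Set.subset_def]

theorem mem_reducedSpan {v : V} :
    v ∈ reducedSpan b G ↔ ∀ w, b.repr v w ≠ 0 → ¬ ∃ g, G g w := by
  simp [reducedSpan, Finsupp.mem_supported, Set.subset_def]

theorem basis_mem_reducedSpan {w : W} (h : ¬ ∃ g, G g w) : b w ∈ reducedSpan b G := by
  classical
  rw [mem_reducedSpan]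
  intro w' hw'
  rw [b.repr_self, Finsupp.single_apply] at hw'
  split_ifs at hw' with h'
  · exact h' ▸ h
  · exact absurd rfl hw'

theorem lowerSpan_le_totalSpan (w : W) : lowerSpan k r G w ≤ totalSpan k G :=
  Submodule.span_mono fun _ ⟨w', h, _⟩ => ⟨w', h⟩

theorem HasLead.unique [IsWellOrder W r] {v : V} {w w' : W} (h : HasLead b r v w)
    (h' : HasLead b r v w') : w = w' := by
  rcases h.2 _ h'.1 with e | e
  · exact e.symm
  · rcases h'.2 _ h.1 with e' | e'
    · exact e'
    · exact absurd e (asymm e')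

theorem HasLead.mem_belowWord [IsTrans W r] {v : V} {w w' : W} (h : HasLead b r v w)
    (hr : r w w') : v ∈ belowWord b r w' := by
  rw [_root_.mem_belowWord]
  intro x hx
  rcases h.2 x hx with rfl | hx
  exacts [hr, _root_.trans hx hr]

theorem lowerSpan_le_belowWord [IsTrans W r] (hG : ∀ g w, G g w → HasLead b r g w) (w : W) :
    lowerSpan k r G w ≤ belowWord b r w :=
  Submodule.span_le.2 fun _ ⟨_, hg, hr⟩ => (hG _ _ hg).mem_belowWord hr

theorem exists_hasLead [IsWellOrder W r] {v : V} (hv : v ≠ 0) : ∃ w, HasLead b r v w := by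
  classical
  let _ := linearOrderOfSTO r
  have hs : (b.repr v).support.Nonempty := by
    rw [Finsupp.support_nonempty_iff]
    simpa using hv
  refine ⟨(b.repr v).support.max' hs, Finsupp.mem_support_iff.1 (Finset.max'_mem _ hs),
    fun w' hw' => ?_⟩
  exact ((b.repr v).support.le_max' w' (Finsupp.mem_support_iff.2 hw'))

/-- Normalizing both leading coefficients to one cancels the common principal word; all other words
were already smaller. -/
theorem sub_mem_belowWord [IsWellOrder W r] {g g' : V} {w : W} (h : HasLead b r g w)
    (h' : HasLead b r g' w) :
    (b.repr g w)⁻¹ • g - (b.repr g' w)⁻¹ • g' ∈ belowWord b r w := by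
  rw [mem_belowWord]
  intro w' hw'
  by_cases e : w' = w
  · subst e
    simp [inv_mul_cancel₀ h.1, inv_mul_cancel₀ h'.1] at hw'
  · by_contra hr
    have h1 : b.repr g w' = 0 := by
      by_contra h0
      rcases h.2 _ h0 with e' | e'
      exacts [e e', hr e']
    have h2 : b.repr g' w' = 0 := by
      by_contra h0
      rcases h'.2 _ h0 with e' | e'
      exacts [e e', hr e']
    simp [h1, h2] at hw'

theorem basis_sub_mem_belowWord [IsWellOrder W r] {g : V} {w : W} (h : HasLead b r g w) :
    b w - (b.repr g w)⁻¹ • g ∈ belowWord b r w := by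
  have hb : HasLead b r (b w) w := by
    refine ⟨by simp, fun w' hw' => Or.inl ?_⟩
    classical
    rw [b.repr_self, Finsupp.single_apply] at hw'
    by_contra hne
    simp [Ne.symm hne] at hw'
  simpa using sub_mem_belowWord hb h

theorem mem_of_forall_basis_mem {P : Submodule k V} {v : V}
    (h : ∀ w, b.repr v w ≠ 0 → b w ∈ P) : v ∈ P := by
  rw [← b.linearCombination_repr v, Finsupp.linearCombination_apply]
  exact Submodule.sum_mem _ fun w hw => P.smul_mem _ (h w (Finsupp.mem_support_iff.1 hw))

/-- Every word less than `w` reduces to a combination of reduced words modulo the elements of the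
family with principal words less than `w`. -/
theorem basis_mem_sup_lowerSpan [IsWellOrder W r] (hG : ∀ g w, G g w → HasLead b r g w) {w w' : W}
    (hw : r w' w) : b w' ∈ reducedSpan b G ⊔ lowerSpan k r G w := by
  induction w' using (IsWellFounded.wf (r := r)).induction with
  | _ w' ih =>
    by_cases hred : ∃ g, G g w'
    · obtain ⟨g, hg⟩ := hred
      have h1 : b w' - (b.repr g w')⁻¹ • g ∈ reducedSpan b G ⊔ lowerSpan k r G w :=
        mem_of_forall_basis_mem fun x hx =>
          have hx' := mem_belowWord.1 (basis_sub_mem_belowWord (hG g w' hg)) x hx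
          ih x hx' (_root_.trans hx' hw)
      have h2 : (b.repr g w')⁻¹ • g ∈ reducedSpan b G ⊔ lowerSpan k r G w :=
        Submodule.smul_mem _ _ (Submodule.mem_sup_right (Submodule.subset_span ⟨w', hg, hw⟩))
      simpa using add_mem h1 h2
    · exact Submodule.mem_sup_left (basis_mem_reducedSpan hred)

/-- The word `w` is not below itself, so `basis_mem_sup_lowerSpan` does not apply to it directly;
one reduction step produces words strictly below `w`, to which it does. -/
theorem basis_mem_sup_totalSpan [IsWellOrder W r] (hG : ∀ g w, G g w → HasLead b r g w) (w : W) :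
    b w ∈ reducedSpan b G ⊔ totalSpan k G := by
  have hle : reducedSpan b G ⊔ lowerSpan k r G w ≤ reducedSpan b G ⊔ totalSpan k G :=
    sup_le_sup_left (lowerSpan_le_totalSpan w) _
  by_cases hred : ∃ g, G g w
  · obtain ⟨g, hg⟩ := hred
    have h1 : b w - (b.repr g w)⁻¹ • g ∈ reducedSpan b G ⊔ totalSpan k G :=
      mem_of_forall_basis_mem fun x hx =>
        hle (basis_mem_sup_lowerSpan hG
          (mem_belowWord.1 (basis_sub_mem_belowWord (hG g w hg)) x hx))
    have h2 : (b.repr g w)⁻¹ • g ∈ reducedSpan b G ⊔ totalSpan k G :=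
      Submodule.smul_mem _ _ (Submodule.mem_sup_right (Submodule.subset_span ⟨w, hg⟩))
    simpa using add_mem h1 h2
  · exact Submodule.mem_sup_left (basis_mem_reducedSpan hred)

/-- Reduction terminates because the order is well-founded; no confluence is needed for spanning. -/
theorem reducedSpan_sup_totalSpan [IsWellOrder W r] (hG : ∀ g w, G g w → HasLead b r g w) :
    reducedSpan b G ⊔ totalSpan k G = ⊤ :=
  eq_top_iff.2 fun _ _ => mem_of_forall_basis_mem fun w _ => basis_mem_sup_totalSpan hG w

/-- If the reduced words are independent modulo the family, then every combination of the family
with small words is a combination of elements of the family with small principal words. -/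
theorem mem_lowerSpan_of_disjoint [IsWellOrder W r] (hG : ∀ g w, G g w → HasLead b r g w)
    (hd : Disjoint (reducedSpan b G) (totalSpan k G)) {w : W} {h : V}
    (h1 : h ∈ totalSpan k G) (h2 : h ∈ belowWord b r w) : h ∈ lowerSpan k r G w := by
  have : h ∈ reducedSpan b G ⊔ lowerSpan k r G w := mem_of_forall_basis_mem fun x hx =>
    basis_mem_sup_lowerSpan hG (mem_belowWord.1 h2 x hx)
  obtain ⟨p, hp, t, ht, rfl⟩ := Submodule.mem_sup.1 this
  have hp' : p ∈ totalSpan k G := by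
    simpa using sub_mem h1 (lowerSpan_le_totalSpan w ht)
  rw [Submodule.disjoint_def.1 hd p hp hp', zero_add]
  exact ht

/-- The elements of the family with principal word at most `w`. -/
def upToSpan (k : Type*) {V W : Type*} [Field k] [AddCommGroup V] [Module k V]
    (r : W → W → Prop) (G : V → W → Prop) (w : W) : Submodule k V :=
  Submodule.span k {g | ∃ w', G g w' ∧ (w' = w ∨ r w' w)}

theorem upToSpan_mono [IsTrans W r] {w w' : W} (h : r w' w) :
    upToSpan k r G w' ≤ upToSpan k r G w := by
  refine Submodule.span_mono fun _ ⟨w'', hg, hr⟩ => ⟨w'', hg, Or.inr ?_⟩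
  rcases hr with rfl | hr
  exacts [h, _root_.trans hr h]

/-- A finite combination has a largest principal word. The predicate `P` is left free so that the
lemma serves both `lowerSpan` (a bound on the words) and `totalSpan` (no condition). -/
theorem exists_mem_upToSpan [IsWellOrder W r] {P : W → Prop} {h : V}
    (hh : h ∈ Submodule.span k {g | ∃ w', G g w' ∧ P w'}) :
    h = 0 ∨ ∃ w', P w' ∧ h ∈ upToSpan k r G w' := by
  induction hh using Submodule.span_induction with
  | mem x hx =>
    obtain ⟨w', hg, hr⟩ := hx
    exact Or.inr ⟨w', hr, Submodule.subset_span ⟨w', hg, Or.inl rfl⟩⟩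
  | zero => exact Or.inl rfl
  | add x y _ _ ihx ihy =>
    rcases ihx with rfl | ⟨w1, hw1, h1⟩
    · simpa using ihy
    rcases ihy with rfl | ⟨w2, hw2, h2⟩
    · exact Or.inr ⟨w1, hw1, by simpa using h1⟩
    rcases trichotomous_of r w1 w2 with e | rfl | e
    · exact Or.inr ⟨w2, hw2, add_mem (upToSpan_mono e h1) h2⟩
    · exact Or.inr ⟨w1, hw1, add_mem h1 h2⟩
    · exact Or.inr ⟨w1, hw1, add_mem h1 (upToSpan_mono e h2)⟩
  | smul c x _ ih =>
    rcases ih with rfl | ⟨w1, hw1, h1⟩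
    · simp
    · exact Or.inr ⟨w1, hw1, Submodule.smul_mem _ _ h1⟩

/-- Well-founded descent on the bound. Members of the family with principal word exactly `w` are
interchangeable up to scalars and smaller members, so one of them, `g`, suffices. Either it survives
and gives the principal word, or the bound can be lowered. -/
theorem exists_lead_of_mem_upToSpan [IsWellOrder W r] (hG : ∀ g w, G g w → HasLead b r g w)
    (hc : ∀ g g' w, G g w → G g' w →
      (b.repr g w)⁻¹ • g - (b.repr g' w)⁻¹ • g' ∈ lowerSpan k r G w) (w : W) (h : V)
    (hh : h ∈ upToSpan k r G w) : h = 0 ∨ ∃ w' g, HasLead b r h w' ∧ G g w' := by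
  induction w using (IsWellFounded.wf (r := r)).induction generalizing h with
  | _ w ih =>
    by_cases hw : ∃ g, G g w
    · obtain ⟨g, hg⟩ := hw
      have key : ∃ (c : k) (t : V), t ∈ lowerSpan k r G w ∧ h = c • g + t := by
        clear ih
        induction hh using Submodule.span_induction with
        | mem x hx =>
          obtain ⟨w', hx, rfl | hr⟩ := hx
          -- Multiplying the composition of `x` and `g` by the leading coefficient of `x` expresses
          -- `x` as a multiple of `g` plus smaller members.
          · have := Submodule.smul_mem _ (b.repr x w') (hc x g w' hx hg)
            rw [smul_sub, smul_smul, mul_inv_cancel₀ (hG _ _ hx).1, one_smul] at this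
            exact ⟨b.repr x w' * (b.repr g w')⁻¹, _, this, by rw [mul_smul]; abel⟩
          · exact ⟨0, x, Submodule.subset_span ⟨w', hx, hr⟩, by simp⟩
        | zero => exact ⟨0, 0, zero_mem _, by simp⟩
        | add x y _ _ ihx ihy =>
          obtain ⟨c, t, ht, rfl⟩ := ihx
          obtain ⟨c', t', ht', rfl⟩ := ihy
          exact ⟨c + c', t + t', add_mem ht ht', by rw [add_smul]; abel⟩
        | smul a x _ ih =>
          obtain ⟨c, t, ht, rfl⟩ := ih
          exact ⟨a * c, a • t, Submodule.smul_mem _ _ ht, by rw [smul_add, mul_smul]⟩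
      obtain ⟨c, t, ht, rfl⟩ := key
      -- For `c = 0` the element equals `t`, which has a smaller bound. Otherwise nothing in `t` can
      -- cancel the principal word of `g`.
      by_cases hc0 : c = 0
      · subst hc0
        rw [zero_smul, zero_add]
        rcases exists_mem_upToSpan (r := r) ht with rfl | ⟨w', hw', h'⟩
        · exact Or.inl rfl
        · exact ih w' hw' t h'
      · refine Or.inr ⟨w, g, ⟨?_, ?_⟩, hg⟩
        · have h0 : b.repr t w = 0 := by
            by_contra h0
            exact irrefl w (mem_belowWord.1 (lowerSpan_le_belowWord hG w ht) w h0)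
          simp [h0, hc0, (hG g w hg).1]
        · intro w' hw'
          by_cases h0 : b.repr t w' = 0
          · refine (hG g w hg).2 w' fun h1 => hw' ?_
            simp [h0, h1]
          · exact Or.inr (mem_belowWord.1 (lowerSpan_le_belowWord hG w ht) w' h0)
    · have : h ∈ lowerSpan k r G w := by
        refine Submodule.span_mono ?_ hh
        rintro g ⟨w', hg, rfl | hr⟩
        · exact absurd ⟨g, hg⟩ hw
        · exact ⟨w', hg, hr⟩
      rcases exists_mem_upToSpan (r := r) this with rfl | ⟨w', hw', h'⟩
      · exact Or.inl rfl
      · exact ih w' hw' h h'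

/-- The composition-diamond lemma: if any two elements of the family with the same principal word
are congruent modulo smaller elements, then the reduced words are independent modulo the family. -/
theorem disjoint_reducedSpan_totalSpan [IsWellOrder W r]
    (hG : ∀ g w, G g w → HasLead b r g w)
    (hc : ∀ g g' w, G g w → G g' w →
      (b.repr g w)⁻¹ • g - (b.repr g' w)⁻¹ • g' ∈ lowerSpan k r G w) :
    Disjoint (reducedSpan b G) (totalSpan k G) := by
  rw [Submodule.disjoint_def]
  intro h h1 h2
  have h2' : h ∈ Submodule.span k {g | ∃ w', G g w' ∧ True} := by
    simpa [totalSpan] using h2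
  rcases exists_mem_upToSpan (r := r) h2' with rfl | ⟨w, -, hw⟩
  · rfl
  rcases exists_lead_of_mem_upToSpan hG hc w h hw with rfl | ⟨w', g, hl, hg⟩
  · rfl
  · exact absurd ⟨g, hg⟩ (mem_reducedSpan.1 h1 w' hl.1)

end Reduction

/-! ## The monomial order -/

section Order

variable {X : Type v} [LinearOrder X]

set_option linter.unusedSectionVars false

/-- An embedding of the letters into a lexicographic product realizing `letterLT`. -/
def letterKey : Letter X → ℕ ×ₗ ℕ ×ₗ WithBot X
  | .d => toLex (0, toLex (0, ⊥))
  | .L n a => toLex (1, toLex (n, (a : WithBot X)))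
  | .R n a => toLex (2, toLex (n, (a : WithBot X)))

theorem letterKey_injective : Function.Injective (letterKey (X := X)) := by
  intro p q h
  cases p <;> cases q <;> simp_all [letterKey]

theorem letterLT_iff (p q : Letter X) : letterLT p q ↔ letterKey p < letterKey q := by
  cases p <;> cases q <;> simp [letterKey, letterLT, Prod.Lex.toLex_lt_toLex]

instance : IsStrictTotalOrder (Letter X) letterLT where
  trichotomous p q h h' := by
    rw [letterLT_iff] at h h'
    exact letterKey_injective (le_antisymm (not_lt.1 h') (not_lt.1 h))
  irrefl p := by simp [letterLT_iff]
  trans p q r := by simp only [letterLT_iff]; exact lt_trans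

instance [WellFoundedLT X] : IsWellFounded (Letter X) letterLT where
  wf := by
    have : (letterLT : Letter X → Letter X → Prop) = InvImage (· < ·) letterKey := by
      ext p q; exact letterLT_iff p q
    rw [this]
    exact InvImage.wf _ wellFounded_lt

/-- Exhibits the order as a lexicographic product of well-founded orders, from which totality and
well-foundedness follow. -/
theorem wordLT_iff (u v : OpWord X) : wordLT u v ↔
    Prod.Lex (· < ·) (List.Shortlex letterLT) (degR u, u.toList) (degR v, v.toList) := by
  rw [Prod.lex_def, List.shortlex_def]
  rfl

instance [WellFoundedLT X] : IsWellOrder (OpWord X) wordLT where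
  trichotomous p q h h' := by
    rw [wordLT_iff] at h h'
    exact (Prod.mk.inj (Std.Trichotomous.trichotomous (r := Prod.Lex (· < ·) (List.Shortlex letterLT))
      _ _ h h')).2
  wf := by
    have : (wordLT : OpWord X → OpWord X → Prop) =
        InvImage (Prod.Lex (· < ·) (List.Shortlex letterLT)) (fun u => (degR u, u.toList)) := by
      ext p q; exact wordLT_iff p q
    rw [this]
    exact InvImage.wf _ (WellFounded.prod_lex wellFounded_lt (List.Shortlex.wf IsWellFounded.wf))

theorem modWordLT_iff (p q : OpWord X × X) : modWordLT p q ↔ Prod.Lex wordLT (· < ·) p q := by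
  rw [Prod.lex_def]; rfl

instance [WellFoundedLT X] : IsWellOrder (OpWord X × X) modWordLT where
  trichotomous p q h h' := by
    rw [modWordLT_iff] at h h'
    exact Std.Trichotomous.trichotomous (r := Prod.Lex wordLT (· < ·)) _ _ h h'
  wf := by
    have : (modWordLT : OpWord X × X → _ → Prop) = Prod.Lex wordLT (· < ·) := by
      ext p q; exact modWordLT_iff p q
    rw [this]
    exact WellFounded.prod_lex IsWellFounded.wf wellFounded_lt

theorem degR_mul (u v : OpWord X) : degR (u * v) = degR u + degR v := by
  simp [degR, FreeMonoid.toList_mul]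

theorem wordLT.mul_left {u v : OpWord X} (h : wordLT u v) (a : OpWord X) :
    wordLT (a * u) (a * v) := by
  simp only [wordLT, degR_mul, FreeMonoid.length_mul, FreeMonoid.toList_mul] at h ⊢
  rcases h with h | ⟨h, h' | ⟨h', h''⟩⟩
  · exact Or.inl (by omega)
  · exact Or.inr ⟨by omega, Or.inl (by omega)⟩
  · exact Or.inr ⟨by omega, Or.inr ⟨by omega, h''.append_left _ _⟩⟩

/-- Equal lengths exclude the case of a proper prefix, where appending the same tail could reverse
the comparison. -/
theorem List.Lex.append_of_length_eq {α : Type*} {r : α → α → Prop} {l l' : List α}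
    (h : List.Lex r l l') (hl : l.length = l'.length) (m : List α) :
    List.Lex r (l ++ m) (l' ++ m) := by
  induction h with
  | nil => simp at hl
  | rel h => exact List.Lex.rel h
  | cons _ ih => exact List.Lex.cons (ih (by simpa using hl))

theorem wordLT.mul_right {u v : OpWord X} (h : wordLT u v) (a : OpWord X) :
    wordLT (u * a) (v * a) := by
  simp only [wordLT, degR_mul, FreeMonoid.length_mul, FreeMonoid.toList_mul] at h ⊢
  rcases h with h | ⟨h, h' | ⟨h', h''⟩⟩
  · exact Or.inl (by omega)
  · exact Or.inr ⟨by omega, Or.inl (by omega)⟩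
  · exact Or.inr ⟨by omega, Or.inr ⟨by omega, h''.append_of_length_eq h' _⟩⟩

theorem modWordLT.mul_left {u v : OpWord X} {x y : X} (h : modWordLT (u, x) (v, y))
    (a : OpWord X) : modWordLT (a * u, x) (a * v, y) := by
  rcases h with h | ⟨h, h'⟩
  · exact Or.inl (h.mul_left a)
  · simp only at h
    exact Or.inr ⟨by simp [h], h'⟩

end Order

/-! ## Coordinates in the free module -/

section Coordinates

variable {k : Type u} {X : Type v} [Field k]

/-- The basis of the free module formed by the words `u x`. -/
def opBasis (k : Type u) (X : Type v) [Field k] : Module.Basis (OpWord X × X) k (OpFree k X) :=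
  Module.Basis.ofRepr
    ((Finsupp.mapRange.linearEquiv (MonoidAlgebra.coeffLinearEquiv k)).trans
      ((Finsupp.curryLinearEquiv k).symm.trans (Finsupp.domLCongr (Equiv.prodComm _ _))))

theorem opBasis_repr (h : OpFree k X) (u : OpWord X) (x : X) :
    (opBasis k X).repr h (u, x) = (h x).coeff u := by
  simp [opBasis]

theorem opBasis_apply (u : OpWord X) (x : X) : opBasis k X (u, x) = atGen (wd k u) x := by
  classical
  apply (opBasis k X).repr.injective
  ext ⟨v, y⟩
  rw [Module.Basis.repr_self, opBasis_repr, atGen, wd]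
  by_cases hx : x = y
  · subst hx
    simp [Finsupp.single_apply, Prod.ext_iff]
  · simp [hx]

theorem hasLead_iff [LinearOrder X] {t : OpFree k X} {u : OpWord X} {x : X} :
    HasLead (opBasis k X) modWordLT t (u, x) ↔ IsLeadMod t u x := by
  simp [HasLead, IsLeadMod, opBasis_repr]

theorem wd_mul (u v : OpWord X) : wd k (u * v) = wd k u * wd k v := by
  simp [wd]

theorem wd_one : wd k (1 : OpWord X) = 1 := rfl

theorem coeff_wd_mul (a u : OpWord X) (f : OpAlg k X) :
    (wd k a * f).coeff (a * u) = f.coeff u := by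
  rw [wd, MonoidAlgebra.coeff_single_mul_eq_mul_coeff u fun _ _ => mul_right_inj a, one_mul]

theorem coeff_mul_wd (b u : OpWord X) (f : OpAlg k X) :
    (f * wd k b).coeff (u * b) = f.coeff u := by
  rw [wd, MonoidAlgebra.coeff_mul_single_eq_coeff_mul u fun _ _ => mul_left_inj b, mul_one]

theorem exists_of_coeff_wd_mul {a v : OpWord X} {f : OpAlg k X} (h : (wd k a * f).coeff v ≠ 0) :
    ∃ u, v = a * u ∧ f.coeff u ≠ 0 := by
  have : ∃ u, a * u = v := by
    by_contra! hne
    exact h (MonoidAlgebra.coeff_single_mul_of_forall_mul_ne _ _ hne)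
  obtain ⟨u, rfl⟩ := this
  exact ⟨u, rfl, by rwa [coeff_wd_mul] at h⟩

theorem exists_of_coeff_mul_wd {b v : OpWord X} {f : OpAlg k X} (h : (f * wd k b).coeff v ≠ 0) :
    ∃ u, v = u * b ∧ f.coeff u ≠ 0 := by
  have : ∃ u, u * b = v := by
    by_contra! hne
    exact h (MonoidAlgebra.coeff_mul_single_of_forall_mul_ne _ _ hne)
  obtain ⟨u, rfl⟩ := this
  exact ⟨u, rfl, by rwa [coeff_mul_wd] at h⟩

theorem atGen_apply [DecidableEq X] (p : OpAlg k X) (x y : X) :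
    atGen p x y = if x = y then p else 0 :=
  Finsupp.single_apply

@[simp]
theorem atGen_apply_self (p : OpAlg k X) (x : X) : atGen p x x = p :=
  Finsupp.single_eq_same

theorem smul_atGen (p q : OpAlg k X) (x : X) : p • atGen q x = atGen (p * q) x := by
  simp [atGen]

theorem smul_atGen' (c : k) (q : OpAlg k X) (x : X) : c • atGen q x = atGen (c • q) x := by
  simp [atGen]

theorem atGen_add (p q : OpAlg k X) (x : X) : atGen (p + q) x = atGen p x + atGen q x :=
  Finsupp.single_add ..

theorem atGen_sub (p q : OpAlg k X) (x : X) : atGen (p - q) x = atGen p x - atGen q x :=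
  Finsupp.single_sub ..

theorem atGen_coeff_eq {p : OpAlg k X} {x y : X} {u : OpWord X} (h : (atGen p x y).coeff u ≠ 0) :
    y = x ∧ p.coeff u ≠ 0 := by
  classical
  rw [atGen_apply] at h
  split_ifs at h with e
  · exact ⟨e.symm, h⟩
  · exact absurd rfl h

section Lead

variable [LinearOrder X]

theorem IsLeadAlg.mul_left {f : OpAlg k X} {u : OpWord X} (h : IsLeadAlg f u) (a : OpWord X) :
    IsLeadAlg (wd k a * f) (a * u) := by
  refine ⟨by rw [coeff_wd_mul]; exact h.1, fun v hv => ?_⟩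
  obtain ⟨v, rfl, hv'⟩ := exists_of_coeff_wd_mul hv
  exact (h.2 v hv').imp (congrArg _) fun h => h.mul_left a

theorem IsLeadAlg.mul_right {f : OpAlg k X} {u : OpWord X} (h : IsLeadAlg f u) (b : OpWord X) :
    IsLeadAlg (f * wd k b) (u * b) := by
  refine ⟨by rw [coeff_mul_wd]; exact h.1, fun v hv => ?_⟩
  obtain ⟨v, rfl, hv'⟩ := exists_of_coeff_mul_wd hv
  exact (h.2 v hv').imp (congrArg (· * b)) fun h => h.mul_right b

theorem IsLeadAlg.atGen {f : OpAlg k X} {u : OpWord X} (h : IsLeadAlg f u) (x : X) :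
    IsLeadMod (atGen f x) u x := by
  refine ⟨by rw [atGen_apply_self]; exact h.1, fun v y hv => ?_⟩
  obtain ⟨rfl, hv'⟩ := atGen_coeff_eq hv
  exact (h.2 v hv').imp (fun e => ⟨e, rfl⟩) Or.inl

theorem IsLeadMod.smul {t : OpFree k X} {u : OpWord X} {x : X} (h : IsLeadMod t u x)
    (a : OpWord X) : IsLeadMod (wd k a • t) (a * u) x := by
  refine ⟨?_, fun v y hv => ?_⟩
  · rw [Finsupp.smul_apply, smul_eq_mul, coeff_wd_mul]
    exact h.1
  · rw [Finsupp.smul_apply, smul_eq_mul] at hv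
    obtain ⟨v, rfl, hv'⟩ := exists_of_coeff_wd_mul hv
    exact (h.2 v y hv').imp (fun ⟨e, e'⟩ => ⟨congrArg _ e, e'⟩) fun h => h.mul_left a

end Lead

end Coordinates

/-! ## The composition-diamond lemma for modules over an algebra given by relations -/

section Diamond

set_option linter.unusedSectionVars false

variable {k : Type u} {X : Type v} [Field k] [LinearOrder X]

/-- `g` is one of the elements `a f b x`, `f ∈ E`, or `a t`, `t ∈ T`, and `w` is its principal
word. -/
def GenRel (E : Set (OpAlg k X)) (T : Set (OpFree k X)) (g : OpFree k X) (w : OpWord X × X) :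
    Prop :=
  (∃ f ∈ E, ∃ u, IsLeadAlg f u ∧ ∃ (a b : OpWord X) (x : X),
    w = (a * u * b, x) ∧ g = atGen (wd k a * f * wd k b) x) ∨
  (∃ t ∈ T, ∃ u x, IsLeadMod t u x ∧ ∃ a : OpWord X, w = (a * u, x) ∧ g = wd k a • t)

variable {E : Set (OpAlg k X)} {T : Set (OpFree k X)}

theorem GenRel.of_alg {f : OpAlg k X} (hf : f ∈ E) {u : OpWord X} (hu : IsLeadAlg f u)
    (a b : OpWord X) (x : X) : GenRel E T (atGen (wd k a * f * wd k b) x) (a * u * b, x) :=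
  Or.inl ⟨f, hf, u, hu, a, b, x, rfl, rfl⟩

theorem GenRel.of_mod {t : OpFree k X} (ht : t ∈ T) {u : OpWord X} {x : X} (hu : IsLeadMod t u x)
    (a : OpWord X) : GenRel E T (wd k a • t) (a * u, x) :=
  Or.inr ⟨t, ht, u, x, hu, a, rfl, rfl⟩

theorem GenRel.hasLead {g : OpFree k X} {w : OpWord X × X} (h : GenRel E T g w) :
    HasLead (opBasis k X) modWordLT g w := by
  rcases h with ⟨f, -, u, hu, a, b, x, rfl, rfl⟩ | ⟨t, -, u, x, hu, a, rfl, rfl⟩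
  · exact hasLead_iff.2 (((hu.mul_left a).mul_right b).atGen x)
  · exact hasLead_iff.2 (hu.smul a)

/-- The family is closed under left multiplication by words, so a single multiplication carries a
local statement into any left context. -/
theorem GenRel.smul {g : OpFree k X} {u : OpWord X} {x : X} (h : GenRel E T g (u, x))
    (c : OpWord X) : GenRel E T (wd k c • g) (c * u, x) := by
  rcases h with ⟨f, hf, u, hu, a, b, x, hw, rfl⟩ | ⟨t, ht, u, x, hu, a, hw, rfl⟩
  · obtain ⟨rfl, rfl⟩ := Prod.mk.inj hw
    have := GenRel.of_alg (T := T) hf hu (c * a) b x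
    rwa [wd_mul, mul_assoc (wd k c), mul_assoc (wd k c), ← smul_atGen, mul_assoc c,
      mul_assoc c] at this
  · obtain ⟨rfl, rfl⟩ := Prod.mk.inj hw
    have := GenRel.of_mod (E := E) ht hu (c * a)
    rwa [wd_mul, mul_smul, mul_assoc c] at this

theorem trivialMod_iff {w : OpWord X × X} {h : OpFree k X} :
    TrivialMod E T w h ↔ h ∈ lowerSpan k modWordLT (GenRel E T) w := by
  have : {g | ∃ w', GenRel E T g w' ∧ modWordLT w' w} =
      {g | ∃ f ∈ E, ∃ u, IsLeadAlg f u ∧ ∃ (a b : OpWord X) (x : X),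
        modWordLT (a * u * b, x) w ∧ g = atGen (wd k a * f * wd k b) x} ∪
      {g | ∃ t ∈ T, ∃ u x, IsLeadMod t u x ∧ ∃ a : OpWord X,
        modWordLT (a * u, x) w ∧ g = wd k a • t} := by
    ext g
    constructor
    · rintro ⟨w', ⟨f, hf, u, hu, a, b, x, rfl, rfl⟩ | ⟨t, ht, u, x, hu, a, rfl, rfl⟩, hw⟩
      · exact Or.inl ⟨f, hf, u, hu, a, b, x, hw, rfl⟩
      · exact Or.inr ⟨t, ht, u, x, hu, a, hw, rfl⟩
    · rintro (⟨f, hf, u, hu, a, b, x, hw, rfl⟩ | ⟨t, ht, u, x, hu, a, hw, rfl⟩)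
      · exact ⟨_, GenRel.of_alg hf hu a b x, hw⟩
      · exact ⟨_, GenRel.of_mod ht hu a, hw⟩
  rw [lowerSpan, this]
  rfl

theorem smul_mem_lowerSpan {u : OpWord X} {x : X} {h : OpFree k X}
    (hh : h ∈ lowerSpan k modWordLT (GenRel E T) (u, x)) (a : OpWord X) :
    wd k a • h ∈ lowerSpan k modWordLT (GenRel E T) (a * u, x) := by
  induction hh using Submodule.span_induction with
  | mem g hg =>
    obtain ⟨⟨v, y⟩, hg, hlt⟩ := hg
    exact Submodule.subset_span ⟨_, hg.smul a, hlt.mul_left a⟩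
  | zero => simp
  | add p q _ _ hp hq => rw [smul_add]; exact add_mem hp hq
  | smul c p _ hp => rw [smul_comm]; exact Submodule.smul_mem _ _ hp

/-- The order is compatible with multiplication on both sides, so a trivial composition in the
algebra stays trivial inside any word `a w b x`. -/
theorem TrivialAlg.atGen_mem {w : OpWord X} {h : OpAlg k X} (hh : TrivialAlg E w h)
    (a b : OpWord X) (x : X) :
    atGen (wd k a * h * wd k b) x ∈ lowerSpan k modWordLT (GenRel E T) (a * w * b, x) := by
  induction hh using Submodule.span_induction with
  | mem g hg =>
    obtain ⟨f, hf, u, hu, a', b', hlt, rfl⟩ := hg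
    have hg := GenRel.of_alg (T := T) hf hu (a * a') (b' * b) x
    refine Submodule.subset_span ⟨(a * (a' * u * b') * b, x), ?_, Or.inl ((hlt.mul_left a).mul_right b)⟩
    simpa only [wd_mul, mul_assoc] using hg
  | zero => simp [atGen]
  | add p q _ _ hp hq => rw [mul_add, add_mul, atGen_add]; exact add_mem hp hq
  | smul c p _ hp =>
    rw [mul_smul_comm, smul_mul_assoc, ← smul_atGen']
    exact Submodule.smul_mem _ _ hp

theorem OpAlg.mem_of_forall_wd_mem {P : Submodule k (OpAlg k X)} {q : OpAlg k X}
    (h : ∀ u, q.coeff u ≠ 0 → wd k u ∈ P) : q ∈ P := by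
  have : q = ∑ u ∈ q.coeff.support, q.coeff u • wd k u := by
    conv_lhs => rw [← MonoidAlgebra.ofCoeff_coeff q, ← Finsupp.sum_single q.coeff]
    rw [Finsupp.sum, MonoidAlgebra.ofCoeff_sum]
    simp [wd]
  rw [this]
  exact Submodule.sum_mem _ fun u hu => P.smul_mem _ (h u (Finsupp.mem_support_iff.1 hu))

variable [WellFoundedLT X]

/-- Compositions of relations with disjoint principal words are trivial. -/
theorem disjoint_mem_lowerSpan {f : OpAlg k X} (hf : f ∈ E) {u : OpWord X} (hu : IsLeadAlg f u)
    {t : OpFree k X} {v : OpWord X} {x : X} (hv : IsLeadMod t v x)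
    (ht : ∀ a, GenRel E T (wd k a • t) (a * v, x)) (c : OpWord X) :
    (f.coeff u)⁻¹ • atGen (f * wd k (c * v)) x - ((t x).coeff v)⁻¹ • (wd k (u * c) • t) ∈
      lowerSpan k modWordLT (GenRel E T) (u * c * v, x) := by
  -- Replacing `v x` by the normalized `t` after `f c` costs terms `f c v' y` with `v' y` below `v
  -- x`; these are members of the family with smaller principal words.
  have h1 : (f * wd k c) • (atGen (wd k v) x - ((t x).coeff v)⁻¹ • t) ∈
      lowerSpan k modWordLT (GenRel E T) (u * c * v, x) := by
    have hb := basis_sub_mem_belowWord (hasLead_iff.2 hv)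
    rw [opBasis_repr, opBasis_apply] at hb
    have : atGen (wd k v) x - ((t x).coeff v)⁻¹ • t ∈
        (lowerSpan k modWordLT (GenRel E T) (u * c * v, x)).comap
          (DistribSMul.toLinearMap k (OpFree k X) (f * wd k c)) := by
      refine mem_of_forall_basis_mem (b := opBasis k X) fun ⟨v', y⟩ hw => ?_
      have hlt := mem_belowWord.1 hb _ hw
      rw [opBasis_apply, Submodule.mem_comap]
      refine Submodule.subset_span ⟨(u * c * v', y), ?_, hlt.mul_left (u * c)⟩
      have := GenRel.of_alg (T := T) hf hu 1 (c * v') y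
      rw [one_mul, wd_one, one_mul, wd_mul, ← mul_assoc, ← mul_assoc, ← smul_atGen] at this
      exact this
    exact this
  -- Symmetrically, replacing `u` by the normalized `f` before `c t` costs terms `u' c t` with `u'`
  -- below `u`.
  have h2 : ((wd k u - (f.coeff u)⁻¹ • f) * wd k c) • t ∈
      lowerSpan k modWordLT (GenRel E T) (u * c * v, x) := by
    have : wd k u - (f.coeff u)⁻¹ • f ∈
        (lowerSpan k modWordLT (GenRel E T) (u * c * v, x)).comap
          (((LinearMap.toSpanSingleton (OpAlg k X) (OpFree k X) t).restrictScalars k) ∘ₗ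
            LinearMap.mulRight k (wd k c)) := by
      refine OpAlg.mem_of_forall_wd_mem fun u' hu' => ?_
      have hb := mem_belowWord.1 (basis_sub_mem_belowWord (hasLead_iff.2 (hu.atGen x))) (u', x)
      rw [opBasis_repr, opBasis_repr, opBasis_apply, atGen_apply_self, smul_atGen', ← atGen_sub,
        atGen_apply_self] at hb
      have hlt : wordLT u' u := (hb hu').resolve_right fun h => lt_irrefl _ h.2
      rw [Submodule.mem_comap]
      refine Submodule.subset_span ⟨(u' * c * v, x), ?_, Or.inl ((hlt.mul_right c).mul_right v)⟩
      have := ht (u' * c)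
      rw [wd_mul] at this
      exact this
    exact this
  -- In this combination the two mixed terms `f c t` cancel and the required difference remains.
  have h3 := sub_mem (Submodule.smul_mem _ (f.coeff u)⁻¹ h1)
    (Submodule.smul_mem _ ((t x).coeff v)⁻¹ h2)
  convert h3 using 1
  simp only [smul_sub, sub_mul, sub_smul, smul_atGen, wd_mul, smul_mul_assoc, mul_assoc,
    smul_assoc]
  rw [smul_comm (f * wd k c) ((t x).coeff v)⁻¹ t, smul_comm (f.coeff u)⁻¹ ((t x).coeff v)⁻¹]
  abel

/-- Levi's lemma: two factorizations of the same word differ by shifting a middle factor. All case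
distinctions on occurrences rest on it. -/
theorem FreeMonoid.exists_eq_mul_of_mul_eq_mul {α : Type*} {a b c d : FreeMonoid α}
    (h : a * b = c * d) (hl : a.length ≤ c.length) : ∃ e, c = a * e ∧ b = e * d := by
  obtain ⟨e, he⟩ : a.toList <+: c.toList :=
    List.prefix_of_prefix_length_le (l₃ := (c * d).toList) ⟨b.toList, by rw [← h]; rfl⟩
      ⟨d.toList, rfl⟩ hl
  have hc : c = a * FreeMonoid.ofList e := he.symm
  refine ⟨FreeMonoid.ofList e, hc, ?_⟩
  rw [hc, mul_assoc] at h
  exact mul_left_cancel h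

/-- Two elements of `E` whose principal words occur in the same word. -/
theorem IsGSB.alg_alg (H : IsGSB E T) {f g : OpAlg k X} (hf : f ∈ E) (hg : g ∈ E)
    {u v : OpWord X} (hu : IsLeadAlg f u) (hv : IsLeadAlg g v) {a b a' b' : OpWord X} (x : X)
    (h : a * u * b = a' * v * b') (hl : a.length ≤ a'.length) :
    (f.coeff u)⁻¹ • atGen (wd k a * f * wd k b) x -
      (g.coeff v)⁻¹ • atGen (wd k a' * g * wd k b') x ∈
        lowerSpan k modWordLT (GenRel E T) (a * u * b, x) := by
  rw [mul_assoc, mul_assoc] at h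
  obtain ⟨e, rfl, h'⟩ := FreeMonoid.exists_eq_mul_of_mul_eq_mul h hl
  rcases le_or_gt u.length e.length with h1 | h1
  · obtain ⟨c, rfl, rfl⟩ := FreeMonoid.exists_eq_mul_of_mul_eq_mul h' h1
    -- The occurrences are disjoint. Here `g b' x` plays the role of the module element, with
    -- principal word `v b' x`, so the same lemma covers algebra and module relations.
    have ht : ∀ a, GenRel E T (wd k a • atGen (g * wd k b') x) (a * (v * b'), x) := fun a => by
      rw [smul_atGen, ← mul_assoc, ← mul_assoc]
      exact GenRel.of_alg hg hv a b' x
    have := smul_mem_lowerSpan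
      (disjoint_mem_lowerSpan hf hu ((hv.mul_right b').atGen x) ht c) a
    rw [atGen_apply_self, coeff_mul_wd] at this
    convert this using 1
    · simp only [mul_assoc]
    · simp only [smul_sub, smul_atGen, smul_atGen', wd_mul, mul_assoc, mul_smul_comm]
  -- Now `v` begins inside `u`: it either reaches the end of `u`, which is an intersection, or stops
  -- before it, which is an inclusion.
  rcases le_or_gt u.length (e * v).length with h2 | h2
  · rw [← mul_assoc] at h'
    obtain ⟨c, h3, rfl⟩ := FreeMonoid.exists_eq_mul_of_mul_eq_mul h' h2
    have := (H.alg_inter f hf g hg u v e c hu hv h3.symm h1).atGen_mem (T := T) a b' x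
    convert this using 1
    · simp only [mul_assoc]
    · simp only [mul_sub, sub_mul, atGen_sub, smul_atGen', wd_mul, mul_assoc, mul_smul_comm,
        smul_mul_assoc]
  · rw [← mul_assoc] at h'
    obtain ⟨c, rfl, rfl⟩ := FreeMonoid.exists_eq_mul_of_mul_eq_mul h'.symm h2.le
    have := (H.alg_incl f hf g hg _ v e c hu hv rfl).atGen_mem (T := T) a b x
    convert this using 1
    simp only [mul_sub, sub_mul, atGen_sub, smul_atGen', wd_mul, mul_assoc, mul_smul_comm,
        smul_mul_assoc]

/-- The principal word of `t` always reaches the right end of the word, since the generator `x` is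
last. So `u` lies to the left of `v`, overlaps its beginning, or sits inside it. -/
theorem IsGSB.alg_mod (H : IsGSB E T) {f : OpAlg k X} {t : OpFree k X} (hf : f ∈ E) (ht : t ∈ T)
    {u v : OpWord X} {x : X} (hu : IsLeadAlg f u) (hv : IsLeadMod t v x) {a b a' : OpWord X}
    (h : a * u * b = a' * v) :
    (f.coeff u)⁻¹ • atGen (wd k a * f * wd k b) x - ((t x).coeff v)⁻¹ • (wd k a' • t) ∈
        lowerSpan k modWordLT (GenRel E T) (a * u * b, x) := by
  rw [mul_assoc] at h
  rcases le_or_gt a.length a'.length with hl | hl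
  · obtain ⟨e, rfl, h'⟩ := FreeMonoid.exists_eq_mul_of_mul_eq_mul h hl
    rcases le_or_gt u.length e.length with h1 | h1
    · obtain ⟨c, rfl, rfl⟩ := FreeMonoid.exists_eq_mul_of_mul_eq_mul h' h1
      have := smul_mem_lowerSpan
        (disjoint_mem_lowerSpan hf hu hv (fun a => GenRel.of_mod (E := E) ht hv a) c) a
      convert this using 1
      · simp only [mul_assoc]
      · rw [smul_sub, smul_comm (wd k a), smul_comm (wd k a), smul_smul (wd k a), ← wd_mul]
        simp only [smul_atGen, mul_assoc]
    · have := smul_mem_lowerSpan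
        (trivialMod_iff.1 (H.algMod_inter f hf t ht u v e b x hu hv h' h1)) a
      convert this using 1
      · simp only [mul_assoc]
      · rw [smul_sub, smul_comm (wd k a), smul_comm (wd k a), smul_smul (wd k a), ← wd_mul]
        simp only [smul_atGen, mul_assoc]
  · obtain ⟨e, rfl, rfl⟩ := FreeMonoid.exists_eq_mul_of_mul_eq_mul h.symm hl.le
    have := smul_mem_lowerSpan
        (trivialMod_iff.1 (H.algMod_incl f hf t ht u _ e b x hu hv (mul_assoc _ _ _).symm)) a'
    convert neg_mem this using 1
    · simp only [mul_assoc]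
    · rw [smul_sub, smul_comm (wd k a'), smul_comm (wd k a'), neg_sub, smul_atGen, wd_mul]
      simp only [mul_assoc]

/-- Both principal words are suffixes of the same word, so one is a suffix of the other and only
inclusions arise. -/
theorem IsGSB.mod_mod (H : IsGSB E T) {t t' : OpFree k X} (ht : t ∈ T) (ht' : t' ∈ T)
    {u v : OpWord X} {x : X} (hu : IsLeadMod t u x) (hv : IsLeadMod t' v x) {a a' : OpWord X}
    (h : a * u = a' * v) (hl : a.length ≤ a'.length) :
    ((t x).coeff u)⁻¹ • (wd k a • t) - ((t' x).coeff v)⁻¹ • (wd k a' • t') ∈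
        lowerSpan k modWordLT (GenRel E T) (a * u, x) := by
  obtain ⟨e, rfl, rfl⟩ := FreeMonoid.exists_eq_mul_of_mul_eq_mul h hl
  have := smul_mem_lowerSpan
        (trivialMod_iff.1 (H.mod_incl t ht t' ht' _ v e x hu hv rfl)) a
  convert this using 1
  rw [smul_sub, smul_comm (wd k a), smul_comm (wd k a), smul_smul (wd k a), ← wd_mul]

/-- This is the hypothesis of the abstract diamond lemma. The two members are sorted by type and by
which occurrence starts first; the remaining cases follow by changing the sign. -/
theorem IsGSB.confluent (H : IsGSB E T) (g g' : OpFree k X) (w : OpWord X × X)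
    (hg : GenRel E T g w) (hg' : GenRel E T g' w) :
    ((opBasis k X).repr g w)⁻¹ • g - ((opBasis k X).repr g' w)⁻¹ • g' ∈
      lowerSpan k modWordLT (GenRel E T) w := by
  have hswap : ∀ {p q : OpFree k X} {P : Submodule k (OpFree k X)}, p - q ∈ P → q - p ∈ P :=
    fun h => by rw [← neg_sub]; exact neg_mem h
  have hmid : ∀ (f : OpAlg k X) (a u b : OpWord X),
      (wd k a * f * wd k b).coeff (a * u * b) = f.coeff u := fun f a u b => by
    rw [coeff_mul_wd, coeff_wd_mul]
  have hsm : ∀ (t : OpFree k X) (a u : OpWord X) (x : X),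
      ((wd k a • t) x).coeff (a * u) = (t x).coeff u := fun t a u x => by
    rw [Finsupp.smul_apply, smul_eq_mul, coeff_wd_mul]
  rcases hg with ⟨f, hf, u, hu, a, b, x, rfl, rfl⟩ | ⟨t, ht, u, x, hu, a, rfl, rfl⟩ <;>
    rcases hg' with ⟨f', hf', u', hu', a', b', x', hw, rfl⟩ | ⟨t', ht', u', x', hu', a', hw, rfl⟩ <;>
    obtain ⟨hw', rfl⟩ := Prod.mk.inj hw <;> simp only [opBasis_repr]
  · rw [atGen_apply_self, atGen_apply_self, hmid]
    rw [show (wd k a' * f' * wd k b').coeff (a * u * b) = f'.coeff u' by rw [hw', hmid]]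
    rcases le_total a.length a'.length with hl | hl
    · exact H.alg_alg hf hf' hu hu' x hw' hl
    · rw [hw']
      exact hswap (H.alg_alg hf' hf hu' hu x hw'.symm hl)
  · rw [atGen_apply_self, hmid]
    rw [show ((wd k a' • t') x).coeff (a * u * b) = (t' x).coeff u' by rw [hw', hsm]]
    exact H.alg_mod hf ht' hu hu' hw'
  · rw [atGen_apply_self, hsm]
    rw [show (wd k a' * f' * wd k b').coeff (a * u) = f'.coeff u' by rw [hw', hmid]]
    rw [hw']
    exact hswap (H.alg_mod hf' ht hu' hu hw'.symm)
  · rw [hsm, show ((wd k a' • t') x).coeff (a * u) = (t' x).coeff u' by rw [hw', hsm]]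
    rcases le_total a.length a'.length with hl | hl
    · exact H.mod_mod ht ht' hu hu' hw' hl
    · rw [hw']
      exact hswap (H.mod_mod ht' ht hu' hu hw'.symm hl)

/-- The composition-diamond lemma: the reduced words are independent modulo a Gröbner–Shirshov
basis. -/
theorem IsGSB.disjoint (H : IsGSB E T) :
    Disjoint (reducedSpan (opBasis k X) (GenRel E T)) (totalSpan k (GenRel E T)) :=
  disjoint_reducedSpan_totalSpan (r := modWordLT) (fun _ _ h => h.hasLead) H.confluent

/-- Conversely, if the reduced words are independent, then the compositions that involve module
relations are trivial. -/
theorem trivialMod_of_disjoint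
    (hd : Disjoint (reducedSpan (opBasis k X) (GenRel E T)) (totalSpan k (GenRel E T)))
    {g g' : OpFree k X} {u : OpWord X} {x : X} (hg : GenRel E T g (u, x))
    (hg' : GenRel E T g' (u, x)) :
    TrivialMod E T (u, x) (((g x).coeff u)⁻¹ • g - ((g' x).coeff u)⁻¹ • g') := by
  rw [trivialMod_iff, ← opBasis_repr, ← opBasis_repr]
  exact mem_lowerSpan_of_disjoint (fun _ _ h => h.hasLead) hd
    (sub_mem (Submodule.smul_mem _ _ (Submodule.subset_span ⟨_, hg⟩))
      (Submodule.smul_mem _ _ (Submodule.subset_span ⟨_, hg'⟩)))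
    (sub_mem_belowWord hg.hasLead hg'.hasLead)

/-- If the reduced words are independent, it suffices to check the compositions in the algebra. -/
theorem isGSB_of_disjoint
    (hd : Disjoint (reducedSpan (opBasis k X) (GenRel E T)) (totalSpan k (GenRel E T)))
    (h1 : ∀ f ∈ E, ∀ g ∈ E, ∀ u v a b : OpWord X, IsLeadAlg f u → IsLeadAlg g v →
      u * b = a * v → a.length < u.length →
      TrivialAlg E (u * b) ((f.coeff u)⁻¹ • (f * wd k b) - (g.coeff v)⁻¹ • (wd k a * g)))
    (h2 : ∀ f ∈ E, ∀ g ∈ E, ∀ u v a b : OpWord X, IsLeadAlg f u → IsLeadAlg g v →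
      u = a * v * b →
      TrivialAlg E u ((f.coeff u)⁻¹ • f - (g.coeff v)⁻¹ • (wd k a * g * wd k b))) :
    IsGSB E T where
  alg_inter := h1
  alg_incl := h2
  algMod_inter f hf t ht u v a b x hu hv h _ := by
    have g1 : GenRel E T (atGen (f * wd k b) x) (u * b, x) := by
      simpa only [wd_one, one_mul] using GenRel.of_alg (T := T) hf hu 1 b x
    have g2 : GenRel E T (wd k a • t) (u * b, x) := h ▸ GenRel.of_mod ht hv a
    have := trivialMod_of_disjoint hd g1 g2
    rwa [atGen_apply_self, coeff_mul_wd, h, Finsupp.smul_apply, smul_eq_mul, coeff_wd_mul,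
      ← h] at this
  algMod_incl f hf t ht u v a b x hu hv h := by
    have g1 : GenRel E T t (v, x) := by
      simpa only [wd_one, one_mul, one_smul] using GenRel.of_mod (E := E) ht hv 1
    subst h
    have := trivialMod_of_disjoint hd g1 (GenRel.of_alg (T := T) hf hu a b x)
    rwa [atGen_apply_self, coeff_mul_wd, coeff_wd_mul] at this
  mod_incl t ht t' ht' u v a x hu hv h := by
    have g1 : GenRel E T t (u, x) := by
      simpa only [wd_one, one_mul, one_smul] using GenRel.of_mod (E := E) ht hu 1
    subst h
    have := trivialMod_of_disjoint hd g1 (GenRel.of_mod ht' hv a)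
    rwa [Finsupp.smul_apply (wd k a) t', smul_eq_mul, coeff_wd_mul] at this

end Diamond

/-! ## Identities in associative conformal algebras -/

section Identities

variable {k : Type u} {C : Type v} [Field k] [AddCommGroup C] [Module k C]
  [AssocConformalAlgebra k C]

open AssocConformalAlgebra Finset

/-- Binomial inversion: `C(n,q) C(n-q,s) = C(n,s) C(n-s,q)` reduces the sum to the expansion of `(1
- 1)^(n-s)`. -/
theorem sum_neg_one_pow_choose_mul_choose (n s : ℕ) (hs : s ≤ n) :
    ∑ q ∈ range (n + 1), (-1 : k) ^ q * n.choose q * (n - q).choose s = if s = n then 1 else 0 := by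
  have h1 : ∀ q ∈ range (n + 1), (-1 : k) ^ q * n.choose q * (n - q).choose s =
      n.choose s * ((-1 : k) ^ q * (n - s).choose q) := by
    intro q hq
    have hq : q ≤ n := by simpa [Nat.lt_succ_iff] using hq
    have : n.choose q * (n - q).choose s = n.choose s * (n - s).choose q := by
      by_cases h : s ≤ n - q
      · rw [← Nat.choose_symm hq, Nat.choose_mul h,
          ← Nat.choose_symm (show n - q - s ≤ n - s by omega)]
        congr 2
        omega
      · rw [Nat.choose_eq_zero_of_lt (not_le.1 h),
          Nat.choose_eq_zero_of_lt (show n - s < q by omega), mul_zero, mul_zero]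
    rw [mul_assoc, ← Nat.cast_mul, this]
    push_cast
    ring
  rw [sum_congr rfl h1, ← mul_sum]
  have h2 : ∑ q ∈ range (n + 1), (-1 : k) ^ q * (n - s).choose q =
      ∑ q ∈ range (n - s + 1), (-1 : k) ^ q * (n - s).choose q := by
    symm
    refine sum_subset (range_subset_range.2 (by omega)) fun q _ hq => ?_
    rw [Nat.choose_eq_zero_of_lt (by simpa using hq), Nat.cast_zero, mul_zero]
  have h3 := congrArg (Int.cast : ℤ → k) (Int.alternating_sum_range_choose (n := n - s))
  push_cast at h3
  rw [h2, h3]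
  by_cases e : s = n
  · subst e; simp
  · rw [if_neg e, if_neg (by omega), mul_zero]

/-- The associativity identity solved for the products with left-normed brackets. -/
theorem nprod_nprod_left (n m : ℕ) (x y z : C) : nprod k m (nprod k n x y) z =
    ∑ q ∈ range (n + 1), ((-1 : k) ^ q * n.choose q) •
      nprod k (n - q) x (nprod k (m + q) y z) := by
  -- Associativity expands each term into products whose outer index `n + m - s` does not depend on
  -- `q`. Vanishing binomials extend the inner sum to a common range, so the coefficients can be
  -- inverted.
  have h : ∀ q ∈ range (n + 1), ((-1 : k) ^ q * n.choose q) •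
      nprod k (n - q) x (nprod k (m + q) y z) = ∑ s ∈ range (n + 1),
        ((-1 : k) ^ q * n.choose q * (n - q).choose s) •
          nprod k (n + m - s) (nprod k s x y) z := by
    intro q hq
    have hq : q ≤ n := by simpa [Nat.lt_succ_iff] using hq
    rw [assoc, smul_sum]
    simp only [mul_smul]
    rw [show n - q + (m + q) = n + m by omega]
    refine sum_subset (range_subset_range.2 (by omega)) fun s _ hs => ?_
    rw [Nat.choose_eq_zero_of_lt (show n - q < s by simpa using hs)]
    simp
  rw [sum_congr rfl h, sum_comm]
  simp only [← sum_smul]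
  rw [sum_congr rfl fun s hs => by
    rw [sum_neg_one_pow_choose_mul_choose n s (by simpa [Nat.lt_succ_iff] using hs)]]
  simp only [ite_smul, one_smul, zero_smul]
  rw [sum_ite_eq' (range (n + 1)) n, if_pos (by simp), Nat.add_sub_cancel_left]

variable (k) in
/-- The divided powers `∂^(s)` of the operator `∂`. -/
def dder (s : ℕ) : C →ₗ[k] C := ((s.factorial : k))⁻¹ • (der k) ^ s

theorem dder_zero (x : C) : dder k 0 x = x := by simp [dder]

theorem curlyTerm_eq (n : ℕ) (x y : C) (s : ℕ) :
    curlyTerm k n x y s = ((-1 : k) ^ (n + s)) • dder k s (nprod k (n + s) y x) := by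
  simp [curlyTerm, dder, mul_smul]

theorem curly_eq_sum (n M : ℕ) (x y : C) (h : ∀ s, M ≤ s → nprod k (n + s) y x = 0) :
    curly k n x y =
      ∑ s ∈ range M, ((-1 : k) ^ (n + s)) • dder k s (nprod k (n + s) y x) := by
  change ∑ᶠ s : ℕ, curlyTerm k n x y s = _
  rw [finsum_eq_sum_of_support_subset (s := range M)]
  · exact sum_congr rfl fun s _ => curlyTerm_eq n x y s
  · intro s hs
    by_contra hM
    refine hs ?_
    rw [curlyTerm_eq, h s (by simpa using hM), map_zero, smul_zero]

variable [CharZero k]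

theorem der_dder (s : ℕ) (x : C) : der k (dder k s x) = ((s + 1 : ℕ) : k) • dder k (s + 1) x := by
  have h1 : ((s + 1 : ℕ) : k) ≠ 0 := Nat.cast_ne_zero.2 (by omega)
  simp only [dder, LinearMap.smul_apply, map_smul, Nat.factorial_succ, Nat.cast_mul, mul_inv,
    smul_smul, pow_succ', Module.End.mul_apply]
  rw [mul_inv_cancel_left₀ h1]

/-- Iterating the commutation `L_n ∂ = ∂ L_n + n L_{n-1}`. The truncated `n - p.2` is harmless
because the binomial vanishes when `p.2 > n`. -/
theorem nprod_dder (n s : ℕ) (x z : C) : nprod k n x (dder k s z) =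
    ∑ p ∈ antidiagonal s, (n.choose p.2 : k) • dder k p.1 (nprod k (n - p.2) x z) := by
  induction s generalizing n with
  | zero => simp [dder_zero]
  | succ s ih =>
    have h1 : ((s + 1 : ℕ) : k) ≠ 0 := Nat.cast_ne_zero.2 (by omega)
    have h2 : ((s + 1 : ℕ) : k) • nprod k n x (dder k (s + 1) z) = ((s + 1 : ℕ) : k) •
        ∑ p ∈ antidiagonal (s + 1), (n.choose p.2 : k) • dder k p.1 (nprod k (n - p.2) x z) := by
      rw [← map_smul, ← der_dder, nprod_der, ih, ih, map_sum, smul_sum, smul_sum]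
      -- After multiplication by `s + 1`, this factor is split as `p.1 + p.2`: the first part comes
      -- from `∂ L_n ∂^(s)`, the second from `n L_{n-1} ∂^(s)`.
      have h3 : ∀ p ∈ antidiagonal (s + 1), ((s + 1 : ℕ) : k) • (n.choose p.2 : k) •
          dder k p.1 (nprod k (n - p.2) x z) =
          (p.1 : k) • (n.choose p.2 : k) • dder k p.1 (nprod k (n - p.2) x z) +
          (p.2 : k) • (n.choose p.2 : k) • dder k p.1 (nprod k (n - p.2) x z) := fun p hp => by
        rw [← mem_antidiagonal.1 hp, ← add_smul, Nat.cast_add]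
      rw [sum_congr rfl h3, sum_add_distrib, Nat.sum_antidiagonal_succ (n := s) (f := fun p =>
          (p.1 : k) • (n.choose p.2 : k) • dder k p.1 (nprod k (n - p.2) x z)),
        Nat.sum_antidiagonal_succ' (n := s) (f := fun p =>
          (p.2 : k) • (n.choose p.2 : k) • dder k p.1 (nprod k (n - p.2) x z))]
      simp only [Nat.cast_zero, zero_smul, zero_add]
      congr 1
      · refine sum_congr rfl fun p _ => ?_
        rw [map_smul, der_dder, smul_comm]
      · refine sum_congr rfl fun p _ => ?_
        rcases n with _ | n
        · simp
        · rw [smul_smul, smul_smul, ← Nat.cast_mul, ← Nat.cast_mul, Nat.add_sub_cancel,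
            Nat.add_one_mul_choose_eq, mul_comm ((n + 1).choose _), Nat.add_sub_add_right]
    exact (smul_right_injective C h1) h2

/-- The second relation of (A). Since `(∂y)` multiplied with index `n + s` gives the factor `-(n +
s)`, the part with `s` reindexes to `∂ R_n` and the part with `n` gives `n R_{n-1}`. -/
theorem curly_der (n : ℕ) (x y : C) :
    curly k n x (der k y) = der k (curly k n x y) + (n : k) • curly k (n - 1) x y := by
  obtain ⟨M, hM⟩ := locality (k := k) y x
  -- The derivative and the index `n - 1` each lower an index by one, hence the bound `M + 1`.
  rw [curly_eq_sum n (M + 1) x (der k y) fun s hs => by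
      rw [der_nprod, hM _ (by omega), smul_zero, neg_zero],
    curly_eq_sum n M x y fun s hs => hM _ (by omega),
    curly_eq_sum (n - 1) (M + 1) x y fun s hs => hM _ (by omega)]
  have h : ∀ s ∈ range (M + 1), ((-1 : k) ^ (n + s)) • dder k s (nprod k (n + s) (der k y) x) =
      -((-1 : k) ^ (n + s) * s) • dder k s (nprod k (n + s - 1) y x) +
      -((-1 : k) ^ (n + s) * n) • dder k s (nprod k (n + s - 1) y x) := fun s _ => by
    rw [der_nprod, map_neg, map_smul, smul_neg, smul_smul, ← neg_smul, ← add_smul]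
    congr 1
    push_cast
    ring
  rw [sum_congr rfl h, sum_add_distrib, sum_range_succ', map_sum, smul_sum]
  congr 1
  · simp only [Nat.cast_zero, mul_zero, neg_zero, zero_smul, add_zero]
    refine sum_congr rfl fun s _ => ?_
    rw [map_smul, der_dder, smul_smul, ← add_assoc, Nat.add_sub_cancel]
    congr 1
    rw [pow_succ]
    ring
  · refine sum_congr rfl fun s _ => ?_
    rcases n with _ | n
    · simp
    · rw [smul_smul, show n + 1 + s - 1 = n + 1 - 1 + s by omega]
      congr 1
      rw [show n + 1 + s = n + 1 - 1 + s + 1 by omega, pow_succ]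
      ring

/-- The terms outside the triangle `i + j < M` vanish, so summing by diagonals agrees with summing
over the square. -/
theorem sum_range_antidiagonal {A : Type*} [AddCommMonoid A] (M : ℕ) (f : ℕ × ℕ → A)
    (h : ∀ p : ℕ × ℕ, M ≤ p.1 + p.2 → f p = 0) :
    ∑ s ∈ range M, ∑ p ∈ antidiagonal s, f p = ∑ i ∈ range M, ∑ j ∈ range M, f (i, j) := by
  rw [← sum_product', ← sum_filter_of_ne (p := fun p : ℕ × ℕ => p.1 + p.2 ∈ range M)
    (fun p _ hp => mem_range.2 (not_le.1 fun h' => hp (h p h'))),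
    ← sum_fiberwise_of_maps_to (s := filter _ _) (t := range M) (g := fun p : ℕ × ℕ => p.1 + p.2)
      (fun p hp => (mem_filter.1 hp).2)]
  refine sum_congr rfl fun s hs => sum_congr ?_ fun _ _ => rfl
  ext p
  simp only [HasAntidiagonal.mem_antidiagonal, mem_filter, mem_product, mem_range] at hs ⊢
  omega

/-- The third relation of (A). Both sides expand to the double sum over `i, q` of `(-1)^(m+i+q)
C(n,q) ∂^(i)` applied to `x` times (index `n - q`) the product of `y` and `b` with index `m + i +
q`. -/
theorem curly_nprod (n m : ℕ) (x y b : C) :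
    curly k m b (nprod k n x y) = nprod k n x (curly k m b y) := by
  obtain ⟨M₀, hM₀⟩ := locality (k := k) y b
  -- Besides being a locality bound, `M` exceeds `n`, so the range of `q` up to `n` fits into the
  -- square.
  obtain ⟨M, hM, hnM⟩ : ∃ M, (∀ i, M ≤ i → nprod k i y b = 0) ∧ n < M :=
    ⟨M₀ + n + 1, fun i hi => hM₀ i (by omega), by omega⟩
  rw [curly_eq_sum m M b y fun s hs => hM _ (by omega),
    curly_eq_sum m M b (nprod k n x y) fun s hs => by
      rw [nprod_nprod_left]
      exact sum_eq_zero fun q _ => by rw [hM _ (by omega), map_zero, smul_zero], map_sum]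
  have h1 : ∀ s ∈ range M, nprod k n x (((-1 : k) ^ (m + s)) • dder k s (nprod k (m + s) y b)) =
      ∑ p ∈ antidiagonal s, ((-1 : k) ^ (m + p.1 + p.2) * n.choose p.2) • dder k p.1
        (nprod k (n - p.2) x (nprod k (m + p.1 + p.2) y b)) := fun s _ => by
    rw [map_smul, nprod_dder, smul_sum]
    refine sum_congr rfl fun p hp => ?_
    rw [← mem_antidiagonal.1 hp, smul_smul, add_assoc]
  rw [sum_congr rfl h1, sum_range_antidiagonal M (fun p => ((-1 : k) ^ (m + p.1 + p.2) *
    n.choose p.2) • dder k p.1 (nprod k (n - p.2) x (nprod k (m + p.1 + p.2) y b))) fun p hp => by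
      rw [hM _ (by omega), map_zero, map_zero, smul_zero]]
  refine sum_congr rfl fun i _ => ?_
  rw [nprod_nprod_left, map_sum, smul_sum]
  refine (sum_subset (range_subset_range.2 hnM) fun q _ hq => ?_).trans ?_
  · rw [Nat.choose_eq_zero_of_lt (by simpa using hq)]
    simp
  · refine sum_congr rfl fun q _ => ?_
    rw [map_smul, smul_smul]
    congr 1
    rw [pow_add _ (m + i)]
    ring

end Identities

/-! ### Generation of `Conf(X, N)` by left multiplications, and ideals as stable subspaces -/

section Generation

variable {k : Type u} {X : Type v} [Field k] {N : X → X → ℕ}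

open Finset

/-- A subspace of `Conf(X, N)` that contains the generators and is stable under `∂` and the left
products with generators is everything. -/
theorem Conf.eq_top_of_stable {P : Submodule k (Conf k N)} (hg : ∀ a, Conf.gen k N a ∈ P)
    (hd : ∀ f ∈ P, der k f ∈ P) (hL : ∀ n a, ∀ f ∈ P, nprod k n (Conf.gen k N a) f ∈ P) :
    P = ⊤ := by
  have h1 : ∀ (p : ConfMon X) (n : ℕ), ∀ f ∈ P, nprod k n (Conf.mon k N p) f ∈ P := by
    intro p
    induction p with
    | gen a => exact fun n f hf => hL n a f hf
    | der p ih =>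
      intro n f hf
      rw [Conf.mon_der, Conf.der_nprod]
      exact neg_mem (P.smul_mem _ (ih _ f hf))
    | prod m p q ihp ihq =>
      intro n f hf
      rw [Conf.mon_prod, nprod_nprod_left]
      exact P.sum_mem fun i _ => P.smul_mem _ (ihp _ _ (ihq _ f hf))
  have h2 : ∀ p : ConfMon X, Conf.mon k N p ∈ P := by
    intro p
    induction p with
    | gen a => exact hg a
    | der p ih => rw [Conf.mon_der]; exact hd _ ih
    | prod n p q _ ih => rw [Conf.mon_prod]; exact h1 p n _ ih
  refine eq_top_iff.2 fun f _ => ?_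
  obtain ⟨f, rfl⟩ := Submodule.Quotient.mk_surjective _ f
  exact preConf_induction k (P := fun f => (Submodule.Quotient.mk f : Conf k N) ∈ P)
    (by simp) (fun f g hf hg => by simpa using add_mem hf hg)
    (fun c f hf => by simpa using P.smul_mem c hf) h2 f

/-- A subspace of `Conf(X, N)` stable under the operators `∂`, `L_n^a`, `R_n^a` is an ideal. -/
theorem Conf.isConformalIdeal_of_stable {J : Submodule k (Conf k N)} (hd : ∀ f ∈ J, der k f ∈ J)
    (hL : ∀ n a, ∀ f ∈ J, nprod k n (Conf.gen k N a) f ∈ J)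
    (hR : ∀ n a, ∀ f ∈ J, curly k n (Conf.gen k N a) f ∈ J) : IsConformalIdeal J where
  der_mem := hd
  left_mem n y x hx := by
    let P : Submodule k (Conf k N) :=
      { carrier := {y | ∀ n, ∀ x ∈ J, nprod k n y x ∈ J}
        add_mem' := fun {y z} hy hz n x hx => by
          rw [map_add, LinearMap.add_apply]; exact add_mem (hy n x hx) (hz n x hx)
        zero_mem' := fun n x hx => by simp
        smul_mem' := fun c y hy n x hx => by
          rw [map_smul, LinearMap.smul_apply]; exact J.smul_mem _ (hy n x hx) }
    have hP : P = ⊤ := by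
      refine Conf.eq_top_of_stable (fun a n x hx => hL n a x hx) (fun f hf n x hx => ?_)
        fun m a f hf n x hx => ?_
      · rw [Conf.der_nprod]
        exact neg_mem (J.smul_mem _ (hf _ x hx))
      · rw [nprod_nprod_left]
        exact J.sum_mem fun i _ => J.smul_mem _ (hL _ _ _ (hf _ x hx))
    exact (hP ▸ Submodule.mem_top : y ∈ P) n x hx
  right_mem n y x hx := by
    -- The definition of `R_n^a` is triangular: up to sign its leading term is the product with
    -- index `n`, and the others are derivatives of products with larger index. Descending from the
    -- locality bound recovers every right product by a generator.
    have hgen : ∀ a, ∀ x ∈ J, ∀ n, nprod k n x (Conf.gen k N a) ∈ J := by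
      intro a x hx n
      obtain ⟨M, hM⟩ := AssocConformalAlgebra.locality (k := k) x (Conf.gen k N a)
      by_cases hn : M ≤ n
      · rw [hM n hn]; exact J.zero_mem
      obtain ⟨d, hd'⟩ : ∃ d, d = M - n := ⟨_, rfl⟩
      induction d using Nat.strong_induction_on generalizing n with
      | _ d ih =>
        have h1 := hR n a x hx
        -- The bound `M + 1` guarantees a term `s = 0` that can be split off.
        rw [curly_eq_sum n (M + 1) _ _ fun s hs => hM _ (by omega), sum_range_succ'] at h1
        have h2 : ∑ s ∈ range M, ((-1 : k) ^ (n + (s + 1))) •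
            dder k (s + 1) (nprod k (n + (s + 1)) x (Conf.gen k N a)) ∈ J := by
          refine J.sum_mem fun s _ => J.smul_mem _ (J.smul_mem _ ?_)
          have h3 : nprod k (n + (s + 1)) x (Conf.gen k N a) ∈ J := by
            by_cases hs : M ≤ n + (s + 1)
            · rw [hM _ hs]; exact J.zero_mem
            · exact ih _ (by omega) _ hs rfl
          generalize nprod k (n + (s + 1)) x (Conf.gen k N a) = z at h3
          induction s + 1 with
          | zero => simpa using h3
          | succ s ih => rw [pow_succ', Module.End.mul_apply]; exact hd _ ih
        have h4 := (J.add_mem_iff_right h2).1 h1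
        rw [dder_zero, add_zero] at h4
        have h5 := J.smul_mem ((-1 : k) ^ n) h4
        rwa [smul_smul, ← mul_pow, neg_one_mul, neg_neg, one_pow, one_smul] at h5
    let P : Submodule k (Conf k N) :=
      { carrier := {y | ∀ n, ∀ x ∈ J, nprod k n x y ∈ J}
        add_mem' := fun {y z} hy hz n x hx => by
          rw [map_add]; exact add_mem (hy n x hx) (hz n x hx)
        zero_mem' := fun n x hx => by simp
        smul_mem' := fun c y hy n x hx => by
          rw [map_smul]; exact J.smul_mem _ (hy n x hx) }
    have hP : P = ⊤ := by
      refine Conf.eq_top_of_stable (fun a n x hx => hgen a x hx n) (fun f hf n x hx => ?_)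
        fun m a f hf n x hx => ?_
      · rw [Conf.nprod_der]
        exact add_mem (hd _ (hf _ x hx)) (J.smul_mem _ (hf _ x hx))
      · rw [Conf.assoc]
        exact J.sum_mem fun i _ => J.smul_mem _ (hf _ _ (hgen a x hx _))
    exact (hP ▸ Submodule.mem_top : y ∈ P) n x hx

end Generation

/-! ## Conformal sequences -/

section Sequences

variable (k : Type u) {A : Type w} [Field k] [Ring A] [Algebra k A]

/-- Sequences in an associative algebra, with the operations of formal distributions. -/
def ConfSeq (A : Type w) : Type w := ℕ → A

instance : AddCommGroup (ConfSeq A) := inferInstanceAs (AddCommGroup (ℕ → A))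
instance : Module k (ConfSeq A) := inferInstanceAs (Module k (ℕ → A))

/-- The shift of sequences. -/
def ConfSeq.shift : ConfSeq A →ₗ[k] ConfSeq A where
  toFun x := fun n => x (n + 1)
  map_add' _ _ := rfl
  map_smul' _ _ := rfl

/-- The products of sequences: `(x ₙ y)(m) = ∑ (-1)^s (n choose s) x(n - s) y(m + s)`. -/
def ConfSeq.prod : ℕ → ConfSeq A →ₗ[k] ConfSeq A →ₗ[k] ConfSeq A
  | 0 => LinearMap.mk₂ k (fun x y => fun m => x 0 * y m)
      (fun _ _ _ => funext fun _ => add_mul _ _ _) (fun _ _ _ => funext fun _ => smul_mul_assoc _ _ _)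
      (fun _ _ _ => funext fun _ => mul_add _ _ _) (fun _ _ _ => funext fun _ => mul_smul_comm _ _ _)
  | n + 1 => (ConfSeq.prod n).comp (ConfSeq.shift k) - (ConfSeq.prod n).compl₂ (ConfSeq.shift k)

/-- The operations on coefficients of `x(z) = ∑ x(n) z^(-n-1)`: `∂` is `d/dz`, and the factor `n`
makes the truncated `n - 1` harmless. Locality fails in general, so only the other three axioms are
established. -/
instance : ConformalOps k (ConfSeq A) where
  derOp :=
    { toFun := fun x => fun n => -((n : k) • x (n - 1))
      map_add' := fun x y => funext fun n => by
        change -((n : k) • (x (n - 1) + y (n - 1))) = -((n : k) • x (n - 1)) + -((n : k) • y (n - 1))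
        rw [smul_add, neg_add]
      map_smul' := fun c x => funext fun n => by
        change -((n : k) • (c • x (n - 1))) = c • -((n : k) • x (n - 1))
        rw [smul_comm, smul_neg] }
  nprodOp := ConfSeq.prod k

namespace ConfSeq

theorem der_apply (x : ConfSeq A) (n : ℕ) : der k x n = -((n : k) • x (n - 1)) := rfl

theorem shift_apply (x : ConfSeq A) (n : ℕ) : shift k x n = x (n + 1) := rfl

theorem nprod_zero_apply (x y : ConfSeq A) (m : ℕ) : nprod k 0 x y m = x 0 * y m := rfl

/-- The shift is multiplication by the formal variable, so this is the factorization `(z - w)^(n+1)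
= (z - w)^n (z - w)`; the identities below follow from it by induction on `n`. -/
theorem nprod_succ (n : ℕ) (x y : ConfSeq A) :
    nprod k (n + 1) x y = nprod k n (shift k x) y - nprod k n x (shift k y) := rfl

theorem sub_apply (x y : ConfSeq A) (m : ℕ) : (x - y) m = x m - y m := rfl

theorem add_apply (x y : ConfSeq A) (m : ℕ) : (x + y) m = x m + y m := rfl

theorem smul_apply (c : k) (x : ConfSeq A) (m : ℕ) : (c • x) m = c • x m := rfl

theorem shift_nprod (n : ℕ) (x y : ConfSeq A) :
    shift k (nprod k n x y) = nprod k n x (shift k y) := by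
  induction n generalizing x y with
  | zero => rfl
  | succ n ih => rw [nprod_succ, map_sub, ih, ih, nprod_succ]

theorem shift_der (x : ConfSeq A) : shift k (der k x) = der k (shift k x) - x := by
  funext n
  rw [sub_apply, shift_apply, der_apply, der_apply, shift_apply]
  rcases n with _ | n
  · simp
  · rw [Nat.add_sub_cancel, Nat.add_sub_cancel, Nat.cast_add (n + 1), Nat.cast_one, add_smul,
      one_smul, neg_add, sub_eq_add_neg]

theorem der_nprod (n : ℕ) (x y : ConfSeq A) :
    nprod k n (der k x) y = -((n : k) • nprod k (n - 1) x y) := by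
  induction n generalizing x y with
  | zero =>
    funext m
    rw [nprod_zero_apply, der_apply]
    simp only [Nat.cast_zero, zero_smul, neg_zero, zero_mul]
    rfl
  | succ n ih =>
    rw [nprod_succ, shift_der, map_sub, LinearMap.sub_apply, ih, ih, Nat.add_sub_cancel]
    rcases n with _ | n
    · simp
    · rw [Nat.add_sub_cancel, Nat.cast_add (n + 1), Nat.cast_one, add_smul, one_smul]
      conv_rhs => rw [nprod_succ]
      rw [smul_sub, nprod_succ]
      abel

theorem nprod_der (n : ℕ) (x y : ConfSeq A) :
    nprod k n x (der k y) = der k (nprod k n x y) + (n : k) • nprod k (n - 1) x y := by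
  induction n generalizing x y with
  | zero =>
    funext m
    rw [add_apply, nprod_zero_apply, der_apply, der_apply, nprod_zero_apply, smul_apply]
    simp
  | succ n ih =>
    rw [nprod_succ, shift_der, map_sub, ih, ih, nprod_succ, map_sub, Nat.add_sub_cancel]
    rcases n with _ | n
    · simp; abel
    · rw [Nat.add_sub_cancel, Nat.cast_add (n + 1), Nat.cast_one, add_smul, one_smul]
      have e : ((n + 1 : ℕ) : k) • nprod k (n + 1) x y = ((n + 1 : ℕ) : k) •
          nprod k n (shift k x) y - ((n + 1 : ℕ) : k) • nprod k n x (shift k y) := by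
        rw [nprod_succ, smul_sub]
      rw [e]
      abel

/-- Pascal's rule drives the induction on `n`: each step contributes the product with index `s + 1`
and the one with index `s`, and the two sums merge. -/
theorem assoc (n m : ℕ) (x y z : ConfSeq A) : nprod k n x (nprod k m y z) =
    ∑ s ∈ Finset.range (n + 1), (n.choose s : k) • nprod k (n + m - s) (nprod k s x y) z := by
  induction n generalizing m x y z with
  | zero =>
    simp only [zero_add, Finset.range_one, Finset.sum_singleton, Nat.choose_self, Nat.cast_one,
      one_smul, Nat.sub_zero]
    induction m generalizing y z with
    | zero =>
      funext i
      simp only [nprod_zero_apply, mul_assoc]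
    | succ m ih =>
      rw [nprod_succ, map_sub, ih, ih, nprod_succ, shift_nprod]
  | succ n ih =>
    have h : ∀ s ∈ Finset.range (n + 1),
        (n.choose s : k) • nprod k (n + m - s) (nprod k s (shift k x) y) z -
          (n.choose s : k) • nprod k (n + m - s) (nprod k s x y) (shift k z) =
        (n.choose s : k) • nprod k (n + 1 + m - (s + 1)) (nprod k (s + 1) x y) z +
          (n.choose s : k) • nprod k (n + 1 + m - s) (nprod k s x y) z := by
      intro s hs
      have hs : s ≤ n := by simpa [Nat.lt_succ_iff] using hs
      rw [show n + 1 + m - s = n + m - s + 1 by omega, nprod_succ _ (n + m - s), shift_nprod,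
        show n + 1 + m - (s + 1) = n + m - s by omega, nprod_succ _ s, map_sub,
        LinearMap.sub_apply, ← smul_sub, ← smul_add]
      congr 1
      abel
    rw [nprod_succ, shift_nprod, ih, ih, ← Finset.sum_sub_distrib, Finset.sum_congr rfl h,
      Finset.sum_add_distrib, Finset.sum_range_succ' _ (n + 1)]
    simp only [Nat.choose_succ_succ', Nat.cast_add, add_smul, Finset.sum_add_distrib]
    refine Eq.trans (congrArg _ ?_) (add_assoc _ _ _).symm
    have h' := (Finset.sum_range_succ (fun s => (n.choose s : k) •
      nprod k (n + 1 + m - s) (nprod k s x y) z) (n + 1)).symm.trans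
        (Finset.sum_range_succ' _ (n + 1))
    rw [Nat.choose_succ_self, Nat.cast_zero, zero_smul, add_zero] at h'
    simpa using h'

/-- The scalar is `(-1)^s p (p-1) ⋯ (p-s+1)`, nonzero in characteristic zero because `s ≤ p`. -/
theorem pow_der_apply [CharZero k] (y : ConfSeq A) (s p : ℕ) (h : s ≤ p) :
    ∃ c : k, c ≠ 0 ∧ ((der k) ^ s : Module.End k (ConfSeq A)) y p = c • y (p - s) := by
  induction s generalizing p with
  | zero => exact ⟨1, one_ne_zero, by simp⟩
  | succ s ih =>
    obtain ⟨c, hc, hy⟩ := ih (p - 1) (by omega)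
    refine ⟨-((p : k) * c), neg_ne_zero.2 (mul_ne_zero (Nat.cast_ne_zero.2 (by omega)) hc), ?_⟩
    rw [pow_succ', Module.End.mul_apply, der_apply, hy, smul_smul, neg_smul,
      show p - 1 - s = p - (s + 1) by omega]

end ConfSeq

variable {k} in
/-- Homomorphisms from `Conf(X, N)`; the locality of arbitrary elements of the target is not
needed. -/
theorem Conf.exists_hom {X : Type v} (N : X → X → ℕ) {C : Type w} [AddCommGroup C] [Module k C]
    [ConformalOps k C]
    (h1 : ∀ (n : ℕ) (x y : C), nprod k n (der k x) y = -((n : k) • nprod k (n - 1) x y))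
    (h2 : ∀ (n : ℕ) (x y : C),
      nprod k n x (der k y) = der k (nprod k n x y) + (n : k) • nprod k (n - 1) x y)
    (h3 : ∀ (n m : ℕ) (x y z : C), nprod k n x (nprod k m y z) =
      ∑ s ∈ Finset.range (n + 1), (n.choose s : k) • nprod k (n + m - s) (nprod k s x y) z)
    (φ : X → C) (hφ : ∀ a b n, N a b ≤ n → nprod k n (φ a) (φ b) = 0) :
    ∃ F : Conf k N →ₗ[k] C, IsConformalHom k F ∧ ∀ a, F (Conf.gen k N a) = φ a := by
  let E : PreConf k X →ₗ[k] C :=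
    Finsupp.lsum k fun p => LinearMap.toSpanSingleton k C (ConfMon.eval k φ p)
  have hEm : ∀ p, E (PreConf.mon k p) = ConfMon.eval k φ p := fun p => by
    change (Finsupp.lsum k fun p => LinearMap.toSpanSingleton k C (ConfMon.eval k φ p))
      (Finsupp.single p (1 : k)) = _
    simp
  have hEd : ∀ f, E (der k f) = der k (E f) := by
    refine preConf_induction k (by simp) (fun f g hf hg => by simp [hf, hg])
      (fun c f hf => by simp [hf]) fun p => ?_
    rw [preConf_der_mon, hEm, hEm]; rfl
  have hEp : ∀ n f g, E (nprod k n f g) = nprod k n (E f) (E g) := by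
    intro n f g
    refine preConf_induction k (P := fun f => E (nprod k n f g) = nprod k n (E f) (E g))
      (by simp) (fun f g hf hg => by simp [hf, hg]) (fun c f hf => by simp [hf]) (fun p => ?_) f
    refine preConf_induction k (P := fun g => E (nprod k n _ g) = nprod k n _ (E g))
      (by simp) (fun f g hf hg => by simp [hf, hg]) (fun c f hf => by simp [hf]) (fun q => ?_) g
    rw [preConf_nprod_mon, hEm, hEm, hEm]; rfl
  have hker : conformalIdealSpan k {f : PreConf k X | ConfRel k N f} ≤ LinearMap.ker E := by
    refine conformalIdealSpan_le ⟨fun x hx => ?_, fun n y x hx => ?_, fun n y x hx => ?_⟩ ?_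
    · rw [LinearMap.mem_ker] at hx ⊢; rw [hEd, hx, map_zero]
    · rw [LinearMap.mem_ker] at hx ⊢; rw [hEp, hx, map_zero]
    · rw [LinearMap.mem_ker] at hx ⊢; rw [hEp, hx, map_zero, LinearMap.zero_apply]
    · rintro f (⟨n, f, g⟩ | ⟨n, f, g⟩ | ⟨n, m, f, g, h⟩ | ⟨a, b, n, hn⟩)
      · simp [hEp, hEd, h1]
      · simp [hEp, hEd, h2]
      · simp only [SetLike.mem_coe, LinearMap.mem_ker, map_sub, map_sum, map_smul, hEp]
        rw [h3, sub_self]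
      · rw [SetLike.mem_coe, LinearMap.mem_ker, hEp, hEm, hEm]
        exact hφ a b n hn
  refine ⟨Submodule.liftQ _ E hker, ⟨fun x => ?_, fun n x y => ?_⟩, fun a => hEm _⟩
  · obtain ⟨x, rfl⟩ := Submodule.Quotient.mk_surjective _ x
    exact hEd x
  · obtain ⟨x, rfl⟩ := Submodule.Quotient.mk_surjective _ x
    obtain ⟨y, rfl⟩ := Submodule.Quotient.mk_surjective _ y
    exact hEp n x y

end Sequences

/-! ## Linear independence of the words of `Conf(X, N)` -/

theorem exists_max_of_isStrictTotalOrder {ι β : Type*} {r : β → β → Prop}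
    [IsStrictTotalOrder β r] (f : ι → β) {s : Finset ι} (hs : s.Nonempty) :
    ∃ i ∈ s, ∀ j ∈ s, f j = f i ∨ r (f j) (f i) := by
  classical
  let _ := linearOrderOfSTO r
  exact Finset.exists_max_image s f hs

section Model

variable (k : Type u) {X : Type v} [Field k]

/-- The space of the model: words with arbitrary exponents. -/
abbrev ListSpace (k : Type u) (X : Type v) [Field k] : Type (max u v) := List (ℕ × X) →₀ k

/-- Prepending a letter. -/
def consOp (p : ℕ × X) : ListSpace k X →ₗ[k] ListSpace k X :=
  Finsupp.lmapDomain k k (List.cons p)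

theorem consOp_single (p : ℕ × X) (l : List (ℕ × X)) (c : k) :
    consOp k p (Finsupp.single l c) = Finsupp.single (p :: l) c :=
  Finsupp.mapDomain_single

/-- Multiplication by the first variable, on the basis. -/
def firstVarBasis : List (ℕ × X) → ListSpace k X
  | [] => 0
  | p :: l => Finsupp.single ((p.1 + 1, p.2) :: l) 1 + consOp k p (firstVarBasis l)

/-- Multiplication by the first variable. -/
def firstVar : ListSpace k X →ₗ[k] ListSpace k X :=
  Finsupp.linearCombination k (firstVarBasis k)

theorem firstVar_single (l : List (ℕ × X)) :
    firstVar k (Finsupp.single l 1) = firstVarBasis k l := by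
  simp [firstVar]

/-- The identity `t_1 = (t_1 - t_2) + t_2`: either the exponent of the first letter rises, or the
first variable of the tail multiplies. -/
theorem firstVar_consOp (n : ℕ) (a : X) (v : ListSpace k X) :
    firstVar k (consOp k (n, a) v) = consOp k (n + 1, a) v + consOp k (n, a) (firstVar k v) := by
  have : firstVar k ∘ₗ consOp k (n, a) =
      consOp k (n + 1, a) + consOp k (n, a) ∘ₗ firstVar (X := X) k := by
    refine Finsupp.lhom_ext' fun l => LinearMap.ext_ring ?_
    simp only [LinearMap.comp_apply, LinearMap.add_apply, Finsupp.lsingle_apply]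
    rw [consOp_single, firstVar_single, consOp_single, firstVar_single, firstVarBasis]
  exact LinearMap.congr_fun this v

variable {k}

theorem ListSpace.map_le_of_single {s t : Set (List (ℕ × X))}
    {f : ListSpace k X →ₗ[k] ListSpace k X}
    (h : ∀ l ∈ s, f (Finsupp.single l 1) ∈ Finsupp.supported k k t) {v : ListSpace k X}
    (hv : v ∈ Finsupp.supported k k s) : f v ∈ Finsupp.supported k k t := by
  rw [Finsupp.supported_eq_span_single] at hv
  have : Submodule.span k ((fun i => Finsupp.single i (1 : k)) '' s) ≤
      (Finsupp.supported k k t).comap f :=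
    Submodule.span_le.2 (by rintro _ ⟨l, hl, rfl⟩; exact h l hl)
  exact this hv

variable (k)

/-- The vectors whose words begin with the letter `a`. -/
def headSpace (a : X) : Submodule k (ListSpace k X) :=
  Finsupp.supported k k {l | ∃ n w, l = (n, a) :: w}

/-- The vectors whose words begin with a letter `(m, a)`, `m < n`. -/
def lowSpace (n : ℕ) (a : X) : Submodule k (ListSpace k X) :=
  Finsupp.supported k k {l | ∃ m < n, ∃ w, l = (m, a) :: w}

/-- Admissibility of a pair of consecutive letters. -/
def AdmPair (N : X → X → ℕ) (p q : ℕ × X) : Prop := p.1 < N p.2 q.2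

/-- The span of the inadmissible words. -/
def badSpace (N : X → X → ℕ) : Submodule k (ListSpace k X) :=
  Finsupp.supported k k {l | ¬ List.IsChain (AdmPair N) l}

variable {k}

theorem consOp_mem_supported {s t : Set (List (ℕ × X))} {p : ℕ × X} (h : ∀ l ∈ s, p :: l ∈ t)
    {v : ListSpace k X} (hv : v ∈ Finsupp.supported k k s) :
    consOp k p v ∈ Finsupp.supported k k t :=
  ListSpace.map_le_of_single (fun l hl => by
    rw [consOp_single]; exact Finsupp.single_mem_supported k 1 (h l hl)) hv

theorem consOp_mem_headSpace (n : ℕ) (a : X) (v : ListSpace k X) :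
    consOp k (n, a) v ∈ headSpace k a :=
  consOp_mem_supported (s := Set.univ) (t := {l | ∃ n w, l = (n, a) :: w}) (fun l _ => ⟨n, l, rfl⟩) (by simp)

theorem consOp_mem_lowSpace {m n : ℕ} (h : m < n) (a : X) (v : ListSpace k X) :
    consOp k (m, a) v ∈ lowSpace k n a :=
  consOp_mem_supported (s := Set.univ) (t := {l | ∃ m < n, ∃ w, l = (m, a) :: w})
    (fun l _ => ⟨m, h, l, rfl⟩) (by simp)

theorem firstVar_mem_headSpace {a : X} {v : ListSpace k X} (h : v ∈ headSpace k a) :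
    firstVar k v ∈ headSpace k a := by
  refine ListSpace.map_le_of_single ?_ h
  rintro _ ⟨n, w, rfl⟩
  rw [← consOp_single, firstVar_consOp]
  exact add_mem (consOp_mem_headSpace _ _ _) (consOp_mem_headSpace _ _ _)

theorem firstVar_mem_lowSpace {n : ℕ} {a : X} {v : ListSpace k X} (h : v ∈ lowSpace k n a) :
    firstVar k v ∈ lowSpace k (n + 1) a := by
  refine ListSpace.map_le_of_single ?_ h
  rintro _ ⟨m, hm, w, rfl⟩
  rw [← consOp_single, firstVar_consOp]
  exact add_mem (consOp_mem_lowSpace (by omega) _ _) (consOp_mem_lowSpace (by omega) _ _)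

theorem lowSpace_mono {m n : ℕ} (h : m ≤ n) (a : X) : lowSpace k m a ≤ lowSpace k n a :=
  Finsupp.supported_mono fun _ ⟨i, hi, w, hw⟩ => ⟨i, by omega, w, hw⟩

variable {N : X → X → ℕ}

theorem consOp_mem_badSpace {p : ℕ × X} {v : ListSpace k X} (h : v ∈ badSpace k N) :
    consOp k p v ∈ badSpace k N :=
  consOp_mem_supported (s := {l | ¬ List.IsChain (AdmPair N) l})
    (t := {l | ¬ List.IsChain (AdmPair N) l}) (fun _ hl hc => hl hc.tail) h

theorem consOp_mem_badSpace_of_le {n : ℕ} {a b : X} {v : ListSpace k X} (h : v ∈ headSpace k b)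
    (hn : N a b ≤ n) : consOp k (n, a) v ∈ badSpace k N := by
  refine consOp_mem_supported ?_ h
  rintro _ ⟨m, w, rfl⟩ hc
  exact absurd (List.isChain_cons_cons.1 hc).1 (not_lt.2 hn)

/-- Multiplication by `t_1` only raises exponents and keeps the letters, so an exponent that is too
large stays too large. -/
theorem firstVarBasis_mem_badSpace (l : List (ℕ × X)) (h : ¬ List.IsChain (AdmPair N) l) :
    firstVarBasis k l ∈ badSpace k N := by
  induction l with
  | nil => exact absurd List.isChain_nil h
  | cons p l ih =>
    rw [firstVarBasis]
    rcases l with _ | ⟨q, l⟩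
    · exact absurd (List.isChain_singleton p) h
    by_cases hl : List.IsChain (AdmPair N) (q :: l)
    · have hp : N p.2 q.2 ≤ p.1 := by
        by_contra hp
        exact h (List.isChain_cons_cons.2 ⟨not_le.1 hp, hl⟩)
      refine add_mem ?_ (consOp_mem_badSpace_of_le (b := q.2) ?_ hp)
      · refine Finsupp.single_mem_supported k 1 fun hc => ?_
        have := (List.isChain_cons_cons.1 hc).1
        simp only [AdmPair] at this
        omega
      · rw [← firstVar_single]
        exact firstVar_mem_headSpace (Finsupp.single_mem_supported k 1 ⟨q.1, l, rfl⟩)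
    · exact add_mem (Finsupp.single_mem_supported k 1 fun hc => hl hc.tail)
        (consOp_mem_badSpace (ih hl))

theorem firstVar_mem_badSpace {v : ListSpace k X} (h : v ∈ badSpace k N) :
    firstVar k v ∈ badSpace k N :=
  ListSpace.map_le_of_single (fun l hl => by
    rw [firstVar_single]; exact firstVarBasis_mem_badSpace l hl) h

theorem pow_firstVar_mem {P : Submodule k (ListSpace k X)} (hP : ∀ v ∈ P, firstVar k v ∈ P) (i : ℕ)
    {v : ListSpace k X} (h : v ∈ P) : (firstVar k ^ i) v ∈ P := by
  induction i with
  | zero => exact h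
  | succ i ih => rw [pow_succ', Module.End.mul_apply]; exact hP _ ih

variable (k N)

/-- The quotient of the model by the inadmissible words. -/
abbrev ModelSpace : Type (max u v) := ListSpace k X ⧸ badSpace k N

/-- The operators `a(i)` of the model. -/
def modelOp (a : X) (i : ℕ) : Module.End k (ModelSpace k N) :=
  Submodule.mapQ _ _ ((firstVar k ^ i) ∘ₗ consOp k (0, a)) fun _ hv =>
    pow_firstVar_mem (fun _ => firstVar_mem_badSpace) i (consOp_mem_badSpace hv)

/-- The sequence `i ↦ a(i + j)`. -/
def modelSeq (a : X) (j : ℕ) : ConfSeq (Module.End k (ModelSpace k N)) :=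
  fun i => modelOp k N a (i + j)

theorem modelSeq_mk (a : X) (j i : ℕ) (v : ListSpace k X) :
    modelSeq k N a j i (Submodule.Quotient.mk v) =
      Submodule.Quotient.mk ((firstVar k ^ (i + j)) (consOp k (0, a) v)) := rfl

theorem shift_modelSeq (a : X) (j : ℕ) :
    ConfSeq.shift k (modelSeq k N a j) = modelSeq k N a (j + 1) :=
  funext fun i => congrArg (modelOp k N a) (by omega)

/-- Shifting the first sequence multiplies by `t_1`, shifting the second by `t_2`; hence the `n`-th
product inserts `(t_1 - t_2)^n`, that is, the exponent `n` at the letter `a`. -/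
theorem nprod_modelSeq (a b : X) (n j l m : ℕ) (v : ListSpace k X) :
    nprod k n (modelSeq k N a j) (modelSeq k N b l) m (Submodule.Quotient.mk v) =
      Submodule.Quotient.mk ((firstVar k ^ j) (consOp k (n, a)
        ((firstVar k ^ (m + l)) (consOp k (0, b) v)))) := by
  induction n generalizing j l with
  | zero =>
    rw [ConfSeq.nprod_zero_apply, Module.End.mul_apply, modelSeq_mk, modelSeq_mk, zero_add]
  | succ n ih =>
    rw [ConfSeq.nprod_succ, shift_modelSeq, shift_modelSeq, ConfSeq.sub_apply, LinearMap.sub_apply,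
      ih, ih, ← Submodule.Quotient.mk_sub, pow_succ _ j, Module.End.mul_apply, ← map_sub,
      firstVar_consOp, ← add_assoc, pow_succ' _ (m + l), Module.End.mul_apply, add_sub_cancel_right]

theorem nprod_modelSeq_eq_zero (a b : X) (n : ℕ) (h : N a b ≤ n) :
    nprod k n (modelSeq k N a 0) (modelSeq k N b 0) = 0 := by
  funext m
  refine LinearMap.ext fun v => ?_
  obtain ⟨v, rfl⟩ := Submodule.Quotient.mk_surjective _ v
  rw [nprod_modelSeq]
  exact (Submodule.Quotient.mk_eq_zero _).2 (consOp_mem_badSpace_of_le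
    (pow_firstVar_mem (fun _ => firstVar_mem_headSpace) _ (consOp_mem_headSpace _ _ _)) h)

theorem pow_firstVar_consOp (j : ℕ) (a : X) (v : ListSpace k X) :
    ∃ u ∈ lowSpace k j a, (firstVar k ^ j) (consOp k (0, a) v) = consOp k (j, a) v + u := by
  induction j with
  | zero => exact ⟨0, zero_mem _, by simp⟩
  | succ j ih =>
    obtain ⟨u, hu, h⟩ := ih
    refine ⟨consOp k (j, a) (firstVar k v) + firstVar k u,
      add_mem (consOp_mem_lowSpace (by omega) _ _) (firstVar_mem_lowSpace hu), ?_⟩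
    rw [pow_succ', Module.End.mul_apply, h, map_add, firstVar_consOp, add_assoc]

/-- For a general `y` the shift need not be multiplication by `t_2`, so the exact formula is
replaced by its leading part; the error has smaller exponent at the first letter. -/
theorem nprod_modelSeq_apply (a : X) (n j : ℕ) (y : ConfSeq (Module.End k (ModelSpace k N)))
    (e : ModelSpace k N) (w : ℕ → ListSpace k X)
    (h : ∀ p, y p e = Submodule.Quotient.mk (w p)) (p : ℕ) :
    ∃ u ∈ lowSpace k (n + j) a, nprod k n (modelSeq k N a j) y p e =
      Submodule.Quotient.mk (consOp k (n + j, a) (w p) + u) := by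
  induction n generalizing j y w with
  | zero =>
    obtain ⟨u, hu, hu'⟩ := pow_firstVar_consOp k j a (w p)
    refine ⟨u, by simpa using hu, ?_⟩
    rw [ConfSeq.nprod_zero_apply, Module.End.mul_apply, h, modelSeq_mk, zero_add, hu']
  | succ n ih =>
    obtain ⟨u, hu, hu'⟩ := ih (j + 1) y w h
    obtain ⟨t, ht, ht'⟩ := ih j (ConfSeq.shift k y) (fun p => w (p + 1)) fun p => h (p + 1)
    refine ⟨u - (consOp k (n + j, a) (w (p + 1)) + t), sub_mem ?_ (add_mem
      (consOp_mem_lowSpace (by omega) _ _) (lowSpace_mono (by omega) _ ht)), ?_⟩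
    · exact lowSpace_mono (by omega) _ hu
    · rw [ConfSeq.nprod_succ, shift_modelSeq, ConfSeq.sub_apply, LinearMap.sub_apply, hu', ht',
        ← Submodule.Quotient.mk_sub, show n + (j + 1) = n + 1 + j by omega, add_sub_assoc]

/-- The left-normed words without `∂`. -/
def leftWord (l : List (ℕ × X)) (x : X) : Conf k N :=
  l.foldr (fun q f => nprod k q.1 (Conf.gen k N q.2) f) (Conf.gen k N x)

variable {N} in
theorem isChain_of_isAdmissible {l : List (ℕ × X)} {x : X} (h : IsAdmissible N l x) (p : ℕ) :
    List.IsChain (AdmPair N) (l ++ [(p, x)]) := by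
  induction l with
  | nil => exact List.isChain_singleton _
  | cons q l ih =>
    rcases l with _ | ⟨q', l⟩
    · exact List.isChain_cons_cons.2 ⟨h, List.isChain_singleton _⟩
    · exact List.isChain_cons_cons.2 ⟨h.1, ih h.2⟩

variable [LinearOrder X]

/-- The lexicographic order of the words of the model. -/
def listLT : List (ℕ × X) → List (ℕ × X) → Prop := List.Lex (Prod.Lex (· < ·) (· < ·))

instance : IsStrictTotalOrder (List (ℕ × X)) listLT :=
  have : IsStrictTotalOrder (ℕ × X) (Prod.Lex (· < ·) (· < ·)) := { }
  have : IsStrictTotalOrder (List (ℕ × X)) (List.Lex (Prod.Lex (· < ·) (· < ·))) :=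
    { isStrictWeakOrder_of_isOrderConnected with }
  this

/-- `l` is the principal word of `v`. -/
def LeadsAt (v : ListSpace k X) (l : List (ℕ × X)) : Prop :=
  v l ≠ 0 ∧ ∀ l', v l' ≠ 0 → l' = l ∨ listLT l' l

variable {k}

/-- Lists starting with `(m, a)`, `m < n`, precede all lists starting with `(n, a)`, so the
correction cannot affect the principal list. -/
theorem LeadsAt.consOp_add {v u : ListSpace k X} {l : List (ℕ × X)} (h : LeadsAt k v l) {n : ℕ}
    {a : X} (hu : u ∈ lowSpace k n a) : LeadsAt k (consOp k (n, a) v + u) ((n, a) :: l) := by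
  have hu' : ∀ l', u l' ≠ 0 → ∃ m < n, ∃ w, l' = (m, a) :: w := fun l' hl' =>
    (Finsupp.mem_supported k u).1 hu (Finsupp.mem_support_iff.2 hl')
  have hinj : Function.Injective (List.cons (n, a)) := List.cons_injective
  constructor
  · have h0 : u ((n, a) :: l) = 0 := by
      by_contra h0
      obtain ⟨m, hm, w, hw⟩ := hu' _ h0
      simp only [List.cons.injEq, Prod.mk.injEq] at hw
      omega
    rw [Finsupp.add_apply, h0, add_zero]
    change Finsupp.mapDomain _ v _ ≠ 0
    rw [Finsupp.mapDomain_apply hinj]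
    exact h.1
  · intro l' hl'
    by_cases h0 : u l' = 0
    · rw [Finsupp.add_apply, h0, add_zero] at hl'
      change Finsupp.mapDomain _ v _ ≠ 0 at hl'
      by_cases hr : l' ∈ Set.range (List.cons (n, a))
      · obtain ⟨l', rfl⟩ := hr
        rw [Finsupp.mapDomain_apply hinj] at hl'
        exact (h.2 l' hl').imp (congrArg _) List.Lex.cons
      · exact absurd (Finsupp.mapDomain_of_notMem_range _ _ hr) hl'
    · obtain ⟨m, hm, w, rfl⟩ := hu' _ h0
      exact Or.inr (List.Lex.rel (Prod.Lex.left _ _ hm))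

variable {N}

/-- The image of a left-normed word remembers the whole word: its exponents are the exponents of the
principal list, and the coefficient index `p` becomes the exponent of the last letter. -/
theorem leftWord_lead {F : Conf k N →ₗ[k] ConfSeq (Module.End k (ModelSpace k N))}
    (hF : IsConformalHom k F) (hg : ∀ a, F (Conf.gen k N a) = modelSeq k N a 0)
    (l : List (ℕ × X)) (x : X) (p : ℕ) :
    ∃ v, F (leftWord k N l x) p (Submodule.Quotient.mk (Finsupp.single [] 1)) =
      Submodule.Quotient.mk v ∧ LeadsAt k v (l ++ [(p, x)]) := by
  induction l generalizing p with
  | nil =>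
    obtain ⟨u, hu, hu'⟩ := pow_firstVar_consOp k p x (Finsupp.single [] 1)
    refine ⟨_, ?_, LeadsAt.consOp_add (v := Finsupp.single [] 1) (l := []) ⟨by simp, ?_⟩ hu⟩
    · change F (Conf.gen k N x) p _ = _
      rw [hg, modelSeq_mk, add_zero, hu']
    · intro l' hl'
      refine Or.inl ?_
      by_contra hne
      exact hl' (Finsupp.single_eq_of_ne hne)
  | cons q l ih =>
    choose v hv hl using ih
    obtain ⟨u, hu, hu'⟩ := nprod_modelSeq_apply k N q.2 q.1 0 (F (leftWord k N l x)) _ v hv p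
    refine ⟨_, ?_, (hl p).consOp_add hu⟩
    change F (nprod k q.1 (Conf.gen k N q.2) (leftWord k N l x)) p _ = _
    rw [hF.map_nprod, hg, hu']
    rfl

variable (k N)

/-- The words `∂^s L … L x` with admissible exponents are linearly independent in `Conf(X, N)`. -/
theorem linearIndependent_confWord [CharZero k] : LinearIndependent k
    fun i : {p : ℕ × List (ℕ × X) × X // IsAdmissible N p.2.1 p.2.2} => confWord k N i.1 := by
  classical
  obtain ⟨F, hF, hg⟩ := Conf.exists_hom N (C := ConfSeq (Module.End k (ModelSpace k N)))
    (ConfSeq.der_nprod k) (ConfSeq.nprod_der k) (ConfSeq.assoc k) (fun a => modelSeq k N a 0)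
    (nprod_modelSeq_eq_zero k N)
  have hpow : ∀ s f, F (((der k) ^ s : Module.End k (Conf k N)) f) =
      ((der k) ^ s : Module.End k (ConfSeq (Module.End k (ModelSpace k N)))) (F f) := fun s f => by
    induction s with
    | zero => rfl
    | succ s ih => rw [pow_succ', Module.End.mul_apply, hF.map_der, ih, pow_succ',
        Module.End.mul_apply]
  have key : ∀ (i : ℕ × List (ℕ × X) × X) (p : ℕ), i.1 ≤ p → ∃ v,
      F (confWord k N i) p (Submodule.Quotient.mk (Finsupp.single [] 1)) =
        Submodule.Quotient.mk v ∧ LeadsAt k v (i.2.1 ++ [(p - i.1, i.2.2)]) := by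
    intro i p hi
    obtain ⟨v, hv, hl⟩ := leftWord_lead hF hg i.2.1 i.2.2 (p - i.1)
    obtain ⟨c, hc, hy⟩ := ConfSeq.pow_der_apply k (F (leftWord k N i.2.1 i.2.2)) i.1 p hi
    refine ⟨c • v, ?_, ?_, fun l' hl' => hl.2 l' fun h0 => hl' (by simp [h0])⟩
    · change F (((der k) ^ i.1 : Module.End k (Conf k N)) (leftWord k N i.2.1 i.2.2)) p _ = _
      rw [hpow, hy, LinearMap.smul_apply, hv, Submodule.Quotient.mk_smul]
    · simpa [hc] using hl.1
  rw [linearIndependent_iff']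
  intro s g hsum
  by_contra! hne
  obtain ⟨i₀, hi₀, hgi₀⟩ := hne
  -- A coefficient index not below any occurring power of `∂` keeps all scalars of
  -- `ConfSeq.pow_der_apply` nonzero; the last exponent `p - s` then records the power of `∂`.
  let p := s.sup fun i => i.1.1
  have hp : ∀ i ∈ s, i.1.1 ≤ p := fun i hi => Finset.le_sup (f := fun i => i.1.1) hi
  let lead := fun i : {p : ℕ × List (ℕ × X) × X // IsAdmissible N p.2.1 p.2.2} =>
    i.1.2.1 ++ [(p - i.1.1, i.1.2.2)]
  choose! v hv hl using fun (i : {p : ℕ × List (ℕ × X) × X // IsAdmissible N p.2.1 p.2.2})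
    (hi : i ∈ s) => key i.1 p (hp i hi)
  obtain ⟨i₁, hi₁, hmax⟩ := exists_max_of_isStrictTotalOrder (r := listLT) lead
    (s := s.filter fun i => g i ≠ 0) ⟨i₀, by simp [hi₀, hgi₀]⟩
  rw [Finset.mem_filter] at hi₁
  have hbad : ∑ i ∈ s, g i • v i ∈ badSpace k N := by
    rw [← Submodule.Quotient.mk_eq_zero, ← Submodule.mkQ_apply, map_sum]
    have h1 := congrArg (fun f => F f p (Submodule.Quotient.mk (Finsupp.single [] 1))) hsum
    have h2 : ∀ t : Finset {p : ℕ × List (ℕ × X) × X // IsAdmissible N p.2.1 p.2.2}, t ⊆ s →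
        F (∑ i ∈ t, g i • confWord k N i.1) p (Submodule.Quotient.mk (Finsupp.single [] 1)) =
          ∑ i ∈ t, (badSpace k N).mkQ (g i • v i) := by
      intro t
      induction t using Finset.induction_on with
      | empty => intro _; simp only [Finset.sum_empty, map_zero]; rfl
      | insert i t hit ih =>
        intro ht
        rw [Finset.sum_insert hit, Finset.sum_insert hit, map_add, ConfSeq.add_apply,
          LinearMap.add_apply, ih fun j hj => ht (Finset.mem_insert_of_mem hj), map_smul,
          ConfSeq.smul_apply, LinearMap.smul_apply, hv i (ht (Finset.mem_insert_self i t)),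
          map_smul, Submodule.mkQ_apply]
    rw [← h2 s subset_rfl]
    simp only [hsum, map_zero]
    rfl
  -- The largest principal list is admissible, whatever its last exponent, so it cannot occur in a
  -- vector of inadmissible lists.
  have h0 : (∑ i ∈ s, g i • v i) (lead i₁) = 0 := by
    by_contra h0
    exact (Finsupp.mem_supported k _).1 hbad (Finsupp.mem_support_iff.2 h0)
      (isChain_of_isAdmissible i₁.2 _)
  rw [Finsupp.finsetSum_apply, Finset.sum_eq_single i₁] at h0
  · rw [Finsupp.smul_apply, smul_eq_mul] at h0
    exact (mul_ne_zero hi₁.2 (hl i₁ hi₁.1).1) h0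
  · intro i hi hne
    by_cases hgi : g i = 0
    · simp [hgi]
    have h2 : lead i = lead i₁ ∨ listLT (lead i) (lead i₁) := hmax i (by simp [hi, hgi])
    rw [Finsupp.smul_apply, smul_eq_mul]
    by_contra h3
    -- `lead i₁` occurs in `v i` and so is at most `lead i`; maximality gives the reverse.
    have h4 : lead i = lead i₁ := by
      rcases (hl i hi).2 _ (right_ne_zero_of_mul h3) with h | h
      · exact h.symm
      · exact h2.resolve_right fun h' => asymm_of listLT h h'
    obtain ⟨h5, h6⟩ := List.append_inj' h4 rfl
    simp only [List.cons.injEq, Prod.mk.injEq, and_true] at h6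
    have h7 := hp i hi
    have h8 := hp i₁ hi₁.1
    exact hne (Subtype.ext (Prod.ext (by omega) (Prod.ext h5 h6.2)))
  · intro h
    exact absurd hi₁.1 h

end Model

/-! ## Values of the relations in `Conf(X, N)` -/

section Values

variable {k : Type u} {X : Type v} [Field k] {N : X → X → ℕ}

theorem opAction_wd_mul (u v : OpWord X) :
    opAction k N (wd k (u * v)) = opAction k N (wd k u) * opAction k N (wd k v) := by
  rw [wd_mul, map_mul]

theorem opAction_wd_of (p : Letter X) : opAction k N (wd k (.of p)) = opLetter k N p := by
  simp [opAction, wd]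

theorem toConf_atGen (p : OpAlg k X) (x : X) :
    toConf k N (atGen p x) = opAction k N p (Conf.gen k N x) := by
  simp [toConf, atGen]

theorem toConf_smul (p : OpAlg k X) (t : OpFree k X) :
    toConf k N (p • t) = opAction k N p (toConf k N t) := by
  induction t using Finsupp.induction_linear with
  | zero => simp
  | add f g hf hg => rw [smul_add, map_add, map_add, map_add, hf, hg]
  | single x q =>
    change toConf k N (p • atGen q x) = opAction k N p (toConf k N (atGen q x))
    rw [smul_atGen, toConf_atGen, toConf_atGen, map_mul, Module.End.mul_apply]

theorem opAction_dPow (s : ℕ) : opAction k N (wd k (dPow s)) = (der k) ^ s := by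
  induction s with
  | zero => rw [dPow, pow_zero, wd_one, map_one, pow_zero]
  | succ s ih =>
    rw [dPow, pow_succ', opAction_wd_mul, opAction_wd_of, pow_succ', ← dPow, ih]
    rfl

theorem lWord_cons (p : ℕ × X) (l : List (ℕ × X)) :
    lWord (p :: l) = .of (.L p.1 p.2) * lWord l := rfl

theorem opAction_lWord (l : List (ℕ × X)) (x : X) :
    opAction k N (wd k (lWord l)) (Conf.gen k N x) = leftWord k N l x := by
  induction l with
  | nil => change opAction k N 1 _ = _; rw [map_one]; rfl
  | cons p l ih =>
    rw [lWord_cons, opAction_wd_mul, opAction_wd_of, Module.End.mul_apply, ih]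
    rfl

theorem toConf_word (s : ℕ) (l : List (ℕ × X)) (x : X) :
    toConf k N (atGen (wd k (dPow s * lWord l)) x) = confWord k N (s, l, x) := by
  rw [toConf_atGen, opAction_wd_mul, Module.End.mul_apply, opAction_lWord, opAction_dPow]
  rfl

theorem nprod_gen_gen (a b : X) {n : ℕ} (hn : N a b ≤ n) :
    nprod k n (Conf.gen k N a) (Conf.gen k N b) = 0 :=
  Conf.mk_eq_zero_of_rel k N (ConfRel.locality a b n hn)

/-- (3) is `nprod_nprod_left` with vanishing inner product of `a` and `b`, solved for the term `q =
0`; (2) is the definition of `R_n^b`, cut off at the locality bound. -/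
theorem toConf_eq_zero_of_baseRel {t : OpFree k X} (ht : BaseRel k N t) : toConf k N t = 0 := by
  rcases ht with ⟨a, b, n, hn⟩ | ⟨a, b, n⟩ | ⟨a, b, n, m, hn, l, c⟩
  · rw [toConf_atGen, opAction_wd_of]
    exact nprod_gen_gen a b hn
  · rw [map_sub, map_sum, toConf_atGen, opAction_wd_of, sub_eq_zero]
    change curly k n (Conf.gen k N b) (Conf.gen k N a) = _
    rw [curly_eq_sum n (N a b - n) _ _ fun s hs => nprod_gen_gen a b (by omega)]
    refine Finset.sum_congr rfl fun s _ => ?_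
    rw [map_smul, toConf_atGen, opAction_wd_mul, opAction_dPow, opAction_wd_of,
      Module.End.mul_apply, mul_smul]
    rfl
  · have h1 : ∀ i j : ℕ, toConf k N (atGen (wd k (.of (.L i a) * .of (.L j b) * lWord l)) c) =
        nprod k i (Conf.gen k N a) (nprod k j (Conf.gen k N b) (leftWord k N l c)) := fun i j => by
      rw [toConf_atGen, opAction_wd_mul, opAction_wd_mul, Module.End.mul_apply, opAction_lWord,
        Module.End.mul_apply, opAction_wd_of, opAction_wd_of]
      rfl
    have h2 := nprod_nprod_left (k := k) n m (Conf.gen k N a) (Conf.gen k N b) (leftWord k N l c)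
    rw [nprod_gen_gen a b hn, map_zero, LinearMap.zero_apply, Finset.range_eq_Ico,
      Finset.sum_eq_sum_Ico_succ_bot (by omega)] at h2
    simp only [map_sub, map_sum, map_smul, h1]
    rw [sub_eq_zero]
    simp only [pow_zero, Nat.choose_zero_right, Nat.cast_one, mul_one, one_smul, Nat.sub_zero,
      add_zero, zero_add] at h2
    rw [eq_neg_of_add_eq_zero_left h2.symm, ← Finset.sum_neg_distrib]
    refine Finset.sum_congr rfl fun q _ => ?_
    rw [← neg_smul]
    congr 1
    ring

variable [CharZero k]

theorem opAction_eq_zero_of_algRel {f : OpAlg k X} (hf : AlgRel k f) : opAction k N f = 0 := by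
  refine LinearMap.ext fun y => ?_
  rcases hf with ⟨n, a⟩ | ⟨n, a⟩ | ⟨m, b, n, a⟩ <;>
    simp only [map_sub, map_smul, opAction_wd_mul, opAction_wd_of, LinearMap.sub_apply,
      LinearMap.smul_apply, Module.End.mul_apply, opLetter, LinearMap.zero_apply]
  · rw [Conf.nprod_der]
    abel
  · rw [curly_der]
    abel
  · rw [curly_nprod, sub_self]

end Values

/-! ## Principal words of the relations -/

section Leads

set_option linter.unusedSectionVars false

variable {k : Type u} {X : Type v} [Field k] [LinearOrder X]

theorem HasLead.basis_sub {V W : Type*} [AddCommGroup V] [Module k V] {b : Module.Basis W k V}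
    {r : W → W → Prop} [IsWellOrder W r] {w : W} {v : V} (hv : v ∈ belowWord b r w) :
    b.repr (b w - v) w = 1 ∧ HasLead b r (b w - v) w := by
  classical
  have h0 : b.repr v w = 0 := by
    by_contra h0
    exact irrefl w (_root_.mem_belowWord.1 hv w h0)
  have h1 : b.repr (b w - v) w = 1 := by simp [h0]
  refine ⟨h1, by rw [h1]; exact one_ne_zero, fun w' hw' => ?_⟩
  by_cases hw : b.repr v w' = 0
  · refine Or.inl ?_
    by_contra hne
    simp [hw, Ne.symm hne] at hw'
  · exact Or.inr (_root_.mem_belowWord.1 hv w' hw)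

variable [WellFoundedLT X]

theorem atGen_wd_mem_belowWord {w : OpWord X × X} {u : OpWord X} {x : X}
    (h : modWordLT (u, x) w) : atGen (wd k u) x ∈ belowWord (opBasis k X) modWordLT w := by
  classical
  rw [← opBasis_apply, mem_belowWord]
  intro w' hw'
  rw [Module.Basis.repr_self, Finsupp.single_apply] at hw'
  split_ifs at hw' with e
  · exact e ▸ h
  · exact absurd rfl hw'

theorem IsLeadMod.wd_sub {u : OpWord X} {x : X} {v : OpFree k X}
    (hv : v ∈ belowWord (opBasis k X) modWordLT (u, x)) :
    IsLeadMod (atGen (wd k u) x - v) u x := by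
  rw [← hasLead_iff, ← opBasis_apply]
  exact (HasLead.basis_sub hv).2

theorem IsLeadMod.unique {t : OpFree k X} {u v : OpWord X} {x y : X} (h : IsLeadMod t u x)
    (h' : IsLeadMod t v y) : u = v ∧ x = y :=
  Prod.mk.inj (HasLead.unique (hasLead_iff.2 h) (hasLead_iff.2 h'))

theorem IsLeadAlg.unique {f : OpAlg k X} {u v : OpWord X} (h : IsLeadAlg f u)
    (h' : IsLeadAlg f v) : u = v := by
  rcases h.2 _ h'.1 with e | e
  · exact e.symm
  · rcases h'.2 _ h.1 with e' | e'
    · exact e'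
    · exact absurd e (asymm e')

/-- The generator `x` is auxiliary: it transfers the question to the copy of the algebra at `x`,
where the statements about module bases apply. -/
theorem isLeadAlg_binomial {u v v' : OpWord X} (c : k) (h : wordLT v u) (h' : wordLT v' u)
    (x : X) : IsLeadAlg (wd k u - wd k v - c • wd k v') u ∧
      (wd k u - wd k v - c • wd k v').coeff u = 1 := by
  have hb : atGen (wd k v + c • wd k v') x ∈ belowWord (opBasis k X) modWordLT (u, x) := by
    rw [atGen_add, ← smul_atGen']
    exact add_mem (atGen_wd_mem_belowWord (Or.inl h))
      (Submodule.smul_mem _ _ (atGen_wd_mem_belowWord (Or.inl h')))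
  obtain ⟨h1, h2⟩ := HasLead.basis_sub hb
  rw [opBasis_repr, opBasis_apply, ← atGen_sub, atGen_apply_self, ← sub_sub] at h1
  rw [opBasis_apply, ← atGen_sub, hasLead_iff, ← sub_sub] at h2
  refine ⟨⟨by rw [h1]; exact one_ne_zero, fun w hw => ?_⟩, h1⟩
  rcases h2.2 w x (by rwa [atGen_apply_self]) with e | e
  · exact Or.inl e.1
  · exact Or.inr (e.resolve_right fun h => lt_irrefl _ h.2)

/-- The pairs of letters that are principal words of the relations of `A(X)`. -/
def IsRelPair : Letter X → Letter X → Prop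
  | .L _ _, .d => True
  | .R _ _, .d => True
  | .R _ _, .L _ _ => True
  | _, _ => False

/-- The relation of `A(X)` with a given principal word. -/
def algRelOf (k : Type u) [Field k] : Letter X → Letter X → OpAlg k X
  | .L n a, .d => wd k (.of (.L n a) * .of .d) - wd k (.of .d * .of (.L n a))
        - (n : k) • wd k (.of (.L (n - 1) a))
  | .R n a, .d => wd k (.of (.R n a) * .of .d) - wd k (.of .d * .of (.R n a))
        - (n : k) • wd k (.of (.R (n - 1) a))
  | .R m b, .L n a => wd k (.of (.R m b) * .of (.L n a)) - wd k (.of (.L n a) * .of (.R m b))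
  | _, _ => 0

theorem algRel_iff {f : OpAlg k X} : AlgRel k f ↔ ∃ p q, IsRelPair p q ∧ f = algRelOf k p q := by
  constructor
  · rintro (⟨n, a⟩ | ⟨n, a⟩ | ⟨m, b, n, a⟩)
    · exact ⟨.L n a, .d, trivial, rfl⟩
    · exact ⟨.R n a, .d, trivial, rfl⟩
    · exact ⟨.R m b, .L n a, trivial, rfl⟩
  · rintro ⟨p, q, h, rfl⟩
    rcases p with _ | ⟨n, a⟩ | ⟨n, a⟩ <;> rcases q with _ | ⟨m, b⟩ | ⟨m, b⟩ <;>
      first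
        | exact h.elim
        | exact AlgRel.L_d n a
        | exact AlgRel.R_d n a
        | exact AlgRel.R_L n a m b

theorem isLeadAlg_algRelOf {p q : Letter X} (h : IsRelPair p q) :
    IsLeadAlg (algRelOf k p q) (.of p * .of q) ∧
      (algRelOf k p q).coeff (.of p * .of q) = 1 := by
  rcases p with _ | ⟨n, a⟩ | ⟨n, a⟩ <;> rcases q with _ | ⟨m, b⟩ | ⟨m, b⟩
  all_goals try exact h.elim
  · exact isLeadAlg_binomial _ (Or.inr ⟨rfl, Or.inr ⟨rfl, List.Lex.rel trivial⟩⟩)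
      (Or.inr ⟨rfl, Or.inl Nat.one_lt_two⟩) a
  · exact isLeadAlg_binomial _ (Or.inr ⟨rfl, Or.inr ⟨rfl, List.Lex.rel trivial⟩⟩)
      (Or.inr ⟨rfl, Or.inl Nat.one_lt_two⟩) a
  -- This relation has only two terms; it is the three-term form with coefficient `0` and the lower
  -- word repeated.
  · have h1 : wordLT (.of (.L m b) * .of (.R n a) : OpWord X) (.of (.R n a) * .of (.L m b)) :=
      Or.inr ⟨rfl, Or.inr ⟨rfl, List.Lex.rel trivial⟩⟩
    have := isLeadAlg_binomial (k := k) 0 h1 h1 a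
    rwa [zero_smul, sub_zero] at this

theorem AlgRel.exists_lead {f : OpAlg k X} (hf : AlgRel k f) {u : OpWord X} (hu : IsLeadAlg f u) :
    ∃ p q, IsRelPair p q ∧ f = algRelOf k p q ∧ u = .of p * .of q ∧ f.coeff u = 1 := by
  obtain ⟨p, q, h, rfl⟩ := algRel_iff.1 hf
  have := isLeadAlg_algRelOf (k := k) h
  obtain rfl := hu.unique this.1
  exact ⟨p, q, h, rfl, rfl, this.2⟩

variable {N : X → X → ℕ}

theorem isLeadMod_locality (a b : X) (n : ℕ) :
    IsLeadMod (atGen (wd k (.of (.L n a))) b) (.of (.L n a)) b := by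
  simpa using IsLeadMod.wd_sub (k := k) (u := .of (.L n a)) (x := b) (Submodule.zero_mem _)

theorem degR_dPow (s : ℕ) : degR (dPow s : OpWord X) = 0 := by
  induction s with
  | zero => rfl
  | succ s ih => rw [dPow, pow_succ, degR_mul, ← dPow, ih]; rfl

/-- The right side is free of letters `R` but may be longer; comparing the degree in `R` first is
what makes `R_n^b a` principal. -/
theorem isLeadMod_rightMul (a b : X) (n M : ℕ) (c : ℕ → k) :
    IsLeadMod (atGen (wd k (.of (.R n b))) a - ∑ s ∈ Finset.range M,
      c s • atGen (wd k (dPow s * .of (.L (n + s) a))) b) (.of (.R n b)) a := by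
  refine IsLeadMod.wd_sub (Submodule.sum_mem _ fun s _ => Submodule.smul_mem _ _
    (atGen_wd_mem_belowWord (Or.inl (Or.inl ?_))))
  rw [degR_mul, degR_dPow]
  exact Nat.zero_lt_one

theorem isLeadMod_localityExt (a b : X) (n m : ℕ) (l : List (ℕ × X)) (x : X) (c : ℕ → k) :
    IsLeadMod (atGen (wd k (.of (.L n a) * .of (.L m b) * lWord l)) x -
      ∑ q ∈ Finset.Icc 1 n, c q •
        atGen (wd k (.of (.L (n - q) a) * .of (.L (m + q) b) * lWord l)) x)
      (.of (.L n a) * .of (.L m b) * lWord l) x := by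
  refine IsLeadMod.wd_sub (Submodule.sum_mem _ fun q hq => Submodule.smul_mem _ _
    (atGen_wd_mem_belowWord (Or.inl (wordLT.mul_right ?_ _))))
  have hq := Finset.mem_Icc.1 hq
  exact Or.inr ⟨rfl, Or.inr ⟨rfl, List.Lex.rel (Or.inl (by omega))⟩⟩

/-! ## Compositions of the relations of the algebra -/

theorem trivialAlg_of_eq {p q : Letter X} {h : OpAlg k X} {w : OpWord X} (hp : IsRelPair p q)
    (a b : OpWord X) (hw : wordLT (a * (.of p * .of q) * b) w)
    (e : h = wd k a * algRelOf k p q * wd k b) : TrivialAlg {f : OpAlg k X | AlgRel k f} w h :=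
  Submodule.subset_span ⟨_, algRel_iff.2 ⟨p, q, hp, rfl⟩, _, (isLeadAlg_algRelOf hp).1, a, b, hw, e⟩

theorem wordLT_R_L_d (i j m n : ℕ) (a b : X) :
    wordLT (1 * (.of (.R i b) * .of (.L j a)) * 1 : OpWord X)
      (.of (.R m b) * .of (.L n a) * .of .d) := by
  rw [one_mul, mul_one]
  exact Or.inr ⟨rfl, Or.inl (Nat.lt_succ_self 2)⟩

/-- The one overlap of three letters. Moving `∂` to the left and `R` to the right in the two
possible orders gives the same result, and `key` records the relations used; each has a principal
word below `R L ∂`. -/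
theorem trivialAlg_R_L_d (m : ℕ) (b : X) (n : ℕ) (a : X) :
    TrivialAlg {f : OpAlg k X | AlgRel k f} (.of (.R m b) * .of (.L n a) * .of .d)
      (algRelOf k (.R m b) (.L n a) * wd k (.of .d) -
        wd k (.of (.R m b)) * algRelOf k (.L n a) .d) := by
  have key : algRelOf k (.R m b) (.L n a) * wd k (.of .d) -
        wd k (.of (.R m b)) * algRelOf k (.L n a) .d =
      -(wd k (.of (.L n a)) * algRelOf k (.R m b) .d * wd k 1) +
      wd k 1 * algRelOf k (.R m b) .d * wd k (.of (.L n a)) -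
      wd k 1 * algRelOf k (.L n a) .d * wd k (.of (.R m b)) +
      wd k (.of .d) * algRelOf k (.R m b) (.L n a) * wd k 1 +
      (m : k) • (wd k 1 * algRelOf k (.R (m - 1) b) (.L n a) * wd k 1) +
      (n : k) • (wd k 1 * algRelOf k (.R m b) (.L (n - 1) a) * wd k 1) := by
    simp only [algRelOf, wd_one, wd_mul, one_mul, mul_one, mul_sub, sub_mul, smul_sub,
      mul_smul_comm, smul_mul_assoc, mul_assoc]
    abel
  rw [key]
  refine add_mem (add_mem (add_mem (sub_mem (add_mem (neg_mem ?_) ?_) ?_) ?_)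
    (Submodule.smul_mem _ _ ?_)) (Submodule.smul_mem _ _ ?_)
  · exact trivialAlg_of_eq (p := .R m b) (q := .d) trivial (.of (.L n a)) 1
      (Or.inr ⟨rfl, Or.inr ⟨rfl, List.Lex.rel trivial⟩⟩) rfl
  · exact trivialAlg_of_eq (p := .R m b) (q := .d) trivial 1 (.of (.L n a))
      (Or.inr ⟨rfl, Or.inr ⟨rfl, List.Lex.cons (List.Lex.rel trivial)⟩⟩) rfl
  · exact trivialAlg_of_eq (p := .L n a) (q := .d) trivial 1 (.of (.R m b))
      (Or.inr ⟨rfl, Or.inr ⟨rfl, List.Lex.rel trivial⟩⟩) rfl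
  · exact trivialAlg_of_eq (p := .R m b) (q := .L n a) trivial (.of .d) 1
      (Or.inr ⟨rfl, Or.inr ⟨rfl, List.Lex.rel trivial⟩⟩) rfl
  · exact trivialAlg_of_eq (p := .R (m - 1) b) (q := .L n a) trivial 1 1
      (wordLT_R_L_d _ _ _ _ _ _) rfl
  · exact trivialAlg_of_eq (p := .R m b) (q := .L (n - 1) a) trivial 1 1
      (wordLT_R_L_d _ _ _ _ _ _) rfl

theorem algRel_incl_trivial (f : OpAlg k X) (hf : AlgRel k f) (g : OpAlg k X) (hg : AlgRel k g)
    (u v a b : OpWord X) (hu : IsLeadAlg f u) (hv : IsLeadAlg g v) (h : u = a * v * b) :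
    TrivialAlg {f : OpAlg k X | AlgRel k f} u
      ((f.coeff u)⁻¹ • f - (g.coeff v)⁻¹ • (wd k a * g * wd k b)) := by
  obtain ⟨p, q, -, rfl, rfl, h1⟩ := hf.exists_lead hu
  obtain ⟨p', q', -, rfl, rfl, h2⟩ := hg.exists_lead hv
  have hl := congrArg FreeMonoid.length h
  simp only [FreeMonoid.length_mul, FreeMonoid.length_of] at hl
  obtain rfl := FreeMonoid.length_eq_zero.1 (show a.length = 0 by omega)
  obtain rfl := FreeMonoid.length_eq_zero.1 (show b.length = 0 by omega)
  rw [one_mul, mul_one] at h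
  have h' : [p, q] = [p', q'] := h
  simp only [List.cons.injEq, and_true] at h'
  obtain ⟨rfl, rfl⟩ := h'
  rw [wd_one, one_mul, mul_one, sub_self]
  exact Submodule.zero_mem _

/-- Principal words have length two, so the overlap is total or in one letter. The pair of letters
determines the relation, and two relation pairs chain only as `R, L, ∂`. -/
theorem algRel_inter_trivial (f : OpAlg k X) (hf : AlgRel k f) (g : OpAlg k X) (hg : AlgRel k g)
    (u v a b : OpWord X) (hu : IsLeadAlg f u) (hv : IsLeadAlg g v) (h : u * b = a * v)
    (hlen : a.length < u.length) :
    TrivialAlg {f : OpAlg k X | AlgRel k f} (u * b)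
      ((f.coeff u)⁻¹ • (f * wd k b) - (g.coeff v)⁻¹ • (wd k a * g)) := by
  obtain ⟨p, q, hpq, rfl, rfl, h1⟩ := hf.exists_lead hu
  obtain ⟨p', q', hpq', rfl, rfl, h2⟩ := hg.exists_lead hv
  have hl := congrArg FreeMonoid.length h
  simp only [FreeMonoid.length_mul, FreeMonoid.length_of] at hl hlen
  rcases Nat.eq_zero_or_pos a.length with ha | ha
  · obtain rfl := FreeMonoid.length_eq_zero.1 ha
    obtain rfl := FreeMonoid.length_eq_zero.1 (show b.length = 0 by omega)
    have h' : [p, q] = [p', q'] := by rw [one_mul, mul_one] at h; exact h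
    simp only [List.cons.injEq, and_true] at h'
    obtain ⟨rfl, rfl⟩ := h'
    rw [wd_one, one_mul, mul_one, mul_one, sub_self]
    exact Submodule.zero_mem _
  · obtain ⟨c, rfl⟩ := FreeMonoid.length_eq_one.1 (show a.length = 1 by omega)
    obtain ⟨e, rfl⟩ := FreeMonoid.length_eq_one.1 (show b.length = 1 by omega)
    have h' : [p, q, e] = [c, p', q'] := h
    simp only [List.cons.injEq, and_true] at h'
    obtain ⟨rfl, rfl, rfl⟩ := h'
    rw [h1, h2, inv_one, one_smul, one_smul]
    rcases p with _ | ⟨m, b⟩ | ⟨m, b⟩ <;> rcases q with _ | ⟨n, a⟩ | ⟨n, a⟩ <;>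
      rcases e with _ | ⟨i, c⟩ | ⟨i, c⟩
    all_goals first
      | exact hpq.elim
      | exact hpq'.elim
      | exact trivialAlg_R_L_d m b n a

end Leads

/-! ## Reduced words -/

section Reduced

variable {X : Type v} {N : X → X → ℕ}

theorem dPow_succ (s : ℕ) : (dPow (s + 1) : OpWord X) = .of .d * dPow s := pow_succ' _ _

theorem isAdmissible_of_append {l l' : List (ℕ × X)} {x : X} (h : IsAdmissible N (l ++ l') x) :
    IsAdmissible N l' x := by
  induction l with
  | nil => exact h
  | cons p l ih =>
    rcases hl : l ++ l' with _ | ⟨q, l''⟩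
    · rw [(List.append_eq_nil_iff.1 hl).2]
      trivial
    · rw [List.cons_append, hl] at h
      exact ih (hl ▸ h.2)

theorem toList_dPow_mul_lWord (s : ℕ) (l : List (ℕ × X)) :
    (dPow s * lWord l : OpWord X).toList =
      List.replicate s Letter.d ++ l.map fun p => Letter.L p.1 p.2 := by
  induction s with
  | zero => rfl
  | succ s ih =>
    rw [dPow_succ, mul_assoc, FreeMonoid.toList_mul, ih, List.replicate_succ, List.cons_append]
    rfl

/-- The index and the generator of a letter `L_n^a`. -/
def Letter.leftPart : Letter X → Option (ℕ × X)
  | .L n a => some (n, a)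
  | _ => none

theorem filterMap_leftPart (s : ℕ) (l : List (ℕ × X)) :
    (dPow s * lWord l : OpWord X).toList.filterMap Letter.leftPart = l := by
  rw [toList_dPow_mul_lWord, List.filterMap_append, List.filterMap_map,
    List.filterMap_eq_nil_iff.2 fun p hp => by rw [List.eq_of_mem_replicate hp]; rfl,
    List.nil_append]
  exact List.filterMap_some

theorem isAdmissible_of_mul_lWord {s : ℕ} {l l' : List (ℕ × X)} {x : X} {a : OpWord X}
    (hl : IsAdmissible N l x) (h : dPow s * lWord l = a * lWord l') : IsAdmissible N l' x := by
  have h1 := congrArg (fun u : OpWord X => u.toList.filterMap Letter.leftPart) h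
  have h2 := filterMap_leftPart 0 l'
  simp only [dPow, pow_zero, one_mul] at h2
  rw [filterMap_leftPart, FreeMonoid.toList_mul, List.filterMap_append, h2] at h1
  rw [h1] at hl
  exact isAdmissible_of_append hl

theorem isChain_not_isRelPair (s : ℕ) (l : List (ℕ × X)) :
    List.IsChain (fun p q => ¬ IsRelPair p q) (dPow s * lWord l : OpWord X).toList := by
  induction s with
  | zero =>
    induction l with
    | nil => exact List.isChain_nil
    | cons p l ih =>
      rcases l with _ | ⟨q, l⟩
      · exact List.isChain_singleton _
      · exact List.isChain_cons_cons.2 ⟨id, ih⟩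
  | succ s ih =>
    rw [dPow_succ, mul_assoc, FreeMonoid.toList_mul, FreeMonoid.toList_of, List.singleton_append,
      List.isChain_cons]
    exact ⟨fun q _ => by rcases q with _ | _ | _ <;> exact id, ih⟩

theorem not_isR_of_mem {s : ℕ} {l : List (ℕ × X)} {p : Letter X}
    (hp : p ∈ (dPow s * lWord l : OpWord X).toList) : p.isR = false := by
  rw [toList_dPow_mul_lWord, List.mem_append] at hp
  rcases hp with hp | hp
  · rw [List.eq_of_mem_replicate hp]; rfl
  · obtain ⟨q, -, rfl⟩ := List.mem_map.1 hp; rfl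

theorem dPow_mul_lWord_injective {s s' : ℕ} {l l' : List (ℕ × X)}
    (h : (dPow s * lWord l : OpWord X) = dPow s' * lWord l') : s = s' ∧ l = l' := by
  have h1 : l = l' := by
    rw [← filterMap_leftPart s l, h, filterMap_leftPart]
  subst h1
  have h2 := congrArg FreeMonoid.length h
  simp only [FreeMonoid.length, toList_dPow_mul_lWord, List.length_append,
    List.length_replicate] at h2
  exact ⟨by omega, rfl⟩

variable {k : Type u} [Field k] [LinearOrder X] [WellFoundedLT X] {T : Set (OpFree k X)}

/-- A word that contains no principal word of the relations is admissible. -/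
theorem exists_of_not_genRel (u : OpWord X) (x : X)
    (h : ¬ ∃ g, GenRel {f : OpAlg k X | AlgRel k f} (T ∪ {t : OpFree k X | BaseRel k N t}) g
      (u, x)) : ∃ s l, u = dPow s * lWord l ∧ IsAdmissible N l x := by
  induction u using FreeMonoid.inductionOn' with
  | one => exact ⟨0, [], rfl, trivial⟩
  | of_mul c u ih =>
    obtain ⟨s, l, rfl, hl⟩ := ih fun ⟨g, hg⟩ => h ⟨_, hg.smul (.of c)⟩
    -- The new first letter must not form a principal word of (A) with the next one.
    have hpair : ∀ (q : Letter X) (v : OpWord X), IsRelPair c q → dPow s * lWord l ≠ .of q * v := by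
      intro q v hq hv
      have := GenRel.of_alg (E := {f : OpAlg k X | AlgRel k f})
        (T := T ∪ {t : OpFree k X | BaseRel k N t})
        (algRel_iff.2 ⟨c, q, hq, rfl⟩) (isLeadAlg_algRelOf hq).1 1 v x
      rw [one_mul (FreeMonoid.of c * FreeMonoid.of q), mul_assoc (FreeMonoid.of c), ← hv] at this
      exact h ⟨_, this⟩
    have hmod : ∀ (t : OpFree k X), BaseRel k N t →
        ¬ IsLeadMod t (.of c * (dPow s * lWord l)) x := by
      intro t ht hlead
      have := GenRel.of_mod (E := {f : OpAlg k X | AlgRel k f})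
        (T := T ∪ {t : OpFree k X | BaseRel k N t}) (Set.mem_union_right _ ht) hlead 1
      rw [one_mul] at this
      exact h ⟨_, this⟩
    -- `∂` can always be prepended. `L_n^a` cannot stand before `∂`, and (1) or (3) bounds `n`.
    -- `R_n^a` is excluded by (A) before `∂` or `L`, and by (2) directly before `x`.
    rcases c with _ | ⟨n, a⟩ | ⟨n, a⟩
    · exact ⟨s + 1, l, by rw [dPow_succ, mul_assoc], hl⟩
    · rcases s with _ | s
      · refine ⟨0, (n, a) :: l, rfl, ?_⟩
        rcases l with _ | ⟨⟨m, b⟩, l⟩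
        · by_contra hn
          exact hmod _ (BaseRel.locality a x n (not_lt.1 hn)) (isLeadMod_locality a x n)
        · refine ⟨?_, hl⟩
          by_contra hn
          exact hmod _ (BaseRel.localityExt a b n m (not_lt.1 hn) l x)
            (isLeadMod_localityExt a b n m l x _)
      · exact absurd (by rw [dPow_succ, mul_assoc]) (hpair .d (dPow s * lWord l) trivial)
    · rcases s with _ | s
      · rcases l with _ | ⟨⟨m, b⟩, l⟩
        · exact absurd (isLeadMod_rightMul x a n _ _) (hmod _ (BaseRel.rightMul x a n))
        · exact absurd rfl (hpair (.L m b) (lWord l) trivial)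
      · exact absurd (by rw [dPow_succ, mul_assoc]) (hpair .d (dPow s * lWord l) trivial)

/-- Conversely, such a word has no pair of letters from (A) and no letter `R`, and admissibility
passes to suffixes, so (1)–(3) do not apply; `T` is excluded by reducedness. -/
theorem not_genRel_iff (u : OpWord X) (x : X) :
    (¬ ∃ g, GenRel {f : OpAlg k X | AlgRel k f} (T ∪ {t : OpFree k X | BaseRel k N t}) g (u, x)) ↔
      ∃ s l, u = dPow s * lWord l ∧ IsAdmissible N l x ∧ IsReducedWord T u x := by
  constructor
  · intro h
    obtain ⟨s, l, hu, hl⟩ := exists_of_not_genRel u x h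
    refine ⟨s, l, hu, hl, ?_⟩
    rintro ⟨t, ht, v, hv, a, rfl⟩
    exact h ⟨_, GenRel.of_mod (Set.mem_union_left _ ht) hv a⟩
  · rintro ⟨s, l, rfl, hl, hT⟩ ⟨g, ⟨f, hf, u, hu, a, b, y, hw, -⟩ |
      ⟨t, ht | ht, v, y, hv, a, hw, -⟩⟩
    · obtain ⟨p, q, hpq, -, rfl, -⟩ := AlgRel.exists_lead hf hu
      have h1 := isChain_not_isRelPair s l
      rw [(Prod.mk.inj hw).1, mul_assoc, mul_assoc] at h1
      exact (List.isChain_cons_cons.1 (List.isChain_append.1 h1).2.1).1 hpq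
    · obtain ⟨hw', rfl⟩ := Prod.mk.inj hw
      exact hT ⟨t, ht, v, hv, a, hw'⟩
    · obtain ⟨hw', rfl⟩ := Prod.mk.inj hw
      rcases ht with ⟨a', b, n, hn⟩ | ⟨a', b, n⟩ | ⟨a', b, n, m, hn, l', c⟩
      · obtain ⟨rfl, rfl⟩ := hv.unique (isLeadMod_locality a' b n)
        have : n < N a' x := isAdmissible_of_mul_lWord (l' := [(n, a')]) hl hw'
        omega
      · obtain ⟨rfl, rfl⟩ := hv.unique (isLeadMod_rightMul a' b n _ _)
        have h1 : Letter.R n b ∈ (dPow s * lWord l : OpWord X).toList := by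
          rw [hw', FreeMonoid.toList_mul]
          exact List.mem_append_right _ (List.mem_singleton.2 rfl)
        exact Bool.noConfusion (not_isR_of_mem h1)
      · obtain ⟨rfl, rfl⟩ := hv.unique (isLeadMod_localityExt a' b n m l' c _)
        have := (isAdmissible_of_mul_lWord (l' := (n, a') :: (m, b) :: l') hl hw').1
        omega

end Reduced

/-! ## The module of relations and the kernel of the evaluation -/

section Kernel

variable {k : Type u} {X : Type v} [Field k] [LinearOrder X]
  {N : X → X → ℕ} {T : Set (OpFree k X)} {S : Set (Conf k N)}

/-- The reduced words as elements of the free module. -/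
def reducedWord (N : X → X → ℕ) (T : Set (OpFree k X)) (p : ReducedIndex N T) : OpFree k X :=
  opBasis k X (dPow p.1.1 * lWord p.1.2.1, p.1.2.2)

theorem toConf_reducedWord (p : ReducedIndex N T) :
    toConf k N (reducedWord N T p) = confWord k N p.1 := by
  rw [reducedWord, opBasis_apply, toConf_word]

/-- The elements of the module of relations. -/
abbrev ConfGenRel (k : Type u) {X : Type v} [Field k] [LinearOrder X] (N : X → X → ℕ)
    (T : Set (OpFree k X)) : OpFree k X → OpWord X × X → Prop :=
  GenRel {f : OpAlg k X | AlgRel k f} (T ∪ {t : OpFree k X | BaseRel k N t})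

variable (S) in
/-- The evaluation in `Conf(X, N | S)`. -/
def toConfMod : OpFree k X →ₗ[k] ConfMod k N S :=
  (conformalIdealSpan k S).mkQ ∘ₗ toConf k N

theorem reducedFamily_eq : reducedFamily N T S = toConfMod S ∘ reducedWord N T :=
  funext fun p => congrArg Submodule.Quotient.mk (toConf_reducedWord p).symm

theorem smul_mem_totalSpan {h : OpFree k X} (hh : h ∈ totalSpan k (ConfGenRel k N T))
    (c : OpWord X) : wd k c • h ∈ totalSpan k (ConfGenRel k N T) := by
  induction hh using Submodule.span_induction with
  | mem g hg =>
    obtain ⟨⟨u, x⟩, hg⟩ := hg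
    exact Submodule.subset_span ⟨_, hg.smul c⟩
  | zero => simp
  | add p q _ _ hp hq => rw [smul_add]; exact add_mem hp hq
  | smul c p _ hp => rw [smul_comm]; exact Submodule.smul_mem _ _ hp

theorem linearIndependent_reducedWord : LinearIndependent k (reducedWord N T) := by
  refine (opBasis k X).linearIndependent.comp
    (fun p : ReducedIndex N T => (dPow p.1.1 * lWord p.1.2.1, p.1.2.2)) fun p q h => ?_
  obtain ⟨h1, h2⟩ := Prod.mk.inj h
  obtain ⟨h3, h4⟩ := dPow_mul_lWord_injective h1
  exact Subtype.ext (Prod.ext h3 (Prod.ext h4 h2))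

section

variable [WellFoundedLT X]

theorem span_reducedWord : Submodule.span k (Set.range (reducedWord N T)) =
    reducedSpan (opBasis k X) (ConfGenRel k N T) := by
  refine le_antisymm (Submodule.span_le.2 ?_) fun v hv => ?_
  · rintro _ ⟨p, rfl⟩
    exact basis_mem_reducedSpan ((not_genRel_iff _ _).2 ⟨_, _, rfl, p.2.1, p.2.2⟩)
  · refine mem_of_forall_basis_mem (b := opBasis k X) fun ⟨u, x⟩ hw => ?_
    obtain ⟨s, l, rfl, hl, hT⟩ := (not_genRel_iff u x).1 (mem_reducedSpan.1 hv _ hw)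
    exact Submodule.subset_span ⟨⟨(s, l, x), hl, hT⟩, rfl⟩

theorem mem_totalSpan_of_mem {t : OpFree k X} (ht : t ∈ T) :
    t ∈ totalSpan k (ConfGenRel k N T) := by
  -- A zero element has no principal word and does not belong to the family by itself.
  by_cases h0 : t = 0
  · rw [h0]; exact zero_mem _
  · obtain ⟨⟨u, x⟩, hu⟩ := exists_hasLead (b := opBasis k X) (r := modWordLT) h0
    refine Submodule.subset_span ⟨(1 * u, x), ?_⟩
    have := GenRel.of_mod (E := {f : OpAlg k X | AlgRel k f})
      (T := T ∪ {t : OpFree k X | BaseRel k N t}) (Set.mem_union_left _ ht) (hasLead_iff.1 hu) 1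
    rwa [wd_one, one_smul] at this

end

variable [CharZero k]

theorem totalSpan_le_ker (hT : toConf k N '' T = S) :
    totalSpan k (ConfGenRel k N T) ≤ LinearMap.ker (toConfMod S) := by
  refine Submodule.span_le.2 ?_
  rintro g ⟨w, ⟨f, hf, u, hu, a, b, x, -, rfl⟩ | ⟨t, ht, u, x, hu, a, -, rfl⟩⟩ <;>
    rw [SetLike.mem_coe, LinearMap.mem_ker, toConfMod, LinearMap.comp_apply]
  · rw [toConf_atGen, map_mul, map_mul, opAction_eq_zero_of_algRel hf, mul_zero, zero_mul,
      LinearMap.zero_apply, map_zero]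
  · rw [toConf_smul]
    rcases ht with ht | ht
    · have h1 : toConf k N t ∈ conformalIdealSpan k S :=
        subset_conformalIdealSpan _ (hT ▸ ⟨t, ht, rfl⟩)
      rw [Submodule.mkQ_apply, Submodule.Quotient.mk_eq_zero]
      clear hu
      induction a using FreeMonoid.inductionOn' generalizing t with
      | one => rwa [wd_one, map_one]
      | of_mul c a ih =>
        rw [opAction_wd_mul, Module.End.mul_apply, opAction_wd_of]
        have h2 := ih t ht h1
        have hI := conformalIdealSpan_isIdeal (k := k) S
        rcases c with _ | ⟨n, c⟩ | ⟨n, c⟩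
        · exact hI.der_mem _ h2
        · exact hI.left_mem n _ _ h2
        -- `R_n` of an element of the ideal is a finite sum of derivatives of right products by a
        -- generator.
        · change curly k n _ _ ∈ _
          generalize opAction k N (wd k a) (toConf k N t) = y at h2
          obtain ⟨M, hM⟩ := AssocConformalAlgebra.locality (k := k) y (Conf.gen k N c)
          rw [curly_eq_sum n M _ _ fun s hs => hM _ (by omega)]
          refine Submodule.sum_mem _ fun s hs => Submodule.smul_mem _ _ (Submodule.smul_mem _ _ ?_)
          have h3 := hI.right_mem (n + s) (Conf.gen k N c) y h2
          generalize nprod k (n + s) y (Conf.gen k N c) = z at h3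
          clear hs
          induction s with
          | zero => exact h3
          | succ s ih => rw [pow_succ', Module.End.mul_apply]; exact hI.der_mem _ ih
    · rw [toConf_eq_zero_of_baseRel ht, map_zero, map_zero]

theorem totalSpan_empty_le_ker :
    totalSpan k (ConfGenRel k N (∅ : Set (OpFree k X))) ≤ LinearMap.ker (toConf k N) := by
  refine Submodule.span_le.2 ?_
  rintro g ⟨w, ⟨f, hf, u, hu, a, b, x, -, rfl⟩ | ⟨t, ht, u, x, hu, a, -, rfl⟩⟩ <;>
    rw [SetLike.mem_coe, LinearMap.mem_ker]
  · rw [toConf_atGen, map_mul, map_mul, opAction_eq_zero_of_algRel hf, mul_zero, zero_mul,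
      LinearMap.zero_apply]
  · rw [toConf_smul, toConf_eq_zero_of_baseRel (ht.resolve_left id), map_zero]

variable [WellFoundedLT X]

/-- `Conf(X, N)` is the module defined by the relations (A), (1), (2), (3). -/
theorem ker_toConf_le : LinearMap.ker (toConf k N) ≤
    totalSpan k (ConfGenRel k N (∅ : Set (OpFree k X))) := by
  intro h hh
  have h1 : h ∈ reducedSpan (opBasis k X) (ConfGenRel k N (∅ : Set (OpFree k X))) ⊔
      totalSpan k (ConfGenRel k N (∅ : Set (OpFree k X))) := by
    rw [reducedSpan_sup_totalSpan (r := modWordLT) fun _ _ h => h.hasLead]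
    trivial
  obtain ⟨p, hp, t, ht, rfl⟩ := Submodule.mem_sup.1 h1
  have hpk : p ∈ LinearMap.ker (toConf k N) := by
    simpa using sub_mem hh (totalSpan_empty_le_ker ht)
  -- The reduced part `p` lies in the kernel, so it is a linear relation between admissible words in
  -- `Conf(X, N)`, which must be trivial.
  have hli : LinearIndependent k (toConf k N ∘ reducedWord N (∅ : Set (OpFree k X))) := by
    have := (linearIndependent_confWord k N).comp
      (fun p : ReducedIndex N (∅ : Set (OpFree k X)) => ⟨p.1, p.2.1⟩)
      fun p q h => Subtype.ext (Subtype.mk.inj h)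
    convert this using 1
    exact funext fun p => toConf_reducedWord p
  rw [← span_reducedWord] at hp
  rw [Submodule.disjoint_def.1 (Submodule.range_ker_disjoint hli) p hp hpk, zero_add]
  exact ht

/-- The image of the relation module in `Conf(X, N)` is stable under the operators, hence an ideal
containing `S`. An element that dies in the quotient thus agrees with a relation up to the kernel of
`toConf`, which also consists of relations. -/
theorem ker_toConfMod (hT : toConf k N '' T = S) :
    LinearMap.ker (toConfMod S) = totalSpan k (ConfGenRel k N T) := by
  refine le_antisymm (fun h hh => ?_) (totalSpan_le_ker hT)
  have h0 : LinearMap.ker (toConf k N) ≤ totalSpan k (ConfGenRel k N T) := by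
    refine ker_toConf_le.trans (Submodule.span_mono ?_)
    rintro g ⟨w, hg | ⟨t, ht, hg⟩⟩
    · exact ⟨w, Or.inl hg⟩
    · exact ⟨w, Or.inr ⟨t, Or.inr (ht.resolve_left id), hg⟩⟩
  have hstable : ∀ c : OpWord X, ∀ f ∈ (totalSpan k (ConfGenRel k N T)).map (toConf k N),
      opAction k N (wd k c) f ∈ (totalSpan k (ConfGenRel k N T)).map (toConf k N) := by
    rintro c _ ⟨t, ht, rfl⟩
    exact ⟨_, smul_mem_totalSpan ht c, toConf_smul _ _⟩
  have hI : conformalIdealSpan k S ≤ (totalSpan k (ConfGenRel k N T)).map (toConf k N) := by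
    refine conformalIdealSpan_le (Conf.isConformalIdeal_of_stable (fun f hf => ?_)
      (fun n a f hf => ?_) fun n a f hf => ?_) ?_
    · have := hstable (.of .d) f hf
      rwa [opAction_wd_of] at this
    · have := hstable (.of (.L n a)) f hf
      rwa [opAction_wd_of] at this
    · have := hstable (.of (.R n a)) f hf
      rwa [opAction_wd_of] at this
    · rintro f hf
      obtain ⟨t, ht, rfl⟩ := hT.symm ▸ hf
      exact ⟨t, mem_totalSpan_of_mem ht, rfl⟩
  rw [LinearMap.mem_ker, toConfMod, LinearMap.comp_apply, Submodule.mkQ_apply,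
    Submodule.Quotient.mk_eq_zero] at hh
  obtain ⟨t, ht, hth⟩ := hI hh
  have h1 : h - t ∈ LinearMap.ker (toConf k N) := by
    rw [LinearMap.mem_ker, map_sub, hth, sub_self]
  simpa using add_mem (h0 h1) ht

/-- The reduced words span `Conf(X, N | S)`. -/
theorem span_reducedFamily (hT : toConf k N '' T = S) :
    Submodule.span k (Set.range (reducedFamily N T S)) = ⊤ := by
  have hsurj : LinearMap.range (toConf k N) = ⊤ := by
    refine Conf.eq_top_of_stable (fun a => ⟨atGen 1 a, ?_⟩) ?_ ?_
    · rw [toConf_atGen, map_one, Module.End.one_apply]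
    · rintro _ ⟨t, rfl⟩
      exact ⟨wd k (.of .d) • t, by rw [toConf_smul, opAction_wd_of]; rfl⟩
    · rintro n a _ ⟨t, rfl⟩
      exact ⟨wd k (.of (.L n a)) • t, by rw [toConf_smul, opAction_wd_of]; rfl⟩
  have hsurj' : LinearMap.range (toConfMod S) = ⊤ := by
    rw [toConfMod, LinearMap.range_comp, hsurj, Submodule.map_top, Submodule.range_mkQ]
  have hsup : reducedSpan (opBasis k X) (ConfGenRel k N T) ⊔ totalSpan k (ConfGenRel k N T) = ⊤ :=
    reducedSpan_sup_totalSpan (r := modWordLT) fun _ _ h => GenRel.hasLead h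
  rw [reducedFamily_eq, Set.range_comp, Submodule.span_image, span_reducedWord, ← hsurj',
    ← Submodule.map_top, ← hsup, Submodule.map_sup,
    LinearMap.le_ker_iff_map.1 (totalSpan_le_ker hT), sup_bot_eq]

/-- The reduced words are independent in the free module, so their images are independent exactly
when their span avoids the kernel of the evaluation. -/
theorem linearIndependent_reducedFamily_iff (hT : toConf k N '' T = S) :
    LinearIndependent k (reducedFamily N T S) ↔
      Disjoint (reducedSpan (opBasis k X) (ConfGenRel k N T))
        (totalSpan k (ConfGenRel k N T)) := by
  rw [reducedFamily_eq, ← ker_toConfMod hT, ← span_reducedWord]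
  exact ⟨Submodule.range_ker_disjoint, fun h => linearIndependent_reducedWord.map h⟩

end Kernel

end

/-! ### The equivalence of the two conditions -/

theorem mainTheorem4 {k : Type*} [Field k] [CharZero k] {X : Type*} [LinearOrder X]
    [WellFoundedLT X] (N : X → X → ℕ) (S : Set (Conf k N)) (T : Set (OpFree k X))
    (hT : Represents N T S) :
    IsGSB {f : OpAlg k X | AlgRel k f} (T ∪ {t : OpFree k X | BaseRel k N t}) ↔
      (LinearIndependent k (reducedFamily N T S) ∧
        Submodule.span k (Set.range (reducedFamily N T S)) = ⊤) := by
  rw [linearIndependent_reducedFamily_iff hT.2]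
  exact ⟨fun h => ⟨h.disjoint, span_reducedFamily hT.2⟩,
    fun h => isGSB_of_disjoint h.1 algRel_inter_trivial algRel_incl_trivial⟩
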